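/- Let $f(h)=h^{-6}-h^{-3}$ and $\bar h>0$. For $\varepsilon>0$, a steady state is a positive function $h\in C^2([0,1])$ with $$\varepsilon^2h_{xx}+f(h)-\int_0^1 f(h)\,dx=0\ \text{ on }(0,1),\qquad h(0)=h(1),\quad h_x(0)=h_x(1),\quad \int_0^1h\,dx=\bar h;$$ it is nontrivial if $h\not\equiv\bar h$. Call $\varepsilon_0>0$ a bifurcation point if every neighbourhood of $(\varepsilon_0,\bar h)$ in $(0,\infty)\times C^2([0,1])$ contains a pair $(\varepsilon,h)$ with $h$ a nontrivial steady state for $\varepsilon$. Call the bifurcation at $\varepsilon_0$ supercritical (in the parameter $1/\varepsilon$) if $1/\varepsilon>1/\varepsilon_0$ for all nontrivial steady states in some neighbourhood of $(\varepsilon_0,\bar h)$ and if, for every neighbourhood $U$ of $\bar h$ in $C^2([0,1])$, there is a nontrivial steady state in $U$ for every $\varepsilon$ with $1/\varepsilon>1/\varepsilon_0$ sufficiently close to $1/\varepsilon_0$; subcritical is the same with $1/\varepsilon<1/\varepsilon_0$. For $k\ge1$ put $$\varepsilon_k=\frac{\sqrt{f'(\bar h)}}{2k\pi},\qquad h_\pm=\Big(\frac{71\pm3\sqrt{102}}{19}\Big)^{1/3}.$$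 Then $1.259<2^{1/3}<1.26$, $|h_--1.289|<0.0005$, $|h_+-1.747|<0.0005$, and the following hold. (a) $\varepsilon_0>0$ is a bifurcation point if and only if $\bar h>2^{1/3}$ and $\varepsilon_0=\varepsilon_k$ for some $k\ge1$. (b) For every $k\ge 1$, the bifurcation at $\varepsilon_k$ is supercritical if $h_-<\bar h<h_+$, and subcritical if $2^{1/3}<\bar h<h_-$ or $\bar h>h_+$. If $\bar h>2^{1/3}$ and $\bar h\ne h_\pm$, then in a neighbourhood of $(\varepsilon_k,\bar h)$ any two nontrivial steady states with the same $\varepsilon$ are translates of each other modulo $1$ (they form one circle). (c) Let $\bar h>2^{1/3}$ and $k\ge1$. Write $G(v,\varepsilon)=\varepsilon^2v_{xx}+f(v+\bar h)-\int_0^1f(v+\bar h)\,dx$ for $v\in C^2([0,1])$ with zero mean, $v(0)=v(1)$, $v_x(0)=v_x(1)$; let $w_1=\cos(2k\pi\,\cdot)$, $w_2=\sin(2k\pi\,\cdot)$, let $M$ be the space of such $v$ that are $L^2(0,1)$-orthogonal to $w_1,w_2$, and let $E$ be the $L^2$-orthogonal projection onto $\{w_1,w_2\}^\perp$. Then the Liapunov–Schmidt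 reduction at $(v,\varepsilon)=(0,\varepsilon_k)$ exists: for $(x,y,\varepsilon)$ near $(0,0,\varepsilon_k)$ the equation $E\,G(xw_1+yw_2+W,\varepsilon)=0$ has a unique $C^2$-small solution $W=W(x,y,\varepsilon)\in M$. The reduced functions $g_i(x,y,\varepsilon)=\langle w_i,G(xw_1+yw_2+W(x,y,\varepsilon),\varepsilon)\rangle_{L^2}$ are $C^\infty$ at $(0,0,\varepsilon_k)$, they have near this point the form $g_1=x\,p(x^2+y^2,\varepsilon)$, $g_2=y\,p(x^2+y^2,\varepsilon)$ for some function $p$, and $$g_{1,xxx}(0,0,\varepsilon_k)=\frac{57\bar h^6-426\bar h^3+651}{2\bar h^9(\bar h^3-2)}.$$ The bifurcation at $\varepsilon_k$ is supercritical if $g_{1,xxx}(0,0,\varepsilon_k)<0$ and subcritical if $g_{1,xxx}(0,0,\varepsilon_k)>0$. -/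

import Mathlib

open Set Filter Topology
open scoped ContDiff

noncomputable section

namespace ThinFilm

/-- The (scaled) disjoining pressure. -/
def f (h : ℝ) : ℝ := 1 / h ^ 6 - 1 / h ^ 3

/-- The `n`-th derivative of a function on `[0,1]`, one-sided at the end points. -/
def D (n : ℕ) (v : ℝ → ℝ) (x : ℝ) : ℝ := iteratedDerivWithin n v (Icc 0 1) x

/-- `h` is a positive steady state on `[0,1]` with parameter `ε` and mean thickness `hbar`.
Values of `h` outside `[0,1]` play no role. -/
structure IsSteadyState (hbar ε : ℝ) (h : ℝ → ℝ) : Prop where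
  pos : ∀ x ∈ Icc (0 : ℝ) 1, 0 < h x
  smooth : ContDiffOn ℝ 2 h (Icc 0 1)
  eqn : ∀ x ∈ Ioo (0 : ℝ) 1, ε ^ 2 * D 2 h x + f (h x) - ∫ y in (0 : ℝ)..1, f (h y) = 0
  bc : h 0 = h 1
  bc_deriv : D 1 h 0 = D 1 h 1
  mean : ∫ x in (0 : ℝ)..1, h x = hbar

/-- A steady state that is not the constant `hbar`. -/
def IsNontrivialSteadyState (hbar ε : ℝ) (h : ℝ → ℝ) : Prop :=
  IsSteadyState hbar ε h ∧ ∃ x ∈ Icc (0 : ℝ) 1, h x ≠ hbar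

/-- `v` is smaller than `η` in the `C²([0,1])` norm (maximum of the sup norms of `v`, `v'`, `v''`). -/
def C2Small (η : ℝ) (v : ℝ → ℝ) : Prop :=
  ∀ n ≤ 2, ∀ x ∈ Icc (0 : ℝ) 1, |D n v x| < η

/-- Nontrivial steady states exist in every neighbourhood of `(ε₀, hbar)` in `(0,∞) × C²([0,1])`. -/
def IsBifurcationPoint (hbar ε₀ : ℝ) : Prop :=
  ∀ η > 0, ∃ ε > 0, |ε - ε₀| < η ∧
    ∃ h, IsNontrivialSteadyState hbar ε h ∧ C2Small η (fun x => h x - hbar)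

/-- Supercritical bifurcation at `ε₀` with respect to the parameter `1/ε`: close to `(ε₀, hbar)` all
nontrivial steady states have `1/ε > 1/ε₀`, and for each `1/ε` slightly larger than `1/ε₀` there are
nontrivial steady states arbitrarily close to `hbar`. -/
def IsSupercritical (hbar ε₀ : ℝ) : Prop :=
  (∃ η > 0, ∀ ε > 0, |ε - ε₀| < η → ∀ h, IsNontrivialSteadyState hbar ε h →
    C2Small η (fun x => h x - hbar) → 1 / ε₀ < 1 / ε) ∧
  ∀ η > 0, ∃ δ > 0, ∀ ε > 0, 1 / ε₀ < 1 / ε → 1 / ε < 1 / ε₀ + δ →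
    ∃ h, IsNontrivialSteadyState hbar ε h ∧ C2Small η (fun x => h x - hbar)

/-- Subcritical bifurcation at `ε₀` with respect to the parameter `1/ε`. -/
def IsSubcritical (hbar ε₀ : ℝ) : Prop :=
  (∃ η > 0, ∀ ε > 0, |ε - ε₀| < η → ∀ h, IsNontrivialSteadyState hbar ε h →
    C2Small η (fun x => h x - hbar) → 1 / ε < 1 / ε₀) ∧
  ∀ η > 0, ∃ δ > 0, ∀ ε > 0, 1 / ε₀ - δ < 1 / ε → 1 / ε < 1 / ε₀ →
    ∃ h, IsNontrivialSteadyState hbar ε h ∧ C2Small η (fun x => h x - hbar)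

/-- Close to `(ε₀, hbar)`, the nontrivial steady states with the same `ε` form a single circle: any
two of them are translates of each other (`Int.fract` realizes the translation modulo `1`). -/
def IsLocallyOneCircle (hbar ε₀ : ℝ) : Prop :=
  ∃ η > 0, ∀ ε > 0, |ε - ε₀| < η → ∀ h₁ h₂,
    IsNontrivialSteadyState hbar ε h₁ → C2Small η (fun x => h₁ x - hbar) →
    IsNontrivialSteadyState hbar ε h₂ → C2Small η (fun x => h₂ x - hbar) →
    ∃ s : ℝ, ∀ x ∈ Icc (0 : ℝ) 1, h₂ x = h₁ (Int.fract (x + s))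

/-- The bifurcation values `ε_k`. -/
def epsK (hbar : ℝ) (k : ℕ) : ℝ := √(deriv f hbar) / (2 * k * Real.pi)

/-- The steady-state operator in terms of the deviation `v = h - hbar`. -/
def G (hbar ε : ℝ) (v : ℝ → ℝ) (x : ℝ) : ℝ :=
  ε ^ 2 * D 2 v x + f (v x + hbar) - ∫ y in (0 : ℝ)..1, f (v y + hbar)

/-- The domain of `G`. -/
def DomG : Set (ℝ → ℝ) :=
  {v | ContDiffOn ℝ 2 v (Icc 0 1) ∧ v 0 = v 1 ∧ D 1 v 0 = D 1 v 1 ∧ ∫ x in (0 : ℝ)..1, v x = 0}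

/-- The `L²(0,1)` inner product. -/
def ip (u v : ℝ → ℝ) : ℝ := ∫ x in (0 : ℝ)..1, u x * v x

/-- First basis function of the kernel of the linearization `S w = ε_k² w'' + f'(hbar) w` of `G`
at `v = 0`. -/
def w₁ (k : ℕ) (x : ℝ) : ℝ := Real.cos (2 * k * Real.pi * x)

/-- Second basis function of the kernel of `S`. -/
def w₂ (k : ℕ) (x : ℝ) : ℝ := Real.sin (2 * k * Real.pi * x)

/-- The complement of `ker S` in the domain of `G`. -/
def M (k : ℕ) : Set (ℝ → ℝ) := {v | v ∈ DomG ∧ ip (w₁ k) v = 0 ∧ ip (w₂ k) v = 0}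

/-- The `L²`-orthogonal projection onto `range S = (ker S)^⊥`; note `ip wᵢ wᵢ = 1/2`. -/
def E (k : ℕ) (u : ℝ → ℝ) (x : ℝ) : ℝ :=
  u x - 2 * ip (w₁ k) u * w₁ k x - 2 * ip (w₂ k) u * w₂ k x

/-- `(g₁, g₂)` are the reduced functions of the Liapunov–Schmidt reduction of `G = 0` at
`(v, ε) = (0, ε_k)`: for `(x, y, ε)` near `(0, 0, ε_k)`, `W x y ε` is the unique small solution in `M`
of `E G(x w₁ + y w₂ + W) = 0`, and `gᵢ x y ε = ⟨wᵢ, G(x w₁ + y w₂ + W x y ε)⟩`. -/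
def IsLiapunovSchmidtReduction (hbar : ℝ) (k : ℕ) (g₁ g₂ : ℝ → ℝ → ℝ → ℝ) : Prop :=
  ∃ W : ℝ → ℝ → ℝ → ℝ → ℝ, ∃ r > 0, ∃ η > 0,
    ∀ x y ε, |x| < r → |y| < r → |ε - epsK hbar k| < r →
      (∀ u : ℝ → ℝ, u ∈ M k → C2Small η u →
        (∀ t ∈ Icc (0 : ℝ) 1, E k (G hbar ε (fun s => x * w₁ k s + y * w₂ k s + u s)) t = 0) →
        EqOn u (W x y ε) (Icc 0 1)) ∧
      W x y ε ∈ M k ∧ C2Small η (W x y ε) ∧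
      (∀ t ∈ Icc (0 : ℝ) 1,
        E k (G hbar ε (fun s => x * w₁ k s + y * w₂ k s + W x y ε s)) t = 0) ∧
      g₁ x y ε = ip (w₁ k) (G hbar ε (fun s => x * w₁ k s + y * w₂ k s + W x y ε s)) ∧
      g₂ x y ε = ip (w₂ k) (G hbar ε (fun s => x * w₁ k s + y * w₂ k s + W x y ε s))

/-- The derivative `∂³g/∂x³` at `(0, 0, ε)`. -/
def dxxx (g : ℝ → ℝ → ℝ → ℝ) (ε : ℝ) : ℝ := iteratedDeriv 3 (fun x => g x 0 ε) 0

/-- The threshold `2^{1/3} ≈ 1.259…`. -/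
def hZero : ℝ := (2 : ℝ) ^ (1 / 3 : ℝ)

/-- The threshold `≈ 1.289`, the smaller positive root of `57 h⁶ - 426 h³ + 651`. -/
def hMinus : ℝ := ((71 - 3 * √102) / 19) ^ (1 / 3 : ℝ)

/-- The threshold `≈ 1.747`, the larger positive root of `57 h⁶ - 426 h³ + 651`. -/
def hPlus : ℝ := ((71 + 3 * √102) / 19) ^ (1 / 3 : ℝ)

end ThinFilm

end

/-! Work in the Banach algebra `Per` of continuous functions on the circle. Let `K` be the inverse
of `d²/dx²` on mean-zero functions, extended by zero to constants. For `V = h - hbar` near `0`, the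
whole steady state problem (differential equation, nonlocal term, boundary conditions, mean
constraint) is the single equation `V + ε⁻² K f(hbar + V) = 0`. The superposition operator is
analytic because it is built from inversion in a Banach algebra. The linearization at `0` is `1 +
(f'(hbar)/ε²) K` with `K` compact, so it is invertible as soon as it is injective; by Fourier series
this fails only if `f'(hbar)/ε² = (2πn)²` for some `n ≥ 1`. Away from these values the inverse
function theorem leaves only the constant solution (`not_isBifurcationPoint`), and the exceptional
values are the `ε_k`, which exist exactly when `f'(hbar) > 0`, that is `hbar³ > 2`.

At `ε_k` the equation projected by `E` has an analytic solution operator `S(ε, z)`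
(`exists_isSolOp`); taking `z` in the kernel gives the Liapunov–Schmidt reduction. Uniqueness makes
`S` commute with translations and with the reflection, so both reduced functions are determined by
one scalar function `ray r ε`, odd in `r`. Its linear coefficient is `(f'(hbar) - (2kπ)² ε²)/2`
(`hasDerivAt_ray_zero`) and its third derivative at `ε_k` is `f''²/(8f') + 3f'''/8`
(`iteratedDeriv_ray`).

The linear coefficient changes sign at `ε_k`, so zeros `r > 0` accumulate there and every `ε_k` is a
bifurcation point. If the third derivative is nonzero then, up to sign, `ray` is strictly convex for
small `r ≥ 0` (`exists_strictConvexOn`). A positive zero is then unique, and it exists precisely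
when the signed linear coefficient is negative (`exists_zero_structure`). This yields the direction
of the bifurcation and the single circle of solutions. The sign of the third derivative is that of a
quadratic in `hbar³` with roots `hMinus³` and `hPlus³` (`numerator_eq`). -/

noncomputable section

namespace ThinFilm

/-! ### Periodic functions, the mean, and the compact inverse `K` of the second derivative. -/

/-- Continuous `1`-periodic functions, as a commutative Banach algebra. -/
abbrev Per := C(UnitAddCircle, ℝ)

/-- The element of `Per` given by a continuous `1`-periodic function on the line. -/
def ofPeriodic (g : ℝ → ℝ) (hg : Continuous g) (hp : Function.Periodic g 1) : Per :=
  ⟨hp.lift, continuous_coinduced_dom.2 hg⟩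

@[simp] lemma ofPeriodic_coe (g : ℝ → ℝ) (hg : Continuous g) (hp : Function.Periodic g 1) (x : ℝ) :
    ofPeriodic g hg hp (x : UnitAddCircle) = g x := rfl

namespace Per

lemma ext_coe {u v : Per} (h : ∀ x : ℝ, u (x : UnitAddCircle) = v (x : UnitAddCircle)) : u = v := by
  ext x
  induction x using QuotientAddGroup.induction_on with
  | H x => exact h x

lemma coe_fract (x : ℝ) : ((Int.fract x : ℝ) : UnitAddCircle) = (x : UnitAddCircle) := by
  rw [← Int.self_sub_floor, AddCircle.coe_sub, sub_eq_self]
  exact (AddCircle.coe_eq_zero_iff 1).2 ⟨⌊x⌋, by simp⟩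

lemma ext_Icc {u v : Per} (h : ∀ x ∈ Icc (0 : ℝ) 1, u (x : UnitAddCircle) = v (x : UnitAddCircle)) :
    u = v := by
  refine ext_coe fun x => ?_
  rw [← coe_fract]
  exact h _ ⟨Int.fract_nonneg x, (Int.fract_lt_one x).le⟩

lemma continuous_coe (u : Per) : Continuous fun x : ℝ => u (x : UnitAddCircle) :=
  u.continuous.comp (AddCircle.continuous_mk' 1)

lemma intervalIntegrable (u : Per) (a b : ℝ) :
    IntervalIntegrable (fun x : ℝ => u (x : UnitAddCircle)) MeasureTheory.volume a b :=
  u.continuous_coe.intervalIntegrable _ _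

lemma periodic_coe (u : Per) : Function.Periodic (fun x : ℝ => u (x : UnitAddCircle)) 1 := fun x => by
  simp

lemma norm_le_of_Icc {u : Per} {c : ℝ} (h : ∀ x ∈ Icc (0 : ℝ) 1, |u (x : UnitAddCircle)| ≤ c) :
    ‖u‖ ≤ c := by
  rw [ContinuousMap.norm_le_of_nonempty]
  intro x
  induction x using QuotientAddGroup.induction_on with
  | H x =>
    have := h _ ⟨Int.fract_nonneg x, (Int.fract_lt_one x).le⟩
    rw [coe_fract] at this
    exact this

lemma abs_le_norm (u : Per) (x : UnitAddCircle) : |u x| ≤ ‖u‖ := u.norm_coe_le_norm x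

@[simp] lemma algebraMap_eval (c : ℝ) (x : UnitAddCircle) : (algebraMap ℝ Per c) x = c := by
  simp [Algebra.algebraMap_eq_smul_one]

end Per

/-- The mean value over one period. -/
def mean : Per →L[ℝ] ℝ :=
  LinearMap.mkContinuous
    { toFun := fun u => ∫ x in (0 : ℝ)..1, u (x : UnitAddCircle)
      map_add' := fun u v => by
        simp only [ContinuousMap.add_apply]
        exact intervalIntegral.integral_add (u.intervalIntegrable _ _) (v.intervalIntegrable _ _)
      map_smul' := fun c u => by simp } 1
    (fun u => by
      have := intervalIntegral.norm_integral_le_of_norm_le_const (a := (0 : ℝ)) (b := 1) (C := ‖u‖)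
        (f := fun x : ℝ => u (x : UnitAddCircle)) (fun x _ => u.norm_coe_le_norm _)
      simpa using this)

lemma mean_apply (u : Per) : mean u = ∫ x in (0 : ℝ)..1, u (x : UnitAddCircle) := rfl

@[simp] lemma mean_const (c : ℝ) : mean (algebraMap ℝ Per c) = c := by simp [mean_apply]

@[simp] lemma mean_one : mean 1 = 1 := by simp [mean_apply]

lemma abs_mean_le (u : Per) : |mean u| ≤ ‖u‖ := by
  have := intervalIntegral.norm_integral_le_of_norm_le_const (a := (0 : ℝ)) (b := 1) (C := ‖u‖)
    (f := fun x : ℝ => u (x : UnitAddCircle)) (fun x _ => u.norm_coe_le_norm _)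
  simpa [mean_apply] using this

lemma periodic_primitive (u : Per) :
    Function.Periodic (fun x : ℝ => ∫ t in (0 : ℝ)..x, (u (t : UnitAddCircle) - mean u)) 1 := by
  intro x
  have hi : ∀ a b, IntervalIntegrable (fun t : ℝ => u (t : UnitAddCircle) - mean u)
      MeasureTheory.volume a b := fun a b =>
    (u.continuous_coe.sub continuous_const).intervalIntegrable _ _
  have hp : Function.Periodic (fun t : ℝ => u (t : UnitAddCircle) - mean u) 1 := fun t => by
    simp
  have h := hp.intervalIntegral_add_eq x 0
  have h0 : ∫ t in (0 : ℝ)..0 + 1, (u (t : UnitAddCircle) - mean u) = 0 := by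
    rw [intervalIntegral.integral_sub (u.intervalIntegrable _ _) (by simp)]
    simp [mean_apply]
  simp only
  rw [← intervalIntegral.integral_add_adjacent_intervals (hi 0 x) (hi x (x + 1)), h, h0, add_zero]

lemma hasDerivAt_primitive (u : Per) (x : ℝ) :
    HasDerivAt (fun x : ℝ => ∫ t in (0 : ℝ)..x, (u (t : UnitAddCircle) - mean u))
      (u (x : UnitAddCircle) - mean u) x :=
  ((u.continuous_coe.sub continuous_const).integral_hasStrictDerivAt 0 x).hasDerivAt

/-- The primitive of `u - mean u` that vanishes at `0`. -/
def primitive (u : Per) : Per :=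
  ofPeriodic (fun x : ℝ => ∫ t in (0 : ℝ)..x, (u (t : UnitAddCircle) - mean u))
    (continuous_iff_continuousAt.2 fun x => (hasDerivAt_primitive u x).continuousAt)
    (periodic_primitive u)

lemma norm_primitive_le (u : Per) : ‖primitive u‖ ≤ 2 * ‖u‖ := by
  refine Per.norm_le_of_Icc fun x hx => ?_
  have := intervalIntegral.norm_integral_le_of_norm_le_const (a := (0 : ℝ)) (b := x) (C := 2 * ‖u‖)
        (f := fun x : ℝ => u (x : UnitAddCircle) - mean u) (fun x _ => by
          have h1 := u.abs_le_norm x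
          have h2 := abs_mean_le u
          have h3 := abs_sub (u (x : UnitAddCircle)) (mean u)
          rw [Real.norm_eq_abs]; linarith)
  rw [primitive, ofPeriodic_coe]
  rw [Real.norm_eq_abs, sub_zero, abs_of_nonneg hx.1] at this
  refine this.trans ?_
  have := norm_nonneg u
  nlinarith [hx.2]

/-- The inverse of `d/dx` on periodic functions of mean zero, precomposed with the projection onto
them: `J u` is the primitive of mean zero of `u - mean u`. -/
def J : Per →L[ℝ] Per :=
  LinearMap.mkContinuous
    { toFun := fun u => primitive u - algebraMap ℝ Per (mean (primitive u))
      map_add' := fun u v => by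
        have h : primitive (u + v) = primitive u + primitive v := by
          refine Per.ext_coe fun x => ?_
          simp only [primitive, ofPeriodic_coe, ContinuousMap.add_apply, map_add]
          rw [← intervalIntegral.integral_add
            ((u.intervalIntegrable _ _).sub intervalIntegrable_const)
            ((v.intervalIntegrable _ _).sub intervalIntegrable_const)]
          congr 1; ext t; ring
        rw [h, map_add, map_add]; abel
      map_smul' := fun c u => by
        have h : primitive (c • u) = c • primitive u := by
          refine Per.ext_coe fun x => ?_
          simp only [primitive, ofPeriodic_coe, ContinuousMap.smul_apply, map_smul, smul_eq_mul]
          rw [← intervalIntegral.integral_const_mul]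
          congr 1; ext t; ring
        ext x
        simp [h]; ring } 4
    (fun u => by
      have h1 := norm_primitive_le u
      have h2 := abs_mean_le (primitive u)
      have h3 := norm_sub_le (primitive u) (algebraMap ℝ Per (mean (primitive u)))
      rw [norm_algebraMap', Real.norm_eq_abs] at h3
      change ‖primitive u - algebraMap ℝ Per (mean (primitive u))‖ ≤ _
      linarith)

lemma J_apply (u : Per) : J u = primitive u - algebraMap ℝ Per (mean (primitive u)) := rfl

lemma hasDerivAt_J (u : Per) (x : ℝ) :
    HasDerivAt (fun x : ℝ => J u (x : UnitAddCircle)) (u (x : UnitAddCircle) - mean u) x := by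
  simpa [J_apply, primitive] using (hasDerivAt_primitive u x).sub_const (mean (primitive u))

@[simp] lemma mean_J (u : Per) : mean (J u) = 0 := by simp [J_apply]

lemma mean_eq_zero_of_hasDerivAt {U u : Per}
    (h : ∀ x ∈ Ioo (0 : ℝ) 1, HasDerivAt (fun x : ℝ => U (x : UnitAddCircle)) (u (x : UnitAddCircle)) x) :
    mean u = 0 := by
  rw [mean_apply, intervalIntegral.integral_eq_sub_of_hasDerivAt_of_le zero_le_one
    U.continuous_coe.continuousOn h (u.intervalIntegrable _ _)]
  have := U.periodic_coe 0
  simp only [zero_add] at this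
  rw [this, sub_self]

/-- Derivatives are required on the open interval only, because functions given on `[0,1]` have
two-sided derivatives only there. -/
lemma J_eq_of_hasDerivAt {U u : Per} (h : ∀ x ∈ Ioo (0 : ℝ) 1,
      HasDerivAt (fun x : ℝ => U (x : UnitAddCircle)) (u (x : UnitAddCircle) - mean u) x) :
    J u = U - algebraMap ℝ Per (mean U) := by
  have hc : ∀ x ∈ Icc (0 : ℝ) 1, (J u - U) (x : UnitAddCircle) = (J u - U) ((0 : ℝ) : UnitAddCircle) := by
    refine constant_of_has_deriv_right_zero (J u - U).continuous_coe.continuousOn ?_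
    intro x hx
    rcases eq_or_lt_of_le hx.1 with rfl | h0
    · have hd : ∀ x ∈ Ioo (0 : ℝ) 1, HasDerivAt (fun x : ℝ => (J u - U) (x : UnitAddCircle)) 0 x :=
        fun x hx => by simpa using (hasDerivAt_J u x).fun_sub (h x hx)
      -- At the end point `0` the right derivative is the limit of the interior derivatives, which
      -- are all zero.
      have := hasDerivWithinAt_Ici_of_tendsto_deriv (s := Ioo (0 : ℝ) 1) (a := (0 : ℝ)) (e := (0 : ℝ))
        (f := fun x : ℝ => (J u - U) (x : UnitAddCircle))
        (fun x hx => (hd x hx).differentiableAt.differentiableWithinAt)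
        (J u - U).continuous_coe.continuousWithinAt (Ioo_mem_nhdsGT zero_lt_one)
        (by
          refine (tendsto_const_nhds (x := (0 : ℝ))).congr' ?_
          filter_upwards [Ioo_mem_nhdsGT (zero_lt_one (α := ℝ))] with x hx
          exact (hd x hx).deriv.symm)
      exact this
    · have := (hasDerivAt_J u x).fun_sub (h x ⟨h0, hx.2⟩)
      simpa using this.hasDerivWithinAt
  have h2 : J u - U = algebraMap ℝ Per ((J u - U) ((0 : ℝ) : UnitAddCircle)) :=
    Per.ext_Icc fun x hx => by rw [hc x hx]; simp
  have h3 := congrArg mean h2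
  rw [mean_const, map_sub, mean_J, zero_sub] at h3
  rw [← h3, map_neg] at h2
  linear_combination h2

lemma J_const (c : ℝ) : J (algebraMap ℝ Per c) = 0 := by
  have := J_eq_of_hasDerivAt (U := 0) (u := algebraMap ℝ Per c) (fun x _ => by
    simpa using hasDerivAt_const x (0 : ℝ))
  simpa using this

/-- Integration by parts: the derivative of the periodic function `J u * J v` has mean zero, and the
subtracted constants do not contribute since `J u` and `J v` have mean zero. Applied twice it makes
`K` self-adjoint. -/
lemma mean_J_mul (u v : Per) : mean (J u * v) = -mean (u * J v) := by
  have h := mean_eq_zero_of_hasDerivAt (U := J u * J v)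
    (u := (u - algebraMap ℝ Per (mean u)) * J v + J u * (v - algebraMap ℝ Per (mean v)))
    (fun x _ => by simpa using (hasDerivAt_J u x).fun_mul (hasDerivAt_J v x))
  simp only [sub_mul, mul_sub, map_add, map_sub] at h
  have e1 : mean (algebraMap ℝ Per (mean u) * J v) = 0 := by
    rw [← Algebra.smul_def, map_smul, mean_J, smul_zero]
  have e2 : mean (J u * algebraMap ℝ Per (mean v)) = 0 := by
    rw [mul_comm, ← Algebra.smul_def, map_smul, mean_J, smul_zero]
  rw [e1, e2] at h
  linarith

/-- The inverse of `d²/dx²` on periodic functions of mean zero, precomposed with the projection onto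
them. -/
def K : Per →L[ℝ] Per := J ∘L J

lemma K_apply (u : Per) : K u = J (J u) := rfl

lemma K_const (c : ℝ) : K (algebraMap ℝ Per c) = 0 := by rw [K_apply, J_const, map_zero]

@[simp] lemma mean_K (u : Per) : mean (K u) = 0 := mean_J _

lemma mean_K_mul (u v : Per) : mean (K u * v) = mean (u * K v) := by
  rw [K_apply, K_apply, mean_J_mul, mean_J_mul, neg_neg]

lemma abs_J_sub_le (u : Per) (x y : ℝ) :
    |J u (x : UnitAddCircle) - J u (y : UnitAddCircle)| ≤ 2 * ‖u‖ * |x - y| := by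
  have := convex_univ.norm_image_sub_le_of_norm_hasDerivWithin_le (𝕜 := ℝ) (s := univ)
    (f := fun x : ℝ => J u (x : UnitAddCircle)) (C := 2 * ‖u‖)
    (fun x _ => (hasDerivAt_J u x).hasDerivWithinAt) (fun x _ => by
      have h1 := u.abs_le_norm x
      have h2 := abs_mean_le u
      have h3 := abs_sub (u (x : UnitAddCircle)) (mean u)
      rw [Real.norm_eq_abs]; linarith) (mem_univ y) (mem_univ x)
  simpa using this

/-- Arzelà–Ascoli: the image of the unit ball is bounded, and equicontinuous by the common Lipschitz
constant `2`. -/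
lemma isCompactOperator_J : IsCompactOperator J := by
  change IsCompactOperator (J : Per →ₗ[ℝ] Per)
  rw [isCompactOperator_iff_isCompact_closure_image_ball _ zero_lt_one]
  let e := ContinuousMap.isometryEquivBoundedOfCompact UnitAddCircle ℝ
  have hc := BoundedContinuousFunction.arzela_ascoli (Metric.closedBall (0 : ℝ) ‖J‖)
    (isCompact_closedBall _ _) (e '' (J '' Metric.ball 0 1)) (by
      rintro _ x ⟨_, ⟨u, hu, rfl⟩, rfl⟩
      change J u x ∈ _
      rw [mem_closedBall_zero_iff]
      refine ((J u).norm_coe_le_norm x).trans ((J.le_opNorm u).trans ?_)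
      rw [mem_ball_zero_iff] at hu
      nlinarith [norm_nonneg J]) (by
      intro x
      rw [Metric.equicontinuousAt_iff_right]
      intro δ hδ
      induction x using QuotientAddGroup.induction_on with
      | H x =>
        have h1 : ∀ᶠ y in 𝓝 x, |x - y| < δ / 2 := by
          filter_upwards [Metric.ball_mem_nhds x (half_pos hδ)] with y hy
          rwa [Metric.mem_ball, dist_comm, Real.dist_eq] at hy
        have h2 := (QuotientAddGroup.isOpenMap_coe (N := AddSubgroup.zmultiples (1 : ℝ))).image_mem_nhds h1
        filter_upwards [h2]
        rintro _ ⟨y, hy, rfl⟩ ⟨_, ⟨_, ⟨u, hu, rfl⟩, rfl⟩⟩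
        change |J u (x : UnitAddCircle) - J u (y : UnitAddCircle)| < δ
        have h3 := abs_J_sub_le u x y
        rw [mem_ball_zero_iff] at hu
        change |x - y| < δ / 2 at hy
        nlinarith [norm_nonneg u, abs_nonneg (x - y)])
  rw [← e.coe_toHomeomorph, ← e.toHomeomorph.image_closure, e.toHomeomorph.isCompact_image] at hc
  exact hc

lemma isCompactOperator_K : IsCompactOperator K :=
  isCompactOperator_J.clm_comp J

/-! ### Trigonometric eigenfunctions of `K` and Fourier uniqueness. -/

lemma w₁_periodic (n : ℕ) : Function.Periodic (w₁ n) 1 := fun x => by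
  have : 2 * (n : ℝ) * Real.pi * (x + 1) = 2 * n * Real.pi * x + n * (2 * Real.pi) := by ring
  rw [w₁, w₁, this, Real.cos_add_nat_mul_two_pi]

lemma w₂_periodic (n : ℕ) : Function.Periodic (w₂ n) 1 := fun x => by
  have : 2 * (n : ℝ) * Real.pi * (x + 1) = 2 * n * Real.pi * x + n * (2 * Real.pi) := by ring
  rw [w₂, w₂, this, Real.sin_add_nat_mul_two_pi]

/-- `x ↦ cos (2πnx)` as a periodic function. -/
def cosPer (n : ℕ) : Per := ofPeriodic (w₁ n) (by unfold w₁; fun_prop) (w₁_periodic n)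

/-- `x ↦ sin (2πnx)` as a periodic function. -/
def sinPer (n : ℕ) : Per := ofPeriodic (w₂ n) (by unfold w₂; fun_prop) (w₂_periodic n)

@[simp] lemma cosPer_coe (n : ℕ) (x : ℝ) : cosPer n (x : UnitAddCircle) = w₁ n x := rfl
@[simp] lemma sinPer_coe (n : ℕ) (x : ℝ) : sinPer n (x : UnitAddCircle) = w₂ n x := rfl

lemma hasDerivAt_w₁ (n : ℕ) (x : ℝ) : HasDerivAt (w₁ n) (-(2 * n * Real.pi) * w₂ n x) x := by
  have := ((hasDerivAt_id x).const_mul (2 * (n : ℝ) * Real.pi)).cos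
  simp only [id, mul_one] at this
  convert! this using 1
  simp [w₂]; ring

lemma hasDerivAt_w₂ (n : ℕ) (x : ℝ) : HasDerivAt (w₂ n) ((2 * n * Real.pi) * w₁ n x) x := by
  have := ((hasDerivAt_id x).const_mul (2 * (n : ℝ) * Real.pi)).sin
  simp only [id, mul_one] at this
  convert! this using 1
  simp [w₁]; ring

lemma freq_ne_zero {n : ℕ} (hn : 1 ≤ n) : 2 * (n : ℝ) * Real.pi ≠ 0 := by
  have : (n : ℝ) ≠ 0 := by positivity
  have := Real.pi_ne_zero
  positivity

lemma mean_cosPer {n : ℕ} (hn : 1 ≤ n) : mean (cosPer n) = 0 := by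
  have h := mean_eq_zero_of_hasDerivAt (U := sinPer n) (u := (2 * n * Real.pi) • cosPer n)
    (fun x _ => by simpa using hasDerivAt_w₂ n x)
  rw [map_smul, smul_eq_mul] at h
  exact (mul_eq_zero.1 h).resolve_left (freq_ne_zero hn)

lemma mean_sinPer (n : ℕ) : mean (sinPer n) = 0 := by
  rcases Nat.eq_zero_or_pos n with rfl | hn
  · have : sinPer 0 = 0 := Per.ext_coe fun x => by simp [w₂]
    rw [this, map_zero]
  have h := mean_eq_zero_of_hasDerivAt (U := cosPer n) (u := (-(2 * n * Real.pi)) • sinPer n)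
    (fun x _ => by simpa using hasDerivAt_w₁ n x)
  rw [map_smul, smul_eq_mul] at h
  exact (mul_eq_zero.1 h).resolve_left (neg_ne_zero.2 (freq_ne_zero hn))

lemma J_cosPer {n : ℕ} (hn : 1 ≤ n) : J (cosPer n) = (2 * n * Real.pi)⁻¹ • sinPer n := by
  have h := J_eq_of_hasDerivAt (U := (2 * n * Real.pi)⁻¹ • sinPer n) (u := cosPer n)
    (fun x _ => by
      have := (hasDerivAt_w₂ n x).const_mul (2 * (n : ℝ) * Real.pi)⁻¹
      rw [inv_mul_cancel_left₀ (freq_ne_zero hn)] at this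
      simpa [mean_cosPer hn] using this)
  rw [h, map_smul, mean_sinPer, smul_zero, map_zero, sub_zero]

lemma J_sinPer {n : ℕ} (hn : 1 ≤ n) : J (sinPer n) = -(2 * n * Real.pi)⁻¹ • cosPer n := by
  have h := J_eq_of_hasDerivAt (U := -(2 * n * Real.pi)⁻¹ • cosPer n) (u := sinPer n)
    (fun x _ => by
      have := (hasDerivAt_w₁ n x).const_mul (-(2 * (n : ℝ) * Real.pi)⁻¹)
      rw [neg_mul, neg_mul, mul_neg, neg_neg, inv_mul_cancel_left₀ (freq_ne_zero hn)] at this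
      simpa [mean_sinPer n] using this)
  rw [h, map_smul, mean_cosPer hn, smul_zero, map_zero, sub_zero]

lemma K_cosPer {n : ℕ} (hn : 1 ≤ n) : K (cosPer n) = -((2 * n * Real.pi) ^ 2)⁻¹ • cosPer n := by
  rw [K_apply, J_cosPer hn, map_smul, J_sinPer hn, smul_smul]
  congr 1; ring

lemma K_sinPer {n : ℕ} (hn : 1 ≤ n) : K (sinPer n) = -((2 * n * Real.pi) ^ 2)⁻¹ • sinPer n := by
  rw [K_apply, J_sinPer hn, map_smul, J_cosPer hn, smul_smul]
  congr 1; ring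

lemma cosPer_zero : cosPer 0 = 1 := Per.ext_coe fun x => by simp [w₁]

lemma cosPer_mul_cosPer (n m : ℕ) :
    cosPer (n + m) * cosPer n = (1 / 2 : ℝ) • cosPer m + (1 / 2 : ℝ) • cosPer (2 * n + m) :=
  Per.ext_coe fun x => by
    have h1 : 2 * ((2 * n + m : ℕ) : ℝ) * Real.pi * x =
      2 * ((n + m : ℕ) : ℝ) * Real.pi * x + 2 * n * Real.pi * x := by push_cast; ring
    have h2 : 2 * (m : ℝ) * Real.pi * x =
      2 * ((n + m : ℕ) : ℝ) * Real.pi * x - 2 * n * Real.pi * x := by push_cast; ring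
    simp only [ContinuousMap.mul_apply, ContinuousMap.add_apply, ContinuousMap.smul_apply,
      cosPer_coe, w₁, h1, h2, smul_eq_mul]
    rw [Real.cos_add, Real.cos_sub]; ring

lemma cosPer_mul_sinPer (n : ℕ) : cosPer n * sinPer n = (1 / 2 : ℝ) • sinPer (2 * n) :=
  Per.ext_coe fun x => by
    have h1 : 2 * ((2 * n : ℕ) : ℝ) * Real.pi * x = 2 * (2 * n * Real.pi * x) := by push_cast; ring
    simp only [ContinuousMap.mul_apply, ContinuousMap.smul_apply,
      cosPer_coe, sinPer_coe, w₁, w₂, h1, smul_eq_mul]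
    rw [Real.sin_two_mul]; ring

lemma cosPer_sq_add_sinPer_sq (n : ℕ) : cosPer n * cosPer n + sinPer n * sinPer n = 1 :=
  Per.ext_coe fun x => by
    simp only [ContinuousMap.mul_apply, ContinuousMap.add_apply, cosPer_coe, sinPer_coe, w₁, w₂,
      ContinuousMap.one_apply]
    nlinarith [Real.cos_sq_add_sin_sq (2 * n * Real.pi * x)]

lemma cosPer_mul_self (n : ℕ) :
    cosPer n * cosPer n = algebraMap ℝ Per (1 / 2) + (1 / 2 : ℝ) • cosPer (2 * n) := by
  have h := cosPer_mul_cosPer n 0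
  rwa [cosPer_zero, ← Algebra.algebraMap_eq_smul_one] at h

lemma mean_cosPer_mul_self {n : ℕ} (hn : 1 ≤ n) : mean (cosPer n * cosPer n) = 1 / 2 := by
  rw [cosPer_mul_self, map_add, mean_const, map_smul, mean_cosPer (by omega), smul_zero, add_zero]

lemma mean_sinPer_mul_self {n : ℕ} (hn : 1 ≤ n) : mean (sinPer n * sinPer n) = 1 / 2 := by
  have h := congrArg mean (cosPer_sq_add_sinPer_sq n)
  rw [map_add, mean_cosPer_mul_self hn, mean_one] at h
  linarith

lemma mean_cosPer_mul_sinPer (n : ℕ) : mean (cosPer n * sinPer n) = 0 := by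
  rw [cosPer_mul_sinPer, map_smul, mean_sinPer, smul_zero]

/-- A periodic function as a complex-valued one. -/
def toComplex (u : Per) : C(UnitAddCircle, ℂ) := ⟨fun x => (u x : ℂ), by fun_prop⟩

/-- The sign `σ` translates the integer frequencies of complex Fourier series into the natural
frequencies of `cosPer` and `sinPer`. -/
lemma fourier_smul_toComplex (u : Per) (n : ℤ) (m : ℕ) (σ : ℝ) (hn : (n : ℝ) = σ * m)
    (hσ : σ = 1 ∨ σ = -1) (x : ℝ) :
    fourier (-n) (x : UnitAddCircle) • toComplex u x =
      (((cosPer m * u) (x : UnitAddCircle) : ℝ) : ℂ) -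
        (σ * Complex.I) * (((sinPer m * u) (x : UnitAddCircle) : ℝ) : ℂ) := by
  have e1 : 2 * (Real.pi : ℂ) * Complex.I * ((-n : ℤ) : ℂ) * x / (1 : ℝ) =
      ((-σ * (2 * m * Real.pi * x) : ℝ) : ℂ) * Complex.I := by
    have : (n : ℂ) = σ * m := by exact_mod_cast congrArg (fun z : ℝ => (z : ℂ)) hn
    push_cast
    rw [this]; ring
  rw [fourier_coe_apply, e1, Complex.exp_mul_I, ← Complex.ofReal_cos, ← Complex.ofReal_sin]
  rcases hσ with rfl | rfl
  · simp [toComplex, w₁, w₂]; ring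
  · simp [toComplex, w₁, w₂]; ring

lemma fourierCoeff_toComplex (u : Per) (n : ℤ) (m : ℕ) (σ : ℝ) (hn : (n : ℝ) = σ * m)
    (hσ : σ = 1 ∨ σ = -1) :
    fourierCoeff (toComplex u) n = mean (cosPer m * u) - σ * Complex.I * mean (sinPer m * u) := by
  rw [fourierCoeff_eq_intervalIntegral _ _ 0]
  simp_rw [fourier_smul_toComplex u n m σ hn hσ]
  rw [zero_add, intervalIntegral.integral_sub, intervalIntegral.integral_const_mul,
    intervalIntegral.integral_ofReal, intervalIntegral.integral_ofReal, ← mean_apply, ← mean_apply]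
  · simp
  · exact (Complex.continuous_ofReal.comp (cosPer m * u).continuous_coe).intervalIntegrable _ _
  · exact (continuous_const.mul
      (Complex.continuous_ofReal.comp (sinPer m * u).continuous_coe)).intervalIntegrable _ _

/-- Vanishing coefficients are summable, so the Fourier series converges pointwise to `u`, while its
sum is zero. -/
lemma eq_zero_of_fourier {u : Per} (hc : ∀ n, mean (cosPer n * u) = 0)
    (hs : ∀ n, mean (sinPer n * u) = 0) : u = 0 := by
  have hcoef : fourierCoeff (toComplex u) = 0 := by
    funext n
    rcases Int.natAbs_eq n with h | h
    · have h' := congrArg (fun z : ℤ => (z : ℝ)) h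
      rw [fourierCoeff_toComplex u n n.natAbs 1 (by simpa using h') (Or.inl rfl), hc, hs]
      simp
    · have h' := congrArg (fun z : ℤ => (z : ℝ)) h
      rw [fourierCoeff_toComplex u n n.natAbs (-1) (by simpa using h') (Or.inr rfl), hc, hs]
      simp
  ext x
  have hsum := has_pointwise_sum_fourier_series_of_summable (f := toComplex u)
    (by rw [hcoef]; exact summable_zero) x
  rw [hcoef] at hsum
  simp only [Pi.zero_apply, zero_smul] at hsum
  have := hsum.unique hasSum_zero
  simpa [toComplex] using this

lemma mean_mul_K_of_eigen {w u : Per} {c : ℝ} (hw : K w = c • w) :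
    mean (w * K u) = c * mean (w * u) := by
  rw [← mean_K_mul, hw, smul_mul_assoc, map_smul, smul_eq_mul]

/-- A solution of `u'' = -μ u` of mean zero vanishes unless `μ` is one of the numbers `(2πn)²` and `u`
has a component along the corresponding trigonometric functions. -/
lemma eq_zero_of_add_smul_K_eq_zero {u : Per} {μ : ℝ} (h : u + μ • K u = 0)
    (hres : ∀ n : ℕ, 1 ≤ n → μ = (2 * n * Real.pi) ^ 2 →
      mean (cosPer n * u) = 0 ∧ mean (sinPer n * u) = 0) : u = 0 := by
  have key : ∀ (n : ℕ) (w : Per), 1 ≤ n → K w = -((2 * n * Real.pi) ^ 2)⁻¹ • w →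
      μ ≠ (2 * n * Real.pi) ^ 2 → mean (w * u) = 0 := by
    intro n w hn hw hne
    -- Pairing with an eigenfunction `w` moves `K` onto `w` by self-adjointness and leaves a scalar
    -- multiple of `mean (w * u)`.
    have h1 := congrArg (fun z => mean (w * z)) h
    simp only [mul_add, mul_smul_comm, map_add, map_smul, mul_zero, map_zero, smul_eq_mul,
      mean_mul_K_of_eigen hw] at h1
    have h2 : (2 * (n : ℝ) * Real.pi) ^ 2 ≠ 0 := pow_ne_zero 2 (freq_ne_zero hn)
    have h3 : ((2 * (n : ℝ) * Real.pi) ^ 2 - μ) * mean (w * u) = 0 := by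
      field_simp at h1
      linear_combination h1
    exact (mul_eq_zero.1 h3).resolve_left (sub_ne_zero.2 hne.symm)
  refine eq_zero_of_fourier (fun n => ?_) (fun n => ?_)
  · rcases Nat.eq_zero_or_pos n with rfl | hn
    · have h1 := congrArg mean h
      rw [map_add, map_smul, mean_K, smul_zero, add_zero, map_zero] at h1
      rw [cosPer_zero, one_mul, h1]
    · by_cases hne : μ = (2 * n * Real.pi) ^ 2
      · exact (hres n hn hne).1
      · exact key n _ hn (K_cosPer hn) hne
  · rcases Nat.eq_zero_or_pos n with rfl | hn
    · have : sinPer 0 = 0 := Per.ext_coe fun x => by simp [w₂]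
      rw [this, zero_mul, map_zero]
    · by_cases hne : μ = (2 * n * Real.pi) ^ 2
      · exact (hres n hn hne).2
      · exact key n _ hn (K_sinPer hn) hne

/-! ### The projection `E` and the Fredholm alternative. -/

/-- The `L²` projection onto the complement of `cos (2πkx)` and `sin (2πkx)`. -/
def projE (k : ℕ) : Per →L[ℝ] Per :=
  ContinuousLinearMap.id ℝ Per
    - ((2 : ℝ) • (mean ∘L ContinuousLinearMap.mul ℝ Per (cosPer k))).smulRight (cosPer k)
    - ((2 : ℝ) • (mean ∘L ContinuousLinearMap.mul ℝ Per (sinPer k))).smulRight (sinPer k)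

lemma projE_apply (k : ℕ) (u : Per) : projE k u =
    u - (2 * mean (cosPer k * u)) • cosPer k - (2 * mean (sinPer k * u)) • sinPer k := rfl

section projE
variable {k : ℕ} (hk : 1 ≤ k)
include hk

lemma mean_cosPer_mul_projE (u : Per) : mean (cosPer k * projE k u) = 0 := by
  simp only [projE_apply, mul_sub, mul_smul_comm, map_sub, map_smul, mean_cosPer_mul_self hk,
    mean_cosPer_mul_sinPer, smul_eq_mul]
  ring

lemma mean_sinPer_mul_projE (u : Per) : mean (sinPer k * projE k u) = 0 := by
  simp only [projE_apply, mul_sub, mul_smul_comm, map_sub, map_smul, mean_sinPer_mul_self hk,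
    mul_comm (sinPer k) (cosPer k), mean_cosPer_mul_sinPer, smul_eq_mul]
  ring

lemma projE_cosPer : projE k (cosPer k) = 0 := by
  simp [projE_apply, mean_cosPer_mul_self hk, mul_comm (sinPer k), mean_cosPer_mul_sinPer]

lemma projE_sinPer : projE k (sinPer k) = 0 := by
  simp [projE_apply, mean_sinPer_mul_self hk, mean_cosPer_mul_sinPer]

lemma mean_projE (u : Per) : mean (projE k u) = mean u := by
  simp [projE_apply, mean_cosPer hk, mean_sinPer]

lemma projE_K (u : Per) : projE k (K u) = K (projE k u) := by
  simp only [projE_apply, mean_mul_K_of_eigen (K_cosPer hk), mean_mul_K_of_eigen (K_sinPer hk),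
    map_sub, map_smul, K_cosPer hk, K_sinPer hk]
  module

omit hk in
lemma projE_eq_self {u : Per} (hc : mean (cosPer k * u) = 0) (hs : mean (sinPer k * u) = 0) :
    projE k u = u := by simp [projE_apply, hc, hs]

/-- Injectivity of the projected linearization at resonance. The equation forces `u` into the range
of `E`, so `u` has no component in the only resonant mode, and `E` may be dropped. -/
lemma eq_zero_of_add_smul_projE_K_eq_zero {u : Per}
    (h : u + ((2 * k * Real.pi) ^ 2) • projE k (K u) = 0) : u = 0 := by
  have hc : mean (cosPer k * u) = 0 := by
    have := congrArg (fun z => mean (cosPer k * z)) h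
    simpa [mul_add, mean_cosPer_mul_projE hk] using this
  have hs : mean (sinPer k * u) = 0 := by
    have := congrArg (fun z => mean (sinPer k * z)) h
    simpa [mul_add, mean_sinPer_mul_projE hk] using this
  rw [projE_K hk, projE_eq_self hc hs] at h
  refine eq_zero_of_add_smul_K_eq_zero h fun n hn hne => ?_
  have : n = k := by
    have h2 := abs_eq_abs.2 ((sq_eq_sq_iff_eq_or_eq_neg).1 hne)
    have hp := Real.pi_pos
    rw [abs_of_nonneg (by positivity), abs_of_nonneg (by positivity)] at h2
    have h3 := mul_right_cancel₀ hp.ne' h2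
    have h4 : (k : ℝ) = n := by linarith
    exact_mod_cast h4.symm
  subst this
  exact ⟨hc, hs⟩

end projE

/-- A compact perturbation of the identity that is injective is invertible. -/
lemma exists_equiv_one_add_of_injective {X : Type*} [NormedAddCommGroup X] [NormedSpace ℝ X]
    [CompleteSpace X] {T : X →L[ℝ] X} (hT : IsCompactOperator T) (hinj : ∀ u, u + T u = 0 → u = 0) :
    ∃ L : X ≃L[ℝ] X, (L : X →L[ℝ] X) = ContinuousLinearMap.id ℝ X + T := by
  have hT' : IsCompactOperator (-T) := hT.neg
  -- A nonzero number is either an eigenvalue of the compact operator `-T` or in its resolvent set;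
  -- injectivity of `1 + T` excludes the eigenvalue `1`.
  rcases hT'.hasEigenvalue_or_mem_resolventSet (one_ne_zero (α := ℝ)) with h | h
  · obtain ⟨u, hu⟩ := h.exists_hasEigenvector
    refine absurd (hinj u ?_) hu.2
    have := hu.apply_eq_smul
    simp only [one_smul] at this
    have h2 : -T u = u := this
    rw [neg_eq_iff_eq_neg.1 h2, add_neg_cancel]
  · rw [spectrum.mem_resolventSet_iff, map_one, sub_neg_eq_add] at h
    obtain ⟨L, hL⟩ := h
    exact ⟨ContinuousLinearEquiv.ofUnit L, by ext u; exact congrArg (fun S : X →L[ℝ] X => S u) hL⟩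

/-! ### The nonlinearity as an analytic map, and local solution operators. -/

/-- The reciprocal `1 / (hbar + v)`. -/
def recip (hbar : ℝ) (v : Per) : Per := Ring.inverse (algebraMap ℝ Per hbar + v)

lemma isUnit_add {hbar : ℝ} {v : Per} (hv : ‖v‖ < hbar) : IsUnit (algebraMap ℝ Per hbar + v) := by
  rw [ContinuousMap.isUnit_iff_forall_ne_zero]
  intro x
  have h1 := (abs_le.1 (v.abs_le_norm x)).1
  simp only [ContinuousMap.add_apply, Per.algebraMap_eval]
  linarith

lemma recip_apply {hbar : ℝ} {v : Per} (hv : ‖v‖ < hbar) (x : UnitAddCircle) :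
    recip hbar v x = (hbar + v x)⁻¹ := by
  have h := congrArg (fun u : Per => u x) (Ring.inverse_mul_cancel _ (isUnit_add hv))
  simp only [ContinuousMap.mul_apply, ContinuousMap.add_apply, Per.algebraMap_eval,
    ContinuousMap.one_apply] at h
  exact eq_inv_of_mul_eq_one_left h

/-- Inversion is analytic at units, and `‖v‖ < hbar` keeps `hbar + v` away from zero. -/
lemma contDiffAt_recip {hbar : ℝ} {v : Per} (hv : ‖v‖ < hbar) : ContDiffAt ℝ ω (recip hbar) v := by
  obtain ⟨w, hw⟩ := isUnit_add hv
  have h1 : ContDiffAt ℝ ω Ring.inverse (algebraMap ℝ Per hbar + v) := by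
    rw [← hw]; exact contDiffAt_ringInverse ℝ w
  exact h1.comp v (contDiffAt_const.add contDiffAt_id)

lemma hasFDerivAt_recip {hbar : ℝ} {v : Per} (hv : ‖v‖ < hbar) :
    HasFDerivAt (recip hbar) (-ContinuousLinearMap.mul ℝ Per (recip hbar v ^ 2)) v := by
  obtain ⟨w, hw⟩ := isUnit_add hv
  have h1 := hasFDerivAt_ringInverse (𝕜 := ℝ) w
  rw [hw] at h1
  have h2 := h1.comp v ((hasFDerivAt_id v).const_add (algebraMap ℝ Per hbar))
  have h3 : recip hbar v = ↑w⁻¹ := by rw [recip, ← hw, Ring.inverse_unit]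
  convert! h2 using 1
  ext1 z
  simp only [h3, neg_apply, ContinuousLinearMap.mul_apply',
    ContinuousLinearMap.comp_id, ContinuousLinearMap.mulLeftRight_apply]
  ring

/-- The superposition operator of `h ↦ α h⁻ᵐ + β h⁻ˡ`, at `h = hbar + v`. -/
def superpos (hbar α β : ℝ) (m l : ℕ) (v : Per) : Per :=
  α • recip hbar v ^ m + β • recip hbar v ^ l

lemma superpos_apply {hbar : ℝ} {v : Per} (hv : ‖v‖ < hbar) (α β : ℝ) (m l : ℕ) (x : UnitAddCircle) :
    superpos hbar α β m l v x = α * ((hbar + v x) ^ m)⁻¹ + β * ((hbar + v x) ^ l)⁻¹ := by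
  simp [superpos, recip_apply hv]

lemma superpos_zero {hbar : ℝ} (hb : 0 < hbar) (α β : ℝ) (m l : ℕ) :
    superpos hbar α β m l 0 = algebraMap ℝ Per (α * (hbar ^ m)⁻¹ + β * (hbar ^ l)⁻¹) := by
  ext x
  rw [superpos_apply (by simpa using hb)]
  simp

lemma contDiffAt_superpos {hbar : ℝ} {v : Per} (hv : ‖v‖ < hbar) (α β : ℝ) (m l : ℕ) :
    ContDiffAt ℝ ω (superpos hbar α β m l) v := by
  have h := contDiffAt_recip hv
  exact ((h.pow m).const_smul α).add ((h.pow l).const_smul β)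

lemma hasFDerivAt_recip_pow {hbar : ℝ} {v : Per} (hv : ‖v‖ < hbar) (m : ℕ) :
    HasFDerivAt (fun v => recip hbar v ^ m)
      (ContinuousLinearMap.mul ℝ Per ((-(m : ℝ)) • recip hbar v ^ (m + 1))) v := by
  have h := (hasFDerivAt_recip hv).pow m
  convert! h using 1
  ext1 z
  rcases m with _ | m
  · simp
  · ext x
    simp
    ring

/-- The family `superpos` is closed under differentiation, so this one formula serves for `f`, `f'`
and `f''`. -/
lemma hasFDerivAt_superpos {hbar : ℝ} {v : Per} (hv : ‖v‖ < hbar) (α β : ℝ) (m l : ℕ) :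
    HasFDerivAt (superpos hbar α β m l) (ContinuousLinearMap.mul ℝ Per
      (superpos hbar (-m * α) (-l * β) (m + 1) (l + 1) v)) v := by
  have h := ((hasFDerivAt_recip_pow hv m).const_smul α).add
    ((hasFDerivAt_recip_pow hv l).const_smul β)
  convert! h using 1
  ext1 z
  simp only [superpos, add_apply, smul_apply,
    ContinuousLinearMap.mul_apply', add_mul, smul_mul_assoc, smul_smul]
  congr 2 <;> ring

/-- The superposition operator of `f`. -/
abbrev nonlin (hbar : ℝ) : Per → Per := superpos hbar 1 (-1) 6 3

lemma nonlin_apply {hbar : ℝ} {v : Per} (hv : ‖v‖ < hbar) (x : UnitAddCircle) :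
    nonlin hbar v x = f (v x + hbar) := by
  rw [superpos_apply hv, f, add_comm hbar]; ring

lemma nonlin_zero {hbar : ℝ} (hb : 0 < hbar) : nonlin hbar 0 = algebraMap ℝ Per (f hbar) := by
  ext x
  rw [nonlin_apply (by simpa using hb)]
  simp

/-- The derivative `f'(hbar)`. -/
def slope (hbar : ℝ) : ℝ := -6 * (hbar ^ 7)⁻¹ + 3 * (hbar ^ 4)⁻¹

/-- The fixed point map whose zeros in the second component are the solutions of the (projected)
steady state equation. -/
def phi (T : Per →L[ℝ] Per) (hbar : ℝ) (q : ℝ × Per) : ℝ × Per :=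
  (q.1, q.2 + (q.1 ^ 2)⁻¹ • T (nonlin hbar q.2))

lemma contDiffAt_phi (T : Per →L[ℝ] Per) {hbar ε₀ : ℝ} (hb : 0 < hbar) (hε : ε₀ ≠ 0) :
    ContDiffAt ℝ ω (phi T hbar) (ε₀, 0) := by
  have h1 : ContDiffAt ℝ ω (fun q : ℝ × Per => nonlin hbar q.2) (ε₀, 0) :=
    (contDiffAt_superpos (v := ((ε₀, 0) : ℝ × Per).2) (by simpa using hb) _ _ _ _).comp (ε₀, 0)
      contDiffAt_snd
  have h2 : ContDiffAt ℝ ω (fun q : ℝ × Per => T (nonlin hbar q.2)) (ε₀, 0) :=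
    T.contDiff.contDiffAt.comp _ h1
  have h3 : ContDiffAt ℝ ω (fun q : ℝ × Per => (q.1 ^ 2)⁻¹) (ε₀, 0) :=
    (contDiffAt_fst.pow 2).inv (by simpa using hε)
  exact contDiffAt_fst.prodMk (contDiffAt_snd.add (h3.smul h2))

lemma hasFDerivAt_nonlin_zero {hbar : ℝ} (hb : 0 < hbar) :
    HasFDerivAt (nonlin hbar) (slope hbar • ContinuousLinearMap.id ℝ Per) 0 := by
  have h := hasFDerivAt_superpos (hbar := hbar) (v := 0) (by simpa using hb) 1 (-1) 6 3
  convert! h using 1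
  ext1 z
  rw [superpos_zero hb]
  simp only [ContinuousLinearMap.mul_apply', smul_apply, ContinuousLinearMap.id_apply, slope,
    ← Algebra.smul_def]
  norm_num

/-- Since `nonlin hbar 0` is constant and `T` kills constants, the derivative in `ε` of the second
component vanishes. The total derivative is therefore block diagonal, and invertible once `L` is. -/
lemma hasFDerivAt_phi {T : Per →L[ℝ] Per} (hT : ∀ c, T (algebraMap ℝ Per c) = 0) {hbar ε₀ : ℝ}
    (hb : 0 < hbar) (hε : ε₀ ≠ 0) (L : Per ≃L[ℝ] Per)
    (hL : (L : Per →L[ℝ] Per) = ContinuousLinearMap.id ℝ Per + (slope hbar / ε₀ ^ 2) • T) :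
    HasFDerivAt (phi T hbar)
      (((ContinuousLinearEquiv.refl ℝ ℝ).prodCongr L : (ℝ × Per) ≃L[ℝ] (ℝ × Per)) :
        (ℝ × Per) →L[ℝ] (ℝ × Per)) (ε₀, 0) := by
  have h1 : HasFDerivAt (fun q : ℝ × Per => T (nonlin hbar q.2))
      (T ∘L ((slope hbar • ContinuousLinearMap.id ℝ Per) ∘L ContinuousLinearMap.snd ℝ ℝ Per)) (ε₀, 0) :=
    T.hasFDerivAt.comp (ε₀, (0 : Per)) (HasFDerivAt.comp (g := nonlin hbar) (f := Prod.snd)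
      (ε₀, (0 : Per)) (hasFDerivAt_nonlin_zero hb) hasFDerivAt_snd)
  have h2 : DifferentiableAt ℝ (fun q : ℝ × Per => (q.1 ^ 2)⁻¹) (ε₀, 0) :=
    (differentiableAt_fst.pow 2).inv (by simpa using hε)
  have h3 := (hasFDerivAt_fst (𝕜 := ℝ) (p := (ε₀, (0 : Per)))).prodMk
    ((hasFDerivAt_snd (𝕜 := ℝ) (p := (ε₀, (0 : Per)))).add (h2.hasFDerivAt.smul h1))
  convert! h3 using 1
  refine ContinuousLinearMap.ext fun q => ?_
  have h4 : (L : Per →L[ℝ] Per) q.2 = q.2 + (slope hbar / ε₀ ^ 2) • T q.2 := by rw [hL]; rfl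
  have h5 : L q.2 = q.2 + (slope hbar / ε₀ ^ 2) • T q.2 := h4
  have h6 : T (nonlin hbar 0) = 0 := by rw [nonlin_zero hb, hT]
  ext1
  · simp
  · simp [h5, h6, smul_smul, div_eq_inv_mul]

/-- Local solution operator of `v + ε⁻² T (f(hbar + v)) = z`. -/
lemma exists_solution_operator {T : Per →L[ℝ] Per} (hT : ∀ c, T (algebraMap ℝ Per c) = 0)
    (hTc : IsCompactOperator T) {hbar ε₀ : ℝ} (hb : 0 < hbar) (hε : ε₀ ≠ 0)
    (hinj : ∀ u, u + (slope hbar / ε₀ ^ 2) • T u = 0 → u = 0) :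
    ∃ S : ℝ × Per → Per, ContDiffAt ℝ ω S (ε₀, 0) ∧
      (∀ᶠ p in 𝓝 ((ε₀, 0) : ℝ × Per), S p + (p.1 ^ 2)⁻¹ • T (nonlin hbar (S p)) = p.2) ∧
      (∀ᶠ q in 𝓝 ((ε₀, 0) : ℝ × Per), S (phi T hbar q) = q.2) := by
  obtain ⟨L, hL⟩ := exists_equiv_one_add_of_injective (T := (slope hbar / ε₀ ^ 2) • T)
    (hTc.smul (slope hbar / ε₀ ^ 2)) hinj
  have hf := contDiffAt_phi T hb hε
  have hf' := hasFDerivAt_phi hT hb hε L hL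
  have h0 : phi T hbar (ε₀, 0) = (ε₀, 0) := by simp [phi, nonlin_zero hb, hT]
  have hs := hf.hasStrictFDerivAt' hf' (by simp)
  have hri := hs.eventually_right_inverse
  have hli := hs.eventually_left_inverse
  have hc := hf.to_localInverse hf' (by simp)
  rw [h0] at hri hc
  refine ⟨fun p => (hf.localInverse hf' (by simp) p).2, contDiffAt_snd.comp _ hc, ?_, ?_⟩
  · filter_upwards [hri] with p hp
    -- `phi` preserves the parameter, hence so does its local inverse where it is a right inverse.
    have h1 : (hf.localInverse hf' (by simp) p).1 = p.1 := by
      have := congrArg (fun z : ℝ × Per => z.1) hp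
      exact this
    have h2 := congrArg (fun z : ℝ × Per => z.2) hp
    change (hf.localInverse hf' (by simp) p).2 + ((hf.localInverse hf' (by simp) p).1 ^ 2)⁻¹ • _ = _ at h2
    rw [h1] at h2
    exact h2
  · filter_upwards [hli] with q hq
    exact congrArg Prod.snd hq

/-! ### Translations and the reflection. -/

/-- The substitution operator of a continuous self-map of the circle. -/
def subst (φ : C(UnitAddCircle, UnitAddCircle)) : Per →ₐ[ℝ] Per := ContinuousMap.compRightAlgHom ℝ ℝ φ

@[simp] lemma subst_apply (φ : C(UnitAddCircle, UnitAddCircle)) (u : Per) (x : UnitAddCircle) :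
    subst φ u x = u (φ x) := rfl

lemma norm_subst_le (φ : C(UnitAddCircle, UnitAddCircle)) (u : Per) : ‖subst φ u‖ ≤ ‖u‖ := by
  rw [ContinuousMap.norm_le_of_nonempty]
  intro x
  exact u.norm_coe_le_norm _

lemma subst_superpos (φ : C(UnitAddCircle, UnitAddCircle)) {hbar : ℝ} {u : Per} (hu : ‖u‖ < hbar)
    (α β : ℝ) (m l : ℕ) :
    subst φ (superpos hbar α β m l u) = superpos hbar α β m l (subst φ u) := by
  ext x
  rw [subst_apply, superpos_apply hu, superpos_apply ((norm_subst_le φ u).trans_lt hu), subst_apply]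

/-- Translation by `s`. -/
def trans (s : ℝ) : Per →ₐ[ℝ] Per := subst ⟨fun x => x + (s : UnitAddCircle), by fun_prop⟩

/-- Reflection about the origin. -/
def reflect : Per →ₐ[ℝ] Per := subst ⟨fun x => -x, by fun_prop⟩

lemma trans_coe (s : ℝ) (u : Per) (x : ℝ) :
    trans s u (x : UnitAddCircle) = u ((x + s : ℝ) : UnitAddCircle) := by
  simp [trans]

lemma reflect_coe (u : Per) (x : ℝ) :
    reflect u (x : UnitAddCircle) = u ((-x : ℝ) : UnitAddCircle) := by
  simp [reflect]

lemma mean_trans (s : ℝ) (u : Per) : mean (trans s u) = mean u := by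
  simp only [mean_apply, trans_coe]
  rw [intervalIntegral.integral_comp_add_right (fun x : ℝ => u (x : UnitAddCircle)), add_comm 1 s,
    zero_add]
  have := u.periodic_coe.intervalIntegral_add_eq s 0
  rwa [zero_add] at this

lemma mean_reflect (u : Per) : mean (reflect u) = mean u := by
  simp only [mean_apply, reflect_coe]
  rw [intervalIntegral.integral_comp_neg (fun x : ℝ => u (x : UnitAddCircle))]
  have := u.periodic_coe.intervalIntegral_add_eq (-1) 0
  simpa using this

lemma J_trans (s : ℝ) (u : Per) : J (trans s u) = trans s (J u) := by
  have h := J_eq_of_hasDerivAt (U := trans s (J u)) (u := trans s u) (fun x _ => by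
    simpa only [trans_coe, mean_trans] using (hasDerivAt_J u (x + s)).comp_add_const x s)
  rw [h, mean_trans, mean_J, map_zero, sub_zero]

lemma J_reflect (u : Per) : J (reflect u) = -reflect (J u) := by
  have h := J_eq_of_hasDerivAt (U := -reflect (J u)) (u := reflect u) (fun x _ => by
    have := ((hasDerivAt_J u (-x)).scomp x (hasDerivAt_neg x)).neg
    simpa [mean_reflect, Function.comp_def, Pi.neg_def, reflect_coe] using this)
  rw [h, map_neg, mean_reflect, mean_J, neg_zero, map_zero, sub_zero]

lemma K_trans (s : ℝ) (u : Per) : K (trans s u) = trans s (K u) := by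
  rw [K_apply, J_trans, J_trans, K_apply]

lemma K_reflect (u : Per) : K (reflect u) = reflect (K u) := by
  rw [K_apply, J_reflect, map_neg, J_reflect, neg_neg, K_apply]

lemma trans_cosPer (k : ℕ) (s : ℝ) : trans s (cosPer k) = w₁ k s • cosPer k - w₂ k s • sinPer k :=
  Per.ext_coe fun x => by
    rw [trans_coe, cosPer_coe, w₁, mul_add, Real.cos_add]
    simp [w₁, w₂]; ring

lemma trans_sinPer (k : ℕ) (s : ℝ) : trans s (sinPer k) = w₂ k s • cosPer k + w₁ k s • sinPer k :=
  Per.ext_coe fun x => by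
    rw [trans_coe, sinPer_coe, w₂, mul_add, Real.sin_add]
    simp [w₁, w₂]; ring

lemma reflect_cosPer (k : ℕ) : reflect (cosPer k) = cosPer k :=
  Per.ext_coe fun x => by rw [reflect_coe]; simp only [cosPer_coe, w₁, mul_neg, Real.cos_neg]

lemma reflect_sinPer (k : ℕ) : reflect (sinPer k) = -sinPer k :=
  Per.ext_coe fun x => by
    rw [reflect_coe]
    simp only [sinPer_coe, w₂, mul_neg, Real.sin_neg, ContinuousMap.neg_apply]

lemma trans_neg_trans (s : ℝ) (u : Per) : trans s (trans (-s) u) = u :=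
  Per.ext_coe fun x => by rw [trans_coe, trans_coe, add_neg_cancel_right]

/-- Translation invariance of the mean makes `trans s` orthogonal for the `L²` pairing; this gives
the rotation of the coefficients along `cosPer k` and `sinPer k`. -/
lemma mean_mul_trans (s : ℝ) (w u : Per) : mean (w * trans s u) = mean (trans (-s) w * u) := by
  rw [← mean_trans s (trans (-s) w * u), map_mul (trans s), trans_neg_trans]

lemma mean_cosPer_mul_trans (k : ℕ) (s : ℝ) (u : Per) :
    mean (cosPer k * trans s u) = w₁ k s * mean (cosPer k * u) + w₂ k s * mean (sinPer k * u) := by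
  rw [mean_mul_trans, trans_cosPer]
  simp [w₁, w₂, add_mul]

lemma mean_sinPer_mul_trans (k : ℕ) (s : ℝ) (u : Per) :
    mean (sinPer k * trans s u) = -w₂ k s * mean (cosPer k * u) + w₁ k s * mean (sinPer k * u) := by
  rw [mean_mul_trans, trans_sinPer]
  simp [add_mul, w₁, w₂]

lemma projE_trans (k : ℕ) (s : ℝ) (u : Per) : projE k (trans s u) = trans s (projE k u) := by
  simp only [projE_apply, mean_cosPer_mul_trans, mean_sinPer_mul_trans, map_sub, map_smul,
    trans_cosPer, trans_sinPer]
  module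

lemma mean_cosPer_mul_reflect (k : ℕ) (u : Per) :
    mean (cosPer k * reflect u) = mean (cosPer k * u) := by
  rw [← mean_reflect (cosPer k * u), map_mul reflect, reflect_cosPer]

lemma mean_sinPer_mul_reflect (k : ℕ) (u : Per) :
    mean (sinPer k * reflect u) = -mean (sinPer k * u) := by
  rw [← mean_reflect (sinPer k * u), map_mul reflect, reflect_sinPer, neg_mul, map_neg, neg_neg]

lemma projE_reflect (k : ℕ) (u : Per) : projE k (reflect u) = reflect (projE k u) := by
  simp only [projE_apply, mean_cosPer_mul_reflect, mean_sinPer_mul_reflect, map_sub, map_smul,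
    reflect_cosPer, reflect_sinPer]
  module

/-! ### The solution operator at resonance and its equivariance. -/

/-- `S` is a local solution operator of the projected equation
`v + ε⁻² E K f(hbar + v) = z` at the resonant parameter `ε₀`. -/
structure IsSolOp (hbar ε₀ : ℝ) (k : ℕ) (S : ℝ × Per → Per) : Prop where
  hbar_pos : 0 < hbar
  eps_pos : 0 < ε₀
  one_le : 1 ≤ k
  res : slope hbar = (2 * k * Real.pi) ^ 2 * ε₀ ^ 2
  smooth : ContDiffAt ℝ ω S (ε₀, 0)
  eqn : ∀ᶠ p in 𝓝 ((ε₀, 0) : ℝ × Per),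
    S p + (p.1 ^ 2)⁻¹ • projE k (K (nonlin hbar (S p))) = p.2
  uniq : ∀ᶠ q in 𝓝 ((ε₀, 0) : ℝ × Per), S (phi (projE k ∘L K) hbar q) = q.2

lemma exists_isSolOp {hbar ε₀ : ℝ} {k : ℕ} (hb : 0 < hbar) (hε : 0 < ε₀) (hk : 1 ≤ k)
    (hres : slope hbar = (2 * k * Real.pi) ^ 2 * ε₀ ^ 2) : ∃ S, IsSolOp hbar ε₀ k S := by
  have h1 : slope hbar / ε₀ ^ 2 = (2 * k * Real.pi) ^ 2 := by rw [hres]; field_simp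
  obtain ⟨S, hS, he, hu⟩ := exists_solution_operator (T := projE k ∘L K) (hbar := hbar) (ε₀ := ε₀)
    (fun c => by simp [K_const]) (isCompactOperator_K.clm_comp (projE k)) hb hε.ne'
    (fun u hu => eq_zero_of_add_smul_projE_K_eq_zero hk (by rw [h1] at hu; exact hu))
  exact ⟨S, hb, hε, hk, hres, hS, he, hu⟩

lemma eventually_prod_iff_ball {ε₀ : ℝ} {P : ℝ → Per → Prop}
    (h : ∀ᶠ p in 𝓝 ((ε₀, 0) : ℝ × Per), P p.1 p.2) :
    ∃ r > 0, ∀ ε z, |ε - ε₀| < r → ‖z‖ < r → P ε z := by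
  obtain ⟨r, hr, h⟩ := Metric.eventually_nhds_iff.1 h
  refine ⟨r, hr, fun ε z hε hz => h (y := (ε, z)) ?_⟩
  rw [Prod.dist_eq, max_lt_iff]
  exact ⟨by rwa [Real.dist_eq], by rwa [dist_zero_right]⟩

namespace IsSolOp

variable {hbar ε₀ : ℝ} {k : ℕ} {S : ℝ × Per → Per}

/-- Smallness is asked of `v` but not of `z`, because `uniq` is a left inverse property of `phi`.
The bound by `hbar` keeps the film positive, and the bound by `ε₀` keeps `ε` away from zero. -/
lemma exists_unique_ball (h : IsSolOp hbar ε₀ k S) : ∃ ρ > 0, ρ ≤ hbar ∧ ρ ≤ ε₀ ∧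
    ∀ ε v z, |ε - ε₀| < ρ → ‖v‖ < ρ → v + (ε ^ 2)⁻¹ • projE k (K (nonlin hbar v)) = z →
      S (ε, z) = v := by
  obtain ⟨r, hr, hu⟩ := eventually_prod_iff_ball
    (P := fun ε v => S (phi (projE k ∘L K) hbar (ε, v)) = v) h.uniq
  refine ⟨min r (min hbar ε₀), lt_min hr (lt_min h.hbar_pos h.eps_pos),
    (min_le_right _ _).trans (min_le_left _ _), (min_le_right _ _).trans (min_le_right _ _), ?_⟩
  rintro ε v z hε hv rfl
  exact hu ε v (hε.trans_le (min_le_left _ _)) (hv.trans_le (min_le_left _ _))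

lemma map_zero_eventually (h : IsSolOp hbar ε₀ k S) : ∃ ρ > 0, ∀ ε, |ε - ε₀| < ρ → S (ε, 0) = 0 := by
  obtain ⟨ρ, hρ, -, -, hu⟩ := h.exists_unique_ball
  refine ⟨ρ, hρ, fun ε hε => hu ε 0 0 hε (by simpa using hρ) ?_⟩
  simp [nonlin_zero h.hbar_pos, K_const]

lemma map_zero_self (h : IsSolOp hbar ε₀ k S) : S (ε₀, 0) = 0 := by
  obtain ⟨ρ, hρ, hu⟩ := h.map_zero_eventually
  exact hu ε₀ (by simpa using hρ)

lemma exists_small_ball (h : IsSolOp hbar ε₀ k S) {δ : ℝ} (hδ : 0 < δ) : ∃ r > 0, ∀ ε z,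
    |ε - ε₀| < r → ‖z‖ < r → ‖S (ε, z)‖ < δ ∧
      S (ε, z) + (ε ^ 2)⁻¹ • projE k (K (nonlin hbar (S (ε, z)))) = z := by
  refine eventually_prod_iff_ball (P := fun ε z => ‖S (ε, z)‖ < δ ∧
      S (ε, z) + (ε ^ 2)⁻¹ • projE k (K (nonlin hbar (S (ε, z)))) = z) ?_
  have hc := h.smooth.continuousAt.norm
  refine (hc.eventually_lt continuousAt_const ?_).and h.eqn
  rw [h.map_zero_self]; simpa using hδ

/-- `K`, `E` and the superposition operator commute with translations and the reflection. A
transformed solution solves the transformed equation, so local uniqueness identifies it. -/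
lemma exists_equivariance_ball (h : IsSolOp hbar ε₀ k S) : ∃ r > 0, ∀ ε z,
    |ε - ε₀| < r → ‖z‖ < r → ‖S (ε, z)‖ < hbar ∧
      (∀ s, S (ε, trans s z) = trans s (S (ε, z))) ∧ S (ε, reflect z) = reflect (S (ε, z)) := by
  obtain ⟨ρ, hρ, hρb, -, hu⟩ := h.exists_unique_ball
  obtain ⟨r, hr, hs⟩ := h.exists_small_ball hρ
  refine ⟨min r ρ, lt_min hr hρ, fun ε z hε hz => ?_⟩
  obtain ⟨h1, h2⟩ := hs ε z (hε.trans_le (min_le_left _ _)) (hz.trans_le (min_le_left _ _))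
  have hb : ‖S (ε, z)‖ < hbar := h1.trans_le hρb
  refine ⟨hb, fun s => ?_, ?_⟩
  · refine hu ε _ _ (hε.trans_le (min_le_right _ _)) ((norm_subst_le _ _).trans_lt h1) ?_
    have h3 := congrArg (trans s) h2
    rw [map_add, map_smul, ← projE_trans, ← K_trans] at h3
    rw [← h3]
    congr 4
    exact (subst_superpos _ hb _ _ _ _).symm
  · refine hu ε _ _ (hε.trans_le (min_le_right _ _)) ((norm_subst_le _ _).trans_lt h1) ?_
    have h3 := congrArg reflect h2
    rw [map_add, map_smul, ← projE_reflect, ← K_reflect] at h3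
    rw [← h3]
    congr 4
    exact (subst_superpos _ hb _ _ _ _).symm

end IsSolOp

/-! ### The reduced functions and their restriction to a ray. -/

/-- The component of the steady state operator along `w`, for `w = cosPer k` or `w = sinPer k`. -/
def reduced (hbar : ℝ) (k : ℕ) (w : Per) (ε : ℝ) (v : Per) : ℝ :=
  -((2 * k * Real.pi) ^ 2 * ε ^ 2) * mean (w * v) + mean (w * nonlin hbar v)

/-- The reduced function on the ray `y = 0`. -/
def ray (hbar : ℝ) (k : ℕ) (S : ℝ × Per → Per) (r ε : ℝ) : ℝ :=
  reduced hbar k (cosPer k) ε (S (ε, r • cosPer k))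

/-- Polar coordinates in the kernel: a translation acts there as a rotation, so every kernel vector
is a translate of one on the ray `y = 0`. The shift is minus the argument of `x + iy`, divided by
`2kπ`. -/
lemma exists_polar {k : ℕ} (hk : 1 ≤ k) (x y : ℝ) : ∃ s : ℝ, √(x ^ 2 + y ^ 2) * w₁ k s = x ∧
    -(√(x ^ 2 + y ^ 2) * w₂ k s) = y ∧
    x • cosPer k + y • sinPer k = trans s (√(x ^ 2 + y ^ 2) • cosPer k) := by
  have hne := freq_ne_zero hk
  set z : ℂ := ⟨x, y⟩ with hz
  have hn : ‖z‖ = √(x ^ 2 + y ^ 2) := by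
    rw [Complex.norm_eq_sqrt_sq_add_sq]
  have hs : 2 * (k : ℝ) * Real.pi * (-z.arg / (2 * k * Real.pi)) = -z.arg := by field_simp
  have h1 : √(x ^ 2 + y ^ 2) * w₁ k (-z.arg / (2 * k * Real.pi)) = x := by
    rw [w₁, hs, Real.cos_neg, ← hn, Complex.norm_mul_cos_arg]
  have h2 : -(√(x ^ 2 + y ^ 2) * w₂ k (-z.arg / (2 * k * Real.pi))) = y := by
    rw [w₂, hs, Real.sin_neg, ← hn, mul_neg, neg_neg, Complex.norm_mul_sin_arg]
  refine ⟨_, h1, h2, ?_⟩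
  rw [map_smul, trans_cosPer, smul_sub, smul_smul, smul_smul, sub_eq_add_neg, ← neg_smul, h1, h2]

lemma norm_cosPer_le (k : ℕ) : ‖cosPer k‖ ≤ 1 :=
  Per.norm_le_of_Icc fun _ _ => Real.abs_cos_le_one _

lemma norm_sinPer_le (k : ℕ) : ‖sinPer k‖ ≤ 1 :=
  Per.norm_le_of_Icc fun _ _ => Real.abs_sin_le_one _

lemma norm_smul_cosPer_le (k : ℕ) (r : ℝ) : ‖r • cosPer k‖ ≤ |r| := by
  rw [norm_smul, Real.norm_eq_abs]
  nlinarith [norm_cosPer_le k, abs_nonneg r]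

namespace IsSolOp

variable {hbar ε₀ : ℝ} {k : ℕ} {S : ℝ × Per → Per}

/-- The reduced functions are equivariant under rotations. -/
lemma exists_reduced_ball (h : IsSolOp hbar ε₀ k S) : ∃ ρ > 0, ∀ ε r s, |ε - ε₀| < ρ → |r| < ρ →
    reduced hbar k (cosPer k) ε (S (ε, trans s (r • cosPer k))) = w₁ k s * ray hbar k S r ε ∧
    reduced hbar k (sinPer k) ε (S (ε, trans s (r • cosPer k))) = -w₂ k s * ray hbar k S r ε := by
  obtain ⟨ρ, hρ, hs⟩ := h.exists_equivariance_ball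
  refine ⟨ρ, hρ, fun ε r s hε hr => ?_⟩
  obtain ⟨hb, ht, hrf⟩ := hs ε (r • cosPer k) hε ((norm_smul_cosPer_le k r).trans_lt hr)
  rw [map_smul reflect, reflect_cosPer] at hrf
  set v := S (ε, r • cosPer k) with hv
  have hN : ∀ s, nonlin hbar (trans s v) = trans s (nonlin hbar v) := fun s =>
    (subst_superpos _ hb _ _ _ _).symm
  have hNr : nonlin hbar v = reflect (nonlin hbar v) := by
    conv_lhs => rw [hrf]
    exact (subst_superpos _ hb _ _ _ _).symm
  -- `v` is fixed by the reflection, so its sine coefficient equals its own negative.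
  have h1 : mean (sinPer k * v) = 0 := by
    have := mean_sinPer_mul_reflect k v
    rw [← hrf] at this; linarith
  have h2 : mean (sinPer k * nonlin hbar v) = 0 := by
    have := mean_sinPer_mul_reflect k (nonlin hbar v)
    rw [← hNr] at this; linarith
  rw [ht s]
  simp only [ray, reduced, hN, mean_cosPer_mul_trans, mean_sinPer_mul_trans, ← hv, h1, h2]
  constructor <;> ring

lemma ray_zero (h : IsSolOp hbar ε₀ k S) : ∃ ρ > 0, ∀ ε, |ε - ε₀| < ρ → ray hbar k S 0 ε = 0 := by
  obtain ⟨ρ, hρ, hz⟩ := h.map_zero_eventually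
  refine ⟨ρ, hρ, fun ε hε => ?_⟩
  rw [ray, zero_smul, hz ε hε, reduced, nonlin_zero h.hbar_pos, mul_comm (cosPer k) (algebraMap _ _ _),
    ← Algebra.smul_def, map_smul, mean_cosPer h.one_le]
  simp

/-- Translation by half a wavelength, `1 / (2k)`, changes the sign of `cosPer k`. -/
lemma ray_odd (h : IsSolOp hbar ε₀ k S) : ∃ ρ > 0, ∀ ε r, |ε - ε₀| < ρ → |r| < ρ →
    ray hbar k S (-r) ε = -ray hbar k S r ε := by
  obtain ⟨ρ, hρ, hs⟩ := h.exists_reduced_ball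
  refine ⟨ρ, hρ, fun ε r hε hr => ?_⟩
  have hk : (k : ℝ) ≠ 0 := by have := h.one_le; positivity
  have h1 : 2 * (k : ℝ) * Real.pi * (1 / (2 * k)) = Real.pi := by field_simp
  have h2 := (hs ε r (1 / (2 * k)) hε hr).1
  rw [map_smul, trans_cosPer, w₁, w₂, h1, Real.cos_pi, Real.sin_pi] at h2
  rw [ray, show (-r) • cosPer k = r • ((-1 : ℝ) • cosPer k - (0 : ℝ) • sinPer k) by module, h2]
  ring

lemma contDiffAt_nonlin_sol (h : IsSolOp hbar ε₀ k S) :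
    ContDiffAt ℝ ω (fun p => nonlin hbar (S p)) (ε₀, 0) := by
  refine ContDiffAt.comp _ (contDiffAt_superpos ?_ _ _ _ _) h.smooth
  rw [h.map_zero_self]; simpa using h.hbar_pos

lemma contDiffAt_reduced (h : IsSolOp hbar ε₀ k S) (w : Per) :
    ContDiffAt ℝ ω (fun p : ℝ × Per => reduced hbar k w p.1 (S p)) (ε₀, 0) := by
  have h1 : ContDiffAt ℝ ω (fun p : ℝ × Per => mean (w * S p)) (ε₀, 0) :=
    mean.contDiff.contDiffAt.comp _ (contDiffAt_const.mul h.smooth)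
  have h2 : ContDiffAt ℝ ω (fun p : ℝ × Per => mean (w * nonlin hbar (S p))) (ε₀, 0) :=
    mean.contDiff.contDiffAt.comp _ (contDiffAt_const.mul h.contDiffAt_nonlin_sol)
  exact ((contDiffAt_const.mul (contDiffAt_fst.pow 2)).neg.mul h1).add h2

lemma contDiffAt_ray (h : IsSolOp hbar ε₀ k S) :
    ContDiffAt ℝ ω (fun q : ℝ × ℝ => ray hbar k S q.1 q.2) (0, ε₀) := by
  have h1 : ContDiffAt ℝ ω (fun q : ℝ × ℝ => (q.2, q.1 • cosPer k)) (0, ε₀) :=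
    contDiffAt_snd.prodMk (contDiffAt_fst.smul contDiffAt_const)
  refine ContDiffAt.comp (g := fun p : ℝ × Per => reduced hbar k (cosPer k) p.1 (S p))
    (0, ε₀) ?_ h1
  simpa using h.contDiffAt_reduced (cosPer k)

end IsSolOp

/-! ### The linear and cubic coefficients of the reduced function. -/

lemma iteratedDeriv_three_eq {E : Type*} [NormedAddCommGroup E] [NormedSpace ℝ E]
    {g g₁ g₂ : ℝ → E} {x : ℝ} {c : E} (h₁ : ∀ᶠ t in 𝓝 x, HasDerivAt g (g₁ t) t)
    (h₂ : ∀ᶠ t in 𝓝 x, HasDerivAt g₁ (g₂ t) t) (h₃ : HasDerivAt g₂ c x) :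
    iteratedDeriv 3 g x = c := by
  have e1 : deriv g =ᶠ[𝓝 x] g₁ := h₁.mono fun t ht => ht.deriv
  have e2 : deriv (deriv g) =ᶠ[𝓝 x] g₂ := e1.deriv.trans (h₂.mono fun t ht => ht.deriv)
  rw [iteratedDeriv_succ, iteratedDeriv_succ, iteratedDeriv_one, e2.deriv_eq, h₃.deriv]

lemma exists_three_derivs {E : Type*} [NormedAddCommGroup E] [NormedSpace ℝ E] {v : ℝ → E} {x : ℝ}
    (hv : ContDiffAt ℝ ω v x) : ∃ v₁ v₂ : ℝ → E, ∃ v₃ : E, (∀ᶠ t in 𝓝 x, HasDerivAt v (v₁ t) t) ∧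
      (∀ᶠ t in 𝓝 x, HasDerivAt v₁ (v₂ t) t) ∧ HasDerivAt v₂ v₃ x := by
  have key : ∀ {v : ℝ → E}, ContDiffAt ℝ ω v x →
      ContDiffAt ℝ ω (deriv v) x ∧ ∀ᶠ t in 𝓝 x, HasDerivAt v (deriv v t) t := by
    intro v hv
    refine ⟨?_, ?_⟩
    · have h1 : ContDiffAt ℝ ω (fderiv ℝ v) x := hv.fderiv_right (by simp)
      exact h1.clm_apply contDiffAt_const
    · filter_upwards [hv.eventually (by simp)] with t ht
      exact (ht.differentiableAt (by simp)).hasDerivAt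
  obtain ⟨h1, d1⟩ := key hv
  obtain ⟨h2, d2⟩ := key h1
  obtain ⟨h3, d3⟩ := key h2
  exact ⟨_, _, _, d1, d2, d3.self_of_nhds⟩

/-- The second derivative `f''(hbar)`. -/
def slope₂ (hbar : ℝ) : ℝ := 42 * (hbar ^ 8)⁻¹ - 12 * (hbar ^ 5)⁻¹

/-- The third derivative `f'''(hbar)`. -/
def slope₃ (hbar : ℝ) : ℝ := -336 * (hbar ^ 9)⁻¹ + 60 * (hbar ^ 6)⁻¹

lemma hasDerivAt_superpos_comp {hbar : ℝ} {v : ℝ → Per} {v' : Per} {t : ℝ} (hb : ‖v t‖ < hbar)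
    (hv : HasDerivAt v v' t) (α β : ℝ) (m l : ℕ) :
    HasDerivAt (fun t => superpos hbar α β m l (v t))
      (superpos hbar (-m * α) (-l * β) (m + 1) (l + 1) (v t) * v') t :=
  (hasFDerivAt_superpos hb α β m l).comp_hasDerivAt t hv

namespace IsSolOp

variable {hbar ε₀ : ℝ} {k : ℕ} {S : ℝ × Per → Per}

/-- Pairing the projected equation with `cosPer k` removes the term in the range of `E`, so this
coefficient is exactly linear in `r`. All higher derivatives of the solution curve are orthogonal to
`cosPer k`. -/
lemma mean_cosPer_mul_sol (h : IsSolOp hbar ε₀ k S) : ∃ ρ > 0, ∀ ε r, |ε - ε₀| < ρ → |r| < ρ →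
    mean (cosPer k * S (ε, r • cosPer k)) = r / 2 := by
  obtain ⟨ρ, hρ, hs⟩ := h.exists_small_ball one_pos
  refine ⟨ρ, hρ, fun ε r hε hr => ?_⟩
  have h1 := (hs ε (r • cosPer k) hε ((norm_smul_cosPer_le k r).trans_lt hr)).2
  have h2 := congrArg (fun z => mean (cosPer k * z)) h1
  simp only [mul_add, mul_smul_comm, map_add, map_smul, mean_cosPer_mul_projE h.one_le,
    mean_cosPer_mul_self h.one_le, smul_eq_mul, mul_zero, add_zero] at h2
  linarith

lemma ray_eq (h : IsSolOp hbar ε₀ k S) : ∃ ρ > 0, ∀ ε r, |ε - ε₀| < ρ → |r| < ρ →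
    ray hbar k S r ε = -((2 * k * Real.pi) ^ 2 * ε ^ 2) * (r / 2) +
      mean (cosPer k * nonlin hbar (S (ε, r • cosPer k))) := by
  obtain ⟨ρ, hρ, hs⟩ := h.mean_cosPer_mul_sol
  refine ⟨ρ, hρ, fun ε r hε hr => ?_⟩
  rw [ray, reduced, hs ε r hε hr]

lemma contDiffAt_curve (h : IsSolOp hbar ε₀ k S) :
    ∀ᶠ ε in 𝓝 ε₀, ContDiffAt ℝ ω (fun r : ℝ => S (ε, r • cosPer k)) 0 := by
  have h1 := h.smooth.eventually (by simp)
  have h2 : Tendsto (fun ε : ℝ => (ε, (0 : Per))) (𝓝 ε₀) (𝓝 (ε₀, 0)) :=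
    (Continuous.prodMk_left (0 : Per)).tendsto ε₀
  filter_upwards [h2.eventually h1] with ε hε
  refine ContDiffAt.comp (g := S) (f := fun r : ℝ => (ε, r • cosPer k)) 0 ?_ ?_
  · simpa using hε
  · exact contDiffAt_const.prodMk (contDiffAt_id.smul contDiffAt_const)

/-- At `V = 0` the nonlinearity differentiates to multiplication by the scalar `slope hbar`, so only
the cosine coefficient `1/2` of the curve's tangent matters. -/
lemma hasDerivAt_ray_zero (h : IsSolOp hbar ε₀ k S) : ∃ ρ > 0, ∀ ε, |ε - ε₀| < ρ →
    HasDerivAt (fun r => ray hbar k S r ε) ((slope hbar - (2 * k * Real.pi) ^ 2 * ε ^ 2) / 2) 0 := by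
  obtain ⟨ρ₁, hρ₁, h1⟩ := h.mean_cosPer_mul_sol
  obtain ⟨ρ₂, hρ₂, h2⟩ := h.ray_eq
  obtain ⟨ρ₃, hρ₃, h3⟩ := Metric.eventually_nhds_iff.1 h.contDiffAt_curve
  obtain ⟨ρ₄, hρ₄, h4⟩ := h.map_zero_eventually
  refine ⟨min (min ρ₁ ρ₂) (min ρ₃ ρ₄), by positivity, fun ε hε => ?_⟩
  simp only [lt_min_iff] at hε
  obtain ⟨⟨hε₁, hε₂⟩, hε₃, hε₄⟩ := hε
  set v : ℝ → Per := fun r => S (ε, r • cosPer k) with hv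
  have hv0 : v 0 = 0 := by simp only [hv, zero_smul]; exact h4 ε hε₄
  have hd : HasDerivAt v (deriv v 0) 0 :=
    ((h3 (by rwa [Real.dist_eq])).differentiableAt (by simp)).hasDerivAt
  have hball : ∀ ρ > (0 : ℝ), ∀ᶠ r : ℝ in 𝓝 0, |r| < ρ := fun ρ hρ => by
    filter_upwards [Metric.ball_mem_nhds (0 : ℝ) hρ] with r hr
    simpa using hr
  have hm : mean (cosPer k * deriv v 0) = 1 / 2 := by
    have e1 : HasDerivAt (fun r => mean (cosPer k * v r)) (mean (cosPer k * deriv v 0)) 0 :=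
      mean.hasFDerivAt.comp_hasDerivAt 0 (hd.const_mul (cosPer k))
    have e2 : HasDerivAt (fun r : ℝ => r / 2) (1 / 2) 0 := (hasDerivAt_id 0).div_const 2
    exact e1.unique (e2.congr_of_eventuallyEq
      ((hball ρ₁ hρ₁).mono fun r hr => h1 ε r hε₁ hr))
  have hN : HasDerivAt (fun r => nonlin hbar (v r)) (slope hbar • deriv v 0) 0 := by
    have := hasFDerivAt_nonlin_zero h.hbar_pos
    rw [← hv0] at this
    exact this.comp_hasDerivAt 0 hd
  have e3 : HasDerivAt (fun r => mean (cosPer k * nonlin hbar (v r)))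
      (mean (cosPer k * (slope hbar • deriv v 0))) 0 :=
    mean.hasFDerivAt.comp_hasDerivAt 0 (hN.const_mul (cosPer k))
  rw [mul_smul_comm, map_smul, hm, smul_eq_mul] at e3
  have e4 := (((hasDerivAt_id (0 : ℝ)).div_const 2).const_mul
    (-((2 * k * Real.pi) ^ 2 * ε ^ 2))).add e3
  refine HasDerivAt.congr_of_eventuallyEq (f₁ := fun r => ray hbar k S r ε) ?_
    ((hball ρ₂ hρ₂).mono fun r hr => h2 ε r hε₂ hr)
  convert! e4 using 1
  ring

lemma mean_cosPer_sq_mul (hk : 1 ≤ k) : mean (cosPer k * cosPer k * cosPer (2 * k)) = 1 / 4 := by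
  rw [cosPer_mul_self, add_mul, smul_mul_assoc, map_add, map_smul, ← Algebra.smul_def, map_smul,
    mean_cosPer (by omega), mean_cosPer_mul_self (by omega)]
  norm_num

lemma mean_cosPer_pow_four (hk : 1 ≤ k) : mean (cosPer k * (cosPer k * cosPer k * cosPer k)) = 3 / 8 := by
  have : cosPer k * (cosPer k * cosPer k * cosPer k) = (1 / 2 : ℝ) • (cosPer k * cosPer k) +
      (1 / 2 : ℝ) • (cosPer k * cosPer k * cosPer (2 * k)) := by
    rw [show cosPer k * (cosPer k * cosPer k * cosPer k) = cosPer k * cosPer k * (cosPer k * cosPer k) by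
      ring]
    nth_rewrite 2 [cosPer_mul_self]
    rw [mul_add, mul_smul_comm, mul_comm _ (algebraMap ℝ Per (1 / 2)), ← Algebra.smul_def]
  rw [this, map_add, map_smul, map_smul, mean_cosPer_sq_mul hk, mean_cosPer_mul_self hk]
  norm_num

/-- Write `a, b, c` for `f', f'', f'''` at `hbar`. Differentiating the projected equation along `v r
= S (ε₀, r cos)` gives `v' = cos` and `v'' = (b / 6a) cos (4πk·)` at `r = 0`. The third derivative
of `ray` is then the mean of `cos * (c cos³ + 3 b cos v'' + a v''')`. The last term vanishes because
`v'''` is orthogonal to `cos`, and the means `3/8` of `cos⁴` and `1/4` of `cos² cos (4πk·)` give the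
result. -/
lemma iteratedDeriv_ray (h : IsSolOp hbar ε₀ k S) :
    iteratedDeriv 3 (fun r => ray hbar k S r ε₀) 0 =
      slope₂ hbar ^ 2 / (8 * slope hbar) + 3 * slope₃ hbar / 8 := by
  have hk := h.one_le
  have hω : (2 * (k : ℝ) * Real.pi) ^ 2 ≠ 0 := pow_ne_zero 2 (freq_ne_zero hk)
  have hε1 : ε₀ ≠ 0 := h.eps_pos.ne'
  have hε0 : ε₀ ^ 2 ≠ 0 := pow_ne_zero 2 h.eps_pos.ne'
  have ha : slope hbar ≠ 0 := by rw [h.res]; exact mul_ne_zero hω hε0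
  set T : Per →L[ℝ] Per := (ε₀ ^ 2)⁻¹ • (projE k ∘L K) with hT
  -- By resonance `T (slope hbar • u)` is `(2kπ)² E K u`, whose sum with the identity is injective.
  -- The derivatives of the curve can therefore be guessed and verified.
  have hTinj : ∀ u u' : Per, u + T (slope hbar • u) = u' + T (slope hbar • u') → u = u' := by
    intro u u' huu
    refine sub_eq_zero.1 (eq_zero_of_add_smul_projE_K_eq_zero hk (u := u - u') ?_)
    have : ∀ u : Per, T (slope hbar • u) = (2 * (k : ℝ) * Real.pi) ^ 2 • projE k (K u) := by
      intro u
      change (ε₀ ^ 2)⁻¹ • projE k (K (slope hbar • u)) = _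
      rw [map_smul, map_smul, smul_smul, h.res]
      congr 1
      field_simp
    rw [this, this] at huu
    rw [map_sub, map_sub, smul_sub]
    linear_combination (exp := 1) huu
  set v : ℝ → Per := fun r => S (ε₀, r • cosPer k) with hv
  have hv0 : v 0 = 0 := by simp only [hv, zero_smul]; exact h.map_zero_self
  obtain ⟨v₁, v₂, v₃, d1, d2, d3⟩ := exists_three_derivs h.contDiffAt_curve.self_of_nhds
  have hball : ∀ ρ > (0 : ℝ), ∀ᶠ r : ℝ in 𝓝 0, |r| < ρ := fun ρ hρ => by
    filter_upwards [Metric.ball_mem_nhds (0 : ℝ) hρ] with r hr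
    simpa using hr
  have hb : ∀ᶠ r in 𝓝 (0 : ℝ), ‖v r‖ < hbar := by
    have := d1.self_of_nhds.continuousAt.norm
    refine this.eventually_lt continuousAt_const ?_
    change ‖v 0‖ < hbar
    rw [hv0]; simpa using h.hbar_pos
  -- The coefficients stay unevaluated so that they match the iterated derivative formula for
  -- `superpos`; they are evaluated only at `v 0 = 0`.
  set N₁ := superpos hbar (-(6 : ℕ) * 1) (-(3 : ℕ) * -1) (6 + 1) (3 + 1) with hN₁
  set N₂ := superpos hbar (-(6 + 1 : ℕ) * (-(6 : ℕ) * 1)) (-(3 + 1 : ℕ) * (-(3 : ℕ) * -1))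
    (6 + 1 + 1) (3 + 1 + 1) with hN₂
  set N₃ := superpos hbar (-(6 + 1 + 1 : ℕ) * (-(6 + 1 : ℕ) * (-(6 : ℕ) * 1)))
    (-(3 + 1 + 1 : ℕ) * (-(3 + 1 : ℕ) * (-(3 : ℕ) * -1))) (6 + 1 + 1 + 1) (3 + 1 + 1 + 1) with hN₃
  have p1 : ∀ᶠ r in 𝓝 (0 : ℝ), HasDerivAt (fun r => nonlin hbar (v r)) (N₁ (v r) * v₁ r) r := by
    filter_upwards [hb, d1] with r hr h1
    exact hasDerivAt_superpos_comp hr h1 _ _ _ _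
  have p2 : ∀ᶠ r in 𝓝 (0 : ℝ), HasDerivAt (fun r => N₁ (v r) * v₁ r)
      (N₂ (v r) * v₁ r * v₁ r + N₁ (v r) * v₂ r) r := by
    filter_upwards [hb, d1, d2] with r hr h1 h2
    exact (hasDerivAt_superpos_comp hr h1 _ _ _ _).fun_mul h2
  have p3 : HasDerivAt (fun r => N₂ (v r) * v₁ r * v₁ r + N₁ (v r) * v₂ r)
      (((N₃ (v 0) * v₁ 0 * v₁ 0 + N₂ (v 0) * v₂ 0) * v₁ 0 + N₂ (v 0) * v₁ 0 * v₂ 0) +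
        (N₂ (v 0) * v₁ 0 * v₂ 0 + N₁ (v 0) * v₃)) 0 :=
    (((hasDerivAt_superpos_comp hb.self_of_nhds d1.self_of_nhds _ _ _ _).fun_mul
      d2.self_of_nhds).fun_mul d2.self_of_nhds).fun_add
      ((hasDerivAt_superpos_comp hb.self_of_nhds d1.self_of_nhds _ _ _ _).fun_mul d3)
  have n1 : N₁ (v 0) = algebraMap ℝ Per (slope hbar) := by
    rw [hv0, hN₁, superpos_zero h.hbar_pos, slope]; congr 1; norm_num
  have n2 : N₂ (v 0) = algebraMap ℝ Per (slope₂ hbar) := by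
    rw [hv0, hN₂, superpos_zero h.hbar_pos, slope₂]; congr 1; norm_num; ring
  have n3 : N₃ (v 0) = algebraMap ℝ Per (slope₃ hbar) := by
    rw [hv0, hN₃, superpos_zero h.hbar_pos, slope₃]; congr 1; norm_num
  -- differentiate the projected equation twice
  obtain ⟨ρ, hρ, hs⟩ := h.exists_small_ball one_pos
  have q0 : ∀ᶠ r in 𝓝 (0 : ℝ), v r + T (nonlin hbar (v r)) = r • cosPer k :=
    (hball ρ hρ).mono fun r hr =>
      (hs ε₀ (r • cosPer k) (by simpa using hρ) ((norm_smul_cosPer_le k r).trans_lt hr)).2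
  have q1 : ∀ᶠ r in 𝓝 (0 : ℝ), v₁ r + T (N₁ (v r) * v₁ r) = cosPer k := by
    filter_upwards [q0.eventually_nhds, d1, p1] with r hq h1 h2
    have e1 : HasDerivAt (fun r => v r + T (nonlin hbar (v r))) (v₁ r + T (N₁ (v r) * v₁ r)) r :=
      h1.fun_add (T.hasFDerivAt.comp_hasDerivAt r h2)
    have e2 : HasDerivAt (fun r : ℝ => r • cosPer k) ((1 : ℝ) • cosPer k) r :=
      (hasDerivAt_id r).smul_const (cosPer k)
    rw [one_smul] at e2
    exact e1.unique (e2.congr_of_eventuallyEq hq)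
  have q2 : v₂ 0 + T (N₂ (v 0) * v₁ 0 * v₁ 0 + N₁ (v 0) * v₂ 0) = 0 := by
    have e1 : HasDerivAt (fun r => v₁ r + T (N₁ (v r) * v₁ r))
        (v₂ 0 + T (N₂ (v 0) * v₁ 0 * v₁ 0 + N₁ (v 0) * v₂ 0)) 0 :=
      d2.self_of_nhds.fun_add (T.hasFDerivAt.comp_hasDerivAt 0 p2.self_of_nhds)
    exact e1.unique ((hasDerivAt_const (0 : ℝ) (cosPer k)).congr_of_eventuallyEq q1)
  have hTcos : T (slope hbar • cosPer k) = 0 := by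
    change (ε₀ ^ 2)⁻¹ • projE k (K (slope hbar • cosPer k)) = 0
    rw [map_smul, K_cosPer hk, map_smul, map_smul, projE_cosPer hk]; simp
  have hv1 : v₁ 0 = cosPer k := by
    refine hTinj _ _ ?_
    have := q1.self_of_nhds
    rw [n1, ← Algebra.smul_def] at this
    rw [hTcos, this, add_zero]
  have hproj : projE k (cosPer (2 * k)) = cosPer (2 * k) := by
    refine projE_eq_self ?_ ?_
    · have := cosPer_mul_cosPer k k
      rw [mul_comm, ← two_mul] at this
      rw [this, map_add, map_smul, map_smul, mean_cosPer hk, mean_cosPer (by omega)]; simp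
    · have := mean_sinPer_mul_reflect k (cosPer (2 * k))
      rw [reflect_cosPer] at this; linarith
  have hK2 : K (cosPer (2 * k)) = -(4 * (2 * k * Real.pi) ^ 2)⁻¹ • cosPer (2 * k) := by
    rw [K_cosPer (by omega)]; congr 3; push_cast; ring
  have hTcos2 : T (cosPer (2 * k)) = -(4 * slope hbar)⁻¹ • cosPer (2 * k) := by
    change (ε₀ ^ 2)⁻¹ • projE k (K (cosPer (2 * k))) = _
    rw [hK2, map_smul, hproj, smul_smul, h.res]
    congr 1
    field_simp
  have hTconst : ∀ c, T (algebraMap ℝ Per c) = 0 := fun c => by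
    change (ε₀ ^ 2)⁻¹ • projE k (K (algebraMap ℝ Per c)) = 0
    rw [K_const, map_zero, smul_zero]
  -- On `cosPer (2 * k)` the operator `1 + slope hbar • T` is multiplication by `1 - 1/4 = 3/4`, and
  -- the source is `slope₂ hbar / (8 * slope hbar)`.
  have hv2 : v₂ 0 = (slope₂ hbar / (6 * slope hbar)) • cosPer (2 * k) := by
    refine hTinj _ _ ?_
    have h1 : T (N₂ (v 0) * v₁ 0 * v₁ 0 + N₁ (v 0) * v₂ 0) =
        -(slope₂ hbar / (8 * slope hbar)) • cosPer (2 * k) + T (slope hbar • v₂ 0) := by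
      rw [n1, n2, hv1, mul_assoc, ← Algebra.smul_def, ← Algebra.smul_def, map_add]
      congr 1
      rw [map_smul, cosPer_mul_self, map_add, hTconst, map_smul, hTcos2, zero_add, smul_smul, smul_smul]
      congr 1
      field_simp
      ring
    rw [h1, neg_smul] at q2
    have h2 : v₂ 0 + T (slope hbar • v₂ 0) = (slope₂ hbar / (8 * slope hbar)) • cosPer (2 * k) := by
      linear_combination (exp := 1) q2
    rw [h2, smul_smul, map_smul, hTcos2, smul_smul, ← add_smul]
    congr 1
    field_simp
    ring
  -- the third derivative along the curve
  have hmv3 : mean (cosPer k * v₃) = 0 := by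
    obtain ⟨ρ', hρ', hm⟩ := h.mean_cosPer_mul_sol
    have m0 : ∀ᶠ r in 𝓝 (0 : ℝ), mean (cosPer k * v r) = r / 2 :=
      (hball ρ' hρ').mono fun r hr => hm ε₀ r (by simpa using hρ') hr
    have m1 : ∀ᶠ r in 𝓝 (0 : ℝ), mean (cosPer k * v₁ r) = 1 / 2 := by
      filter_upwards [m0.eventually_nhds, d1] with r hq h1
      have e1 : HasDerivAt (fun r => mean (cosPer k * v r)) (mean (cosPer k * v₁ r)) r :=
        mean.hasFDerivAt.comp_hasDerivAt r (h1.const_mul (cosPer k))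
      exact e1.unique (((hasDerivAt_id r).div_const 2).congr_of_eventuallyEq hq)
    have m2 : ∀ᶠ r in 𝓝 (0 : ℝ), mean (cosPer k * v₂ r) = 0 := by
      filter_upwards [m1.eventually_nhds, d2] with r hq h1
      have e1 : HasDerivAt (fun r => mean (cosPer k * v₁ r)) (mean (cosPer k * v₂ r)) r :=
        mean.hasFDerivAt.comp_hasDerivAt r (h1.const_mul (cosPer k))
      exact e1.unique ((hasDerivAt_const r (1 / 2 : ℝ)).congr_of_eventuallyEq hq)
    have e1 : HasDerivAt (fun r => mean (cosPer k * v₂ r)) (mean (cosPer k * v₃)) 0 :=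
      mean.hasFDerivAt.comp_hasDerivAt 0 (d3.const_mul (cosPer k))
    exact e1.unique ((hasDerivAt_const (0 : ℝ) (0 : ℝ)).congr_of_eventuallyEq m2)
  obtain ⟨ρ₂, hρ₂, hr⟩ := h.ray_eq
  set A : ℝ := -((2 * k * Real.pi) ^ 2 * ε₀ ^ 2) with hA
  have r0 : (fun r => ray hbar k S r ε₀) =ᶠ[𝓝 0]
      fun r => A * (r / 2) + mean (cosPer k * nonlin hbar (v r)) :=
    (hball ρ₂ hρ₂).mono fun r hr' => hr ε₀ r (by simpa using hρ₂) hr'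
  rw [r0.iteratedDeriv_eq 3]
  have t1 : ∀ᶠ r in 𝓝 (0 : ℝ), HasDerivAt
      (fun r => A * (r / 2) + mean (cosPer k * nonlin hbar (v r)))
      (A * (1 / 2) + mean (cosPer k * (N₁ (v r) * v₁ r))) r := by
    filter_upwards [p1] with r h1
    exact (((hasDerivAt_id r).div_const 2).const_mul A).fun_add
      (mean.hasFDerivAt.comp_hasDerivAt r (h1.const_mul (cosPer k)))
  have t2 : ∀ᶠ r in 𝓝 (0 : ℝ), HasDerivAt
      (fun r => A * (1 / 2) + mean (cosPer k * (N₁ (v r) * v₁ r)))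
      (mean (cosPer k * (N₂ (v r) * v₁ r * v₁ r + N₁ (v r) * v₂ r))) r := by
    filter_upwards [p2] with r h1
    exact (mean.hasFDerivAt.comp_hasDerivAt r (h1.const_mul (cosPer k))).const_add (A * (1 / 2))
  have t3 : HasDerivAt (fun r => mean (cosPer k * (N₂ (v r) * v₁ r * v₁ r + N₁ (v r) * v₂ r))) _ 0 :=
    mean.hasFDerivAt.comp_hasDerivAt 0 (p3.const_mul (cosPer k))
  rw [iteratedDeriv_three_eq t1 t2 t3, n1, n2, n3, hv1, hv2]
  have e : cosPer k * ((algebraMap ℝ Per (slope₃ hbar) * cosPer k * cosPer k +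
        algebraMap ℝ Per (slope₂ hbar) * (slope₂ hbar / (6 * slope hbar)) • cosPer (2 * k)) * cosPer k +
        algebraMap ℝ Per (slope₂ hbar) * cosPer k * (slope₂ hbar / (6 * slope hbar)) • cosPer (2 * k) +
      (algebraMap ℝ Per (slope₂ hbar) * cosPer k * (slope₂ hbar / (6 * slope hbar)) • cosPer (2 * k) +
        algebraMap ℝ Per (slope hbar) * v₃)) =
      slope₃ hbar • (cosPer k * (cosPer k * cosPer k * cosPer k)) +
      (3 * slope₂ hbar * (slope₂ hbar / (6 * slope hbar))) • (cosPer k * cosPer k * cosPer (2 * k)) +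
      slope hbar • (cosPer k * v₃) := by
    simp only [Algebra.smul_def, map_mul, map_ofNat]
    ring
  rw [e, map_add, map_add, map_smul, map_smul, map_smul, hmv3, mean_cosPer_sq_mul hk,
    mean_cosPer_pow_four hk]
  simp only [smul_eq_mul]
  field_simp
  ring

end IsSolOp

/-! ### Positive zeros of a one-parameter family of real functions. -/

lemma contDiffAt_partial_fst {F : ℝ × ℝ → ℝ} {p : ℝ × ℝ} (hF : ContDiffAt ℝ ω F p) :
    ContDiffAt ℝ ω (fun q => fderiv ℝ F q (1, 0)) p ∧
      ∀ᶠ q in 𝓝 p, HasDerivAt (fun r => F (r, q.2)) (fderiv ℝ F q (1, 0)) q.1 := by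
  refine ⟨?_, ?_⟩
  · have h1 : ContDiffAt ℝ ω (fderiv ℝ F) p := hF.fderiv_right (by simp)
    exact h1.clm_apply contDiffAt_const
  · filter_upwards [hF.eventually (by simp)] with q hq
    have h1 : HasFDerivAt F (fderiv ℝ F q) (q.1, q.2) := (hq.differentiableAt (by simp)).hasFDerivAt
    exact h1.comp_hasDerivAt q.1 ((hasDerivAt_id q.1).prodMk (hasDerivAt_const q.1 q.2))

lemma eventually_prod_iff_abs {ε₀ : ℝ} {P : ℝ → ℝ → Prop}
    (h : ∀ᶠ q in 𝓝 ((0, ε₀) : ℝ × ℝ), P q.1 q.2) :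
    ∃ δ > 0, ∀ r ε, |r| < δ → |ε - ε₀| < δ → P r ε := by
  obtain ⟨δ, hδ, h⟩ := Metric.eventually_nhds_iff.1 h
  refine ⟨δ, hδ, fun r ε hr hε => h (y := (r, ε)) ?_⟩
  rw [Prod.dist_eq, max_lt_iff]
  exact ⟨by simpa using hr, by rwa [Real.dist_eq]⟩

/-- An odd reduced function with positive third derivative is strictly convex for `r > 0`. -/
lemma exists_strictConvexOn {F : ℝ → ℝ → ℝ} {ε₀ : ℝ}
    (hF : ContDiffAt ℝ ω (fun q : ℝ × ℝ => F q.1 q.2) (0, ε₀))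
    (hodd : ∃ ρ > 0, ∀ ε r, |ε - ε₀| < ρ → |r| < ρ → F (-r) ε = -F r ε)
    (h3 : 0 < iteratedDeriv 3 (fun r => F r ε₀) 0) :
    ∃ δ > 0, ∀ ε, |ε - ε₀| < δ → ContinuousOn (fun r => F r ε) (Icc 0 δ) ∧
      StrictConvexOn ℝ (Icc 0 δ) (fun r => F r ε) := by
  obtain ⟨c1, d1⟩ := contDiffAt_partial_fst hF
  set F₁ : ℝ × ℝ → ℝ := fun q => fderiv ℝ (fun q : ℝ × ℝ => F q.1 q.2) q (1, 0) with hF₁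
  obtain ⟨c2, d2⟩ := contDiffAt_partial_fst c1
  set F₂ : ℝ × ℝ → ℝ := fun q => fderiv ℝ F₁ q (1, 0) with hF₂
  obtain ⟨c3, d3⟩ := contDiffAt_partial_fst c2
  set F₃ : ℝ × ℝ → ℝ := fun q => fderiv ℝ F₂ q (1, 0) with hF₃
  have hline : Tendsto (fun r : ℝ => (r, ε₀)) (𝓝 0) (𝓝 (0, ε₀)) :=
    (Continuous.prodMk_left ε₀).tendsto 0
  have h3' : F₃ (0, ε₀) = iteratedDeriv 3 (fun r => F r ε₀) 0 :=
    (iteratedDeriv_three_eq (g := fun r => F r ε₀) (g₁ := fun r => F₁ (r, ε₀))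
      (g₂ := fun r => F₂ (r, ε₀)) (hline.eventually d1) (hline.eventually d2) d3.self_of_nhds).symm
  have hpos : ∀ᶠ q in 𝓝 ((0, ε₀) : ℝ × ℝ), 0 < F₃ q :=
    continuousAt_const.eventually_lt c3.continuousAt (by rw [h3']; exact h3)
  obtain ⟨δ, hδ, hall⟩ := eventually_prod_iff_abs (P := fun r ε =>
    (HasDerivAt (fun r => F r ε) (F₁ (r, ε)) r ∧ HasDerivAt (fun r => F₁ (r, ε)) (F₂ (r, ε)) r) ∧
      HasDerivAt (fun r => F₂ (r, ε)) (F₃ (r, ε)) r ∧ 0 < F₃ (r, ε)) ((d1.and d2).and (d3.and hpos))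
  obtain ⟨ρ, hρ, hodd⟩ := hodd
  have hsmall : ∀ r ∈ Icc (0 : ℝ) (min (δ / 2) ρ), |r| < δ := fun r hr => by
    rw [abs_of_nonneg hr.1]
    linarith [hr.2.trans (min_le_left _ _)]
  refine ⟨min (δ / 2) ρ, by positivity, fun ε hε => ?_⟩
  have hεδ : |ε - ε₀| < δ := by linarith [hε.trans_le (min_le_left _ _)]
  have hερ : |ε - ε₀| < ρ := hε.trans_le (min_le_right _ _)
  have hcont : ContinuousOn (fun r => F r ε) (Icc 0 (min (δ / 2) ρ)) := fun r hr =>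
    (hall r ε (hsmall r hr) hεδ).1.1.continuousAt.continuousWithinAt
  refine ⟨hcont, ?_⟩
  have hnear : ∀ᶠ r : ℝ in 𝓝 0, |r| < min δ ρ := by
    filter_upwards [Metric.ball_mem_nhds (0 : ℝ) (lt_min hδ hρ)] with r hr
    simpa using hr
  have heven : ∀ᶠ r : ℝ in 𝓝 0, F₁ (-r, ε) = F₁ (r, ε) := by
    filter_upwards [hnear.eventually_nhds] with r hr
    have hr0 := hr.self_of_nhds
    have e1 : HasDerivAt (fun r => F (-r) ε) (F₁ (-r, ε) * -1) r :=
      HasDerivAt.comp r (h₂ := fun r => F r ε) (h := fun r : ℝ => -r)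
        (hall (-r) ε (by rw [abs_neg]; exact hr0.trans_le (min_le_left _ _)) hεδ).1.1 (hasDerivAt_neg r)
    have e2 : HasDerivAt (fun r => -F r ε) (-F₁ (r, ε)) r :=
      (hall r ε (hr0.trans_le (min_le_left _ _)) hεδ).1.1.fun_neg
    have e3 := e1.unique (e2.congr_of_eventuallyEq
      (hr.mono fun t ht => hodd ε t hερ (ht.trans_le (min_le_right _ _))))
    linarith
  -- The first derivative is even, so the second vanishes at `0`. As the third is positive near `(0,
  -- ε₀)`, the second is positive for `r > 0`.
  have hz : F₂ (0, ε) = 0 := by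
    have e0 := (hall 0 ε (by simpa using hδ) hεδ).1.2
    have e1 : HasDerivAt (fun r => F₁ (-r, ε)) (F₂ (0, ε) * -1) 0 := by
      refine HasDerivAt.comp 0 (h₂ := fun r => F₁ (r, ε)) (h := fun r : ℝ => -r) ?_ (hasDerivAt_neg 0)
      rw [neg_zero]; exact e0
    have := e1.unique (e0.congr_of_eventuallyEq heven)
    linarith
  have hmono : StrictMonoOn (fun r => F₂ (r, ε)) (Icc 0 (min (δ / 2) ρ)) := by
    refine strictMonoOn_of_deriv_pos (convex_Icc _ _) (fun r hr =>
      (hall r ε (hsmall r hr) hεδ).2.1.continuousAt.continuousWithinAt) fun r hr => ?_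
    rw [interior_Icc] at hr
    have := hall r ε (hsmall r (Ioo_subset_Icc_self hr)) hεδ
    rw [this.2.1.deriv]; exact this.2.2
  refine strictConvexOn_of_deriv2_pos (convex_Icc _ _) hcont fun r hr => ?_
  rw [interior_Icc] at hr
  have hr' := Ioo_subset_Icc_self hr
  have e : deriv (fun r => F r ε) =ᶠ[𝓝 r] fun r => F₁ (r, ε) := by
    filter_upwards [Ioo_mem_nhds hr.1 hr.2] with t ht
    exact (hall t ε (hsmall t (Ioo_subset_Icc_self ht)) hεδ).1.1.deriv
  change 0 < deriv (deriv fun r => F r ε) r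
  rw [e.deriv_eq, (hall r ε (hsmall r hr') hεδ).1.2.deriv, ← hz]
  exact hmono ⟨le_rfl, hr.1.le.trans hr.2.le⟩ hr' hr.1

lemma eventually_neg_of_hasDerivAt {g : ℝ → ℝ} {m : ℝ} (h0 : g 0 = 0) (hd : HasDerivAt g m 0)
    (hm : m < 0) : ∀ᶠ r in 𝓝[>] (0 : ℝ), g r < 0 := by
  have h := (hasDerivAt_iff_tendsto_slope.1 hd).mono_left (nhdsGT_le_nhdsNE 0)
  filter_upwards [h.eventually_lt_const hm, self_mem_nhdsWithin] with r hr hr0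
  rw [slope_def_field, h0, sub_zero, sub_zero, div_lt_iff₀ hr0, zero_mul] at hr
  exact hr

lemma lt_div_mul_of_strictConvexOn {g : ℝ → ℝ} {δ t r : ℝ} (hg : StrictConvexOn ℝ (Icc 0 δ) g)
    (h0 : g 0 = 0) (ht : 0 < t) (htr : t < r) (hr : r ≤ δ) : g t < t / r * g r := by
  have hr0 := ht.trans htr
  obtain ⟨-, hc⟩ := hg
  have := hc (x := 0) ⟨le_rfl, hr0.le.trans hr⟩ (y := r) ⟨hr0.le, hr⟩ hr0.ne (a := 1 - t / r)
    (b := t / r) (by rw [sub_pos, div_lt_one hr0]; exact htr) (by positivity) (by ring)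
  simp only [smul_eq_mul, mul_zero, zero_add, h0] at this
  rwa [div_mul_cancel₀ _ hr0.ne'] at this

/-- Zeros `r > 0` of an odd reduced function with positive third derivative: they exist exactly where
the linear coefficient is negative, and they are unique. -/
lemma exists_zero_structure {F : ℝ → ℝ → ℝ} {ε₀ : ℝ} {m : ℝ → ℝ}
    (hF : ContDiffAt ℝ ω (fun q : ℝ × ℝ => F q.1 q.2) (0, ε₀))
    (hodd : ∃ ρ > 0, ∀ ε r, |ε - ε₀| < ρ → |r| < ρ → F (-r) ε = -F r ε)
    (hzero : ∃ ρ > 0, ∀ ε, |ε - ε₀| < ρ → F 0 ε = 0)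
    (hm : ∃ ρ > 0, ∀ ε, |ε - ε₀| < ρ → HasDerivAt (fun r => F r ε) (m ε) 0) (hm0 : m ε₀ = 0)
    (h3 : 0 < iteratedDeriv 3 (fun r => F r ε₀) 0) :
    (∃ δ > 0, ∀ ε, |ε - ε₀| < δ → (∀ r, 0 < r → r < δ → F r ε = 0 → m ε < 0) ∧
      ∀ r r', 0 < r → r < δ → 0 < r' → r' < δ → F r ε = 0 → F r' ε = 0 → r = r') ∧
    ∀ η > 0, ∃ δ > 0, ∀ ε, |ε - ε₀| < δ → m ε < 0 → ∃ r, 0 < r ∧ r < η ∧ F r ε = 0 := by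
  obtain ⟨δ, hδ, hconv⟩ := exists_strictConvexOn hF hodd h3
  obtain ⟨ρ₁, hρ₁, hzero⟩ := hzero
  obtain ⟨ρ₂, hρ₂, hm⟩ := hm
  -- If `F r ε ≤ 0`, strict convexity gives `F (r / 2) ε < 0` and bounds the chord slopes from `0`
  -- to `t < r / 2` by a negative number. Their limit as `t` tends to `0` is `m ε`, a contradiction.
  have hpos : ∀ ε, |ε - ε₀| < δ → |ε - ε₀| < ρ₁ → |ε - ε₀| < ρ₂ → 0 ≤ m ε →
      ∀ r, 0 < r → r ≤ δ → 0 < F r ε := by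
    intro ε h1 h2 h3 hme r hr hrδ
    have hc := (hconv ε h1).2
    by_contra hneg
    push Not at hneg
    have hhalf := lt_div_mul_of_strictConvexOn hc (hzero ε h2) (half_pos hr) (half_lt_self hr) hrδ
    have hhalf' : F (r / 2) ε < 0 := by
      rw [div_right_comm, div_self hr.ne'] at hhalf; linarith
    have hev : ∀ᶠ t in 𝓝[>] (0 : ℝ), F t ε / t ≤ F (r / 2) ε / (r / 2) := by
      filter_upwards [Ioo_mem_nhdsGT (half_pos hr)] with t ht
      have := lt_div_mul_of_strictConvexOn hc (hzero ε h2) ht.1 ht.2 (by linarith)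
      rw [div_le_iff₀ ht.1]
      refine this.le.trans (le_of_eq ?_)
      field_simp
    have hlim : Tendsto (fun t => F t ε / t) (𝓝[>] 0) (𝓝 (m ε)) := by
      have h := (hasDerivAt_iff_tendsto_slope.1 (hm ε h3)).mono_left (nhdsGT_le_nhdsNE 0)
      refine h.congr fun t => ?_
      rw [slope_def_field, hzero ε h2, sub_zero, sub_zero]
    have hle := le_of_tendsto hlim hev
    have : F (r / 2) ε / (r / 2) < 0 := div_neg_of_neg_of_pos hhalf' (half_pos hr)
    linarith
  refine ⟨⟨min δ (min ρ₁ ρ₂), by positivity, fun ε hε => ?_⟩, fun η hη => ?_⟩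
  · simp only [lt_min_iff] at hε
    obtain ⟨hε1, hε2, hε3⟩ := hε
    refine ⟨fun r hr hrδ h0 => ?_, ?_⟩
    · by_contra hneg
      exact (hpos ε hε1 hε2 hε3 (not_lt.1 hneg) r hr (hrδ.le.trans (min_le_left _ _))).ne' h0
    · have key : ∀ r r', 0 < r → r < r' → r' < min δ (min ρ₁ ρ₂) → F r ε = 0 → F r' ε = 0 → False := by
        intro r r' hr hrr' hr' h0 h0'
        have := lt_div_mul_of_strictConvexOn (hconv ε hε1).2 (hzero ε hε2) hr hrr'
          (hr'.le.trans (min_le_left _ _))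
        rw [h0, h0', mul_zero] at this
        exact lt_irrefl _ this
      intro r r' hr hrδ hr' hrδ' h0 h0'
      rcases lt_trichotomy r r' with h | h | h
      · exact (key r r' hr h hrδ' h0 h0').elim
      · exact h
      · exact (key r' r hr' h hrδ h0' h0).elim
  · obtain ⟨δ', hδ', hcont⟩ := eventually_prod_iff_abs (P := fun r ε =>
      ContinuousAt (fun q : ℝ × ℝ => F q.1 q.2) (r, ε))
      ((hF.eventually (by simp)).mono fun q hq => hq.continuousAt)
    set r₀ : ℝ := min (η / 2) (min δ (δ' / 2)) with hr₀
    have hr₀pos : 0 < r₀ := by positivity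
    have hr₀η : r₀ < η := (min_le_left _ _).trans_lt (by linarith)
    have hr₀δ : r₀ ≤ δ := (min_le_right _ _).trans (min_le_left _ _)
    have hr₀δ' : r₀ < δ' := ((min_le_right _ _).trans (min_le_right _ _)).trans_lt (by linarith)
    -- The linear coefficient vanishes at `ε₀`, so `F r₀ ε₀` is positive and stays so for nearby
    -- `ε`. A negative linear coefficient makes `F` negative close to `0`, and the intermediate
    -- value theorem in `r` gives the zero.
    have hFr₀ : 0 < F r₀ ε₀ := hpos ε₀ (by simpa using hδ) (by simpa using hρ₁) (by simpa using hρ₂)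
      hm0.ge r₀ hr₀pos hr₀δ
    have hce : ContinuousAt (fun ε => F r₀ ε) ε₀ :=
      ContinuousAt.comp (g := fun q : ℝ × ℝ => F q.1 q.2) (f := fun ε => (r₀, ε))
        (hcont r₀ ε₀ (by rwa [abs_of_pos hr₀pos]) (by simpa using hδ'))
        (Continuous.prodMk_right r₀).continuousAt
    obtain ⟨δ₂, hδ₂, hpos₂⟩ := Metric.eventually_nhds_iff.1
      (continuousAt_const.eventually_lt hce hFr₀)
    refine ⟨min (min δ δ₂) (min ρ₁ ρ₂), by positivity, fun ε hε hme => ?_⟩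
    simp only [lt_min_iff] at hε
    obtain ⟨⟨hε1, hε4⟩, hε2, hε3⟩ := hε
    have hneg := eventually_neg_of_hasDerivAt (hzero ε hε2) (hm ε hε3) hme
    obtain ⟨r₁, hr₁neg, hr₁⟩ := (hneg.and (Ioo_mem_nhdsGT hr₀pos)).exists
    have hp : 0 < F r₀ ε := hpos₂ (by rwa [Real.dist_eq])
    obtain ⟨r, hr, hr0⟩ := intermediate_value_Icc hr₁.2.le
      ((hconv ε hε1).1.mono (Icc_subset_Icc hr₁.1.le hr₀δ)) ⟨hr₁neg.le, hp.le⟩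
    exact ⟨r, hr₁.1.trans_le hr.1, hr.2.trans_lt hr₀η, hr0⟩

/-- Zeros `r > 0` of a reduced function accumulate at a parameter where the linear coefficient changes
sign. -/
lemma exists_zero_of_sign_change {F : ℝ → ℝ → ℝ} {ε₀ : ℝ} {m : ℝ → ℝ}
    (hF : ContDiffAt ℝ ω (fun q : ℝ × ℝ => F q.1 q.2) (0, ε₀))
    (hzero : ∃ ρ > 0, ∀ ε, |ε - ε₀| < ρ → F 0 ε = 0)
    (hm : ∃ ρ > 0, ∀ ε, |ε - ε₀| < ρ → HasDerivAt (fun r => F r ε) (m ε) 0)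
    (hmneg : ∀ ε, ε₀ < ε → m ε < 0) (hmpos : ∃ ρ > 0, ∀ ε, ε < ε₀ → ε₀ - ρ < ε → 0 < m ε) {η : ℝ}
    (hη : 0 < η) : ∃ r ε, 0 < r ∧ r < η ∧ |ε - ε₀| < η ∧ F r ε = 0 := by
  obtain ⟨ρ₁, hρ₁, hzero⟩ := hzero
  obtain ⟨ρ₂, hρ₂, hm⟩ := hm
  obtain ⟨ρ₃, hρ₃, hmpos⟩ := hmpos
  obtain ⟨δ', hδ', hcont⟩ := eventually_prod_iff_abs (P := fun r ε =>
    ContinuousAt (fun q : ℝ × ℝ => F q.1 q.2) (r, ε))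
    ((hF.eventually (by simp)).mono fun q hq => hq.continuousAt)
  obtain ⟨d, hd0, hd⟩ := exists_between (show 0 < min (min ρ₁ ρ₂) (min ρ₃ (min δ' η)) by positivity)
  simp only [lt_min_iff] at hd
  obtain ⟨⟨hd1, hd2⟩, hd3, hd4, hd5⟩ := hd
  have a1 : |ε₀ + d - ε₀| = d := by rw [add_sub_cancel_left, abs_of_pos hd0]
  have a2 : |ε₀ - d - ε₀| = d := by rw [sub_sub_cancel_left, abs_neg, abs_of_pos hd0]
  have h1 := eventually_neg_of_hasDerivAt (hzero (ε₀ + d) (by rwa [a1])) (hm _ (by rwa [a1]))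
    (hmneg _ (by linarith))
  have h2 := eventually_neg_of_hasDerivAt (g := fun r => -F r (ε₀ - d))
    (by simp [hzero (ε₀ - d) (by rwa [a2])]) (hm (ε₀ - d) (by rwa [a2])).fun_neg
    (neg_lt_zero.2 (hmpos _ (by linarith) (by linarith)))
  -- One `r` at which `F` is negative at `ε₀ + d` and positive at `ε₀ - d`. The intermediate value
  -- theorem is applied in `ε`, so no condition on the cubic term is needed.
  obtain ⟨r, ⟨hr1, hr2⟩, hr0, hr⟩ := ((h1.and h2).and (Ioo_mem_nhdsGT (lt_min hη hδ'))).exists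
  simp only [lt_min_iff] at hr
  have hc : ContinuousOn (fun ε => F r ε) (Icc (ε₀ - d) (ε₀ + d)) := fun ε hε =>
    (ContinuousAt.comp (g := fun q : ℝ × ℝ => F q.1 q.2) (f := fun ε => (r, ε))
      (hcont r ε (by rw [abs_of_pos hr0]; exact hr.2)
        (by rw [abs_lt]; constructor <;> linarith [hε.1, hε.2]))
      (Continuous.prodMk_right r).continuousAt).continuousWithinAt
  obtain ⟨ε, hε, h0⟩ := intermediate_value_Icc' (by linarith) hc ⟨hr1.le, by linarith⟩
  exact ⟨r, ε, hr0, hr.1, by rw [abs_lt]; constructor <;> linarith [hε.1, hε.2], h0⟩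

/-! ### Passage between `C²` functions on `[0,1]` and fixed points in `Per`. -/

lemma uniqueDiffOn_unit : UniqueDiffOn ℝ (Icc (0 : ℝ) 1) := uniqueDiffOn_Icc zero_lt_one

lemma D_congr {n : ℕ} {u v : ℝ → ℝ} (h : EqOn u v (Icc 0 1)) {x : ℝ} (hx : x ∈ Icc (0 : ℝ) 1) :
    D n u x = D n v x := iteratedDerivWithin_congr h hx

lemma exists_per_of_continuousOn {v : ℝ → ℝ} (hv : ContinuousOn v (Icc 0 1)) (h01 : v 0 = v 1) :
    ∃ V : Per, ∀ x ∈ Icc (0 : ℝ) 1, V (x : UnitAddCircle) = v x := by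
  refine ⟨⟨AddCircle.liftIco 1 0 v, AddCircle.liftIco_zero_continuous h01 hv⟩, fun x hx => ?_⟩
  have hI : ∀ x ∈ Ico (0 : ℝ) 1, AddCircle.liftIco 1 0 v (x : UnitAddCircle) = v x := fun x hx =>
    AddCircle.liftIco_coe_apply (by simpa using hx)
  rcases eq_or_lt_of_le hx.2 with rfl | h1
  · have : ((1 : ℝ) : UnitAddCircle) = ((0 : ℝ) : UnitAddCircle) := by simp
    change AddCircle.liftIco 1 0 v ((1 : ℝ) : UnitAddCircle) = v 1
    rw [this, hI 0 ⟨le_rfl, one_pos⟩, h01]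
  · exact hI x ⟨hx.1, h1⟩

lemma hasDerivAt_D {v : ℝ → ℝ} {n : ℕ} (hv : ContDiffOn ℝ (n + 1) v (Icc 0 1)) {x : ℝ}
    (hx : x ∈ Ioo (0 : ℝ) 1) : HasDerivAt (D n v) (D (n + 1) v x) x := by
  have h1 := hv.differentiableOn_iteratedDerivWithin (m := n) (by exact_mod_cast Nat.lt_succ_self n)
    uniqueDiffOn_unit x (Ioo_subset_Icc_self hx)
  have h2 := h1.hasDerivWithinAt.hasDerivAt (Icc_mem_nhds hx.1 hx.2)
  rw [← iteratedDerivWithin_succ] at h2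
  exact h2

lemma D_zero (v : ℝ → ℝ) (x : ℝ) : D 0 v x = v x := by rw [D, iteratedDerivWithin_zero]

lemma integral_eq_mean {φ : ℝ → ℝ} {Φ : Per} (h : ∀ x ∈ Icc (0 : ℝ) 1, φ x = Φ (x : UnitAddCircle)) :
    ∫ x in (0 : ℝ)..1, φ x = mean Φ := by
  rw [mean_apply]
  refine intervalIntegral.integral_congr fun x hx => ?_
  rw [uIcc_of_le zero_le_one] at hx
  exact h x hx

/-- A periodic function on `[0,1]` of mean zero is recovered from its second derivative by `K`. -/
lemma K_eq_of_D_two {v : ℝ → ℝ} (hv : ContDiffOn ℝ 2 v (Icc 0 1)) (hbc : D 1 v 0 = D 1 v 1)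
    (hmean : ∫ x in (0 : ℝ)..1, v x = 0) {V F : Per} (hV : ∀ x ∈ Icc (0 : ℝ) 1, V (x : UnitAddCircle) = v x)
    (hF : ∀ x ∈ Ioo (0 : ℝ) 1, D 2 v x = F (x : UnitAddCircle)) : K F = V := by
  obtain ⟨V₁, hV₁⟩ := exists_per_of_continuousOn (v := D 1 v)
    (hv.continuousOn_iteratedDerivWithin (m := 1) (by norm_num) uniqueDiffOn_unit) hbc
  have hmV : mean V = 0 := (integral_eq_mean fun x hx => (hV x hx).symm).symm.trans hmean
  have d1 : ∀ x ∈ Ioo (0 : ℝ) 1,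
      HasDerivAt (fun x : ℝ => V (x : UnitAddCircle)) (V₁ (x : UnitAddCircle)) x := by
    intro x hx
    have h1 := hasDerivAt_D (n := 0) (hv.of_le (by norm_num)) hx
    rw [hV₁ x (Ioo_subset_Icc_self hx)]
    refine h1.congr_of_eventuallyEq ?_
    filter_upwards [Ioo_mem_nhds hx.1 hx.2] with t ht
    rw [hV t (Ioo_subset_Icc_self ht), D_zero]
  have d2 : ∀ x ∈ Ioo (0 : ℝ) 1,
      HasDerivAt (fun x : ℝ => V₁ (x : UnitAddCircle)) (F (x : UnitAddCircle)) x := by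
    intro x hx
    have h1 := hasDerivAt_D (n := 1) (hv.of_le (by norm_num)) hx
    rw [← hF x hx]
    refine h1.congr_of_eventuallyEq ?_
    filter_upwards [Ioo_mem_nhds hx.1 hx.2] with t ht
    exact hV₁ t (Ioo_subset_Icc_self ht)
  have m1 := mean_eq_zero_of_hasDerivAt d1
  have m2 := mean_eq_zero_of_hasDerivAt d2
  have j2 : J F = V₁ := by
    rw [J_eq_of_hasDerivAt (U := V₁) (fun x hx => by rw [m2, sub_zero]; exact d2 x hx), m1]; simp
  rw [K_apply, j2, J_eq_of_hasDerivAt (U := V) (fun x hx => by rw [m1, sub_zero]; exact d1 x hx), hmV]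
  simp

/-- `V₁` and `V₂` are the first two derivatives of `V`. -/
structure HasDerivs (V V₁ V₂ : Per) : Prop where
  fst : ∀ x : ℝ, HasDerivAt (fun x : ℝ => V (x : UnitAddCircle)) (V₁ (x : UnitAddCircle)) x
  snd : ∀ x : ℝ, HasDerivAt (fun x : ℝ => V₁ (x : UnitAddCircle)) (V₂ (x : UnitAddCircle)) x

lemma hasDerivs_K (F : Per) : HasDerivs (K F) (J F) (F - algebraMap ℝ Per (mean F)) where
  fst x := by simpa [K_apply] using hasDerivAt_J (J F) x
  snd x := by simpa using hasDerivAt_J F x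

namespace HasDerivs

variable {V V₁ V₂ : Per}

lemma contDiff (h : HasDerivs V V₁ V₂) : ContDiff ℝ 2 fun x : ℝ => V (x : UnitAddCircle) := by
  have e1 : deriv (fun x : ℝ => V (x : UnitAddCircle)) = fun x : ℝ => V₁ (x : UnitAddCircle) :=
    funext fun x => (h.fst x).deriv
  have e2 : deriv (fun x : ℝ => V₁ (x : UnitAddCircle)) = fun x : ℝ => V₂ (x : UnitAddCircle) :=
    funext fun x => (h.snd x).deriv
  rw [show (2 : WithTop ℕ∞) = 1 + 1 by norm_num, contDiff_succ_iff_deriv, e1]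
  refine ⟨fun x => (h.fst x).differentiableAt, by simp, ?_⟩
  rw [contDiff_one_iff_deriv, e2]
  exact ⟨fun x => (h.snd x).differentiableAt, V₂.continuous_coe⟩

lemma D_one (h : HasDerivs V V₁ V₂) {x : ℝ} (hx : x ∈ Icc (0 : ℝ) 1) :
    D 1 (fun x : ℝ => V (x : UnitAddCircle)) x = V₁ (x : UnitAddCircle) := by
  rw [D, iteratedDerivWithin_one, (h.fst x).hasDerivWithinAt.derivWithin (uniqueDiffOn_unit x hx)]

lemma D_two (h : HasDerivs V V₁ V₂) {x : ℝ} (hx : x ∈ Icc (0 : ℝ) 1) :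
    D 2 (fun x : ℝ => V (x : UnitAddCircle)) x = V₂ (x : UnitAddCircle) := by
  rw [D, iteratedDerivWithin_succ]
  have : EqOn (iteratedDerivWithin 1 (fun x : ℝ => V (x : UnitAddCircle)) (Icc 0 1))
    (fun x : ℝ => V₁ (x : UnitAddCircle)) (Icc 0 1) := fun x hx => h.D_one hx
  rw [derivWithin_congr this (this hx),
    (h.snd x).hasDerivWithinAt.derivWithin (uniqueDiffOn_unit x hx)]

lemma c2Small (h : HasDerivs V V₁ V₂) {η : ℝ} (h0 : ‖V‖ < η) (h1 : ‖V₁‖ < η) (h2 : ‖V₂‖ < η) :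
    C2Small η (fun x : ℝ => V (x : UnitAddCircle)) := by
  intro n hn x hx
  interval_cases n
  · rw [D_zero]; exact (V.abs_le_norm _).trans_lt h0
  · rw [h.D_one hx]; exact (V₁.abs_le_norm _).trans_lt h1
  · rw [h.D_two hx]; exact (V₂.abs_le_norm _).trans_lt h2

lemma mem_domG (h : HasDerivs V V₁ V₂) (hm : mean V = 0) :
    (fun x : ℝ => V (x : UnitAddCircle)) ∈ DomG := by
  refine ⟨h.contDiff.contDiffOn, ?_, ?_, hm⟩
  · simpa using (V.periodic_coe 0).symm
  · rw [h.D_one (by simp), h.D_one (by simp)]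
    simpa using (V₁.periodic_coe 0).symm

end HasDerivs

/-- `K F` is small in `C²` if the oscillation of `F` is small. -/
lemma exists_c2Small_K {η : ℝ} (hη : 0 < η) : ∃ δ > 0, ∀ F : Per,
    ‖F - algebraMap ℝ Per (mean F)‖ < δ → C2Small η (fun x : ℝ => K F (x : UnitAddCircle)) := by
  -- The constant dominates `‖K‖`, `‖J‖` and `1`, which bound the function, its first and its second
  -- derivative.
  set c : ℝ := 1 + ‖J‖ + ‖K‖ with hc
  have hcpos : 0 < c := by positivity
  refine ⟨η / c, by positivity, fun F hF => ?_⟩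
  set F' := F - algebraMap ℝ Per (mean F) with hF'
  have hb : ∀ t : ℝ, 0 ≤ t → t ≤ c → t * ‖F'‖ < η := fun t _ htc => by
    rw [lt_div_iff₀ hcpos] at hF
    nlinarith [norm_nonneg F']
  refine (hasDerivs_K F).c2Small ?_ ?_ ?_
  · have : K F = K F' := by rw [hF', map_sub, K_const, sub_zero]
    rw [this]
    exact (K.le_opNorm F').trans_lt (hb _ (norm_nonneg _) (by rw [hc]; linarith [norm_nonneg J]))
  · have : J F = J F' := by rw [hF', map_sub, J_const, sub_zero]
    rw [this]
    exact (J.le_opNorm F').trans_lt (hb _ (norm_nonneg _) (by rw [hc]; linarith [norm_nonneg K]))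
  · have := hb 1 zero_le_one (by rw [hc]; linarith [norm_nonneg K, norm_nonneg J])
    rwa [one_mul] at this

/-- The expression is continuous in `(ε, V)` and vanishes at `V = 0`, where the nonlinearity is
constant. It upgrades uniform smallness of solutions to smallness in `C²`. -/
lemma exists_small_of_map_const {Q : Per →L[ℝ] Per} (hQ : ∀ c, Q (algebraMap ℝ Per c) = 0)
    {hbar ε₀ : ℝ} (hb : 0 < hbar) (hε : 0 < ε₀) {η : ℝ} (hη : 0 < η) :
    ∃ ρ > 0, ∀ ε V, |ε - ε₀| < ρ → ‖V‖ < ρ → ‖-(ε ^ 2)⁻¹ • Q (nonlin hbar V)‖ < η := by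
  refine eventually_prod_iff_ball (P := fun ε V => ‖-(ε ^ 2)⁻¹ • Q (nonlin hbar V)‖ < η) ?_
  have h1 : ContinuousAt (fun p : ℝ × Per => nonlin hbar p.2) (ε₀, 0) :=
    ContinuousAt.comp (g := nonlin hbar) (f := Prod.snd)
      (contDiffAt_superpos (by simpa using hb) _ _ _ _).continuousAt continuousAt_snd
  have h2 : ContinuousAt (fun p : ℝ × Per => ‖-(p.1 ^ 2)⁻¹ • Q (nonlin hbar p.2)‖) (ε₀, 0) :=
    ((((continuousAt_fst.pow 2).inv₀ (by simpa using hε.ne')).neg).smul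
      (Q.continuous.continuousAt.comp h1)).norm
  refine h2.eventually_lt continuousAt_const ?_
  rw [nonlin_zero hb, hQ]
  simpa using hη

lemma ip_eq_mean {φ ψ : ℝ → ℝ} {Φ Ψ : Per} (h : ∀ x ∈ Icc (0 : ℝ) 1, φ x = Φ (x : UnitAddCircle))
    (h' : ∀ x ∈ Icc (0 : ℝ) 1, ψ x = Ψ (x : UnitAddCircle)) : ip φ ψ = mean (Φ * Ψ) :=
  integral_eq_mean fun x hx => by simp [h x hx, h' x hx]

lemma E_eq_projE {k : ℕ} {φ : ℝ → ℝ} {Φ : Per} (h : ∀ x ∈ Icc (0 : ℝ) 1, φ x = Φ (x : UnitAddCircle))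
    {x : ℝ} (hx : x ∈ Icc (0 : ℝ) 1) : E k φ x = projE k Φ (x : UnitAddCircle) := by
  rw [E, ip_eq_mean (φ := w₁ k) (Φ := cosPer k) (fun _ _ => rfl) h,
    ip_eq_mean (φ := w₂ k) (Φ := sinPer k) (fun _ _ => rfl) h, h x hx]
  simp [projE_apply]

lemma norm_lt_of_Icc {u : Per} {c : ℝ} (h : ∀ x ∈ Icc (0 : ℝ) 1, |u (x : UnitAddCircle)| < c) :
    ‖u‖ < c := by
  rw [ContinuousMap.norm_lt_iff_of_nonempty]
  intro x
  induction x using QuotientAddGroup.induction_on with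
  | H x =>
    have := h _ ⟨Int.fract_nonneg x, (Int.fract_lt_one x).le⟩
    rw [Per.coe_fract] at this
    exact this

/-- A steady state close to the constant solves the fixed point equation. -/
lemma exists_per_of_isSteadyState {hbar ε ρ : ℝ} {h : ℝ → ℝ} (hs : IsSteadyState hbar ε h) (hε : 0 < ε)
    (hρ : ρ ≤ hbar) (hsmall : C2Small ρ (fun x => h x - hbar)) :
    ∃ V : Per, (∀ x ∈ Icc (0 : ℝ) 1, h x = hbar + V (x : UnitAddCircle)) ∧ ‖V‖ < ρ ∧
      V + (ε ^ 2)⁻¹ • K (nonlin hbar V) = 0 := by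
  have hv : ContDiffOn ℝ 2 (fun x => h x - hbar) (Icc 0 1) := hs.smooth.sub contDiffOn_const
  have hD : ∀ n, 0 < n → ∀ x, D n (fun x => h x - hbar) x = D n h x := fun n hn x => by
    simp only [D, sub_eq_neg_add]
    exact iteratedDerivWithin_const_add hn _
  obtain ⟨V, hV⟩ := exists_per_of_continuousOn (v := fun x => h x - hbar) hv.continuousOn
    (by simp [hs.bc])
  have hn : ‖V‖ < ρ := norm_lt_of_Icc fun x hx => by
    have := hsmall 0 (by norm_num) x hx
    rwa [D_zero, ← hV x hx] at this
  have hhV : ∀ x ∈ Icc (0 : ℝ) 1, h x = V (x : UnitAddCircle) + hbar := fun x hx => by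
    rw [hV x hx]; ring
  have hint : ∫ y in (0 : ℝ)..1, f (h y) = mean (nonlin hbar V) :=
    integral_eq_mean fun x hx => by rw [nonlin_apply (hn.trans_le hρ), hhV x hx]
  refine ⟨V, fun x hx => by rw [hhV x hx, add_comm], hn, ?_⟩
  have hK := K_eq_of_D_two hv (by rw [hD 1 one_pos, hD 1 one_pos, hs.bc_deriv]) (by
      rw [intervalIntegral.integral_sub
        (hs.smooth.continuousOn.intervalIntegrable_of_Icc zero_le_one) intervalIntegrable_const,
        hs.mean]; simp) hV
    (F := -(ε ^ 2)⁻¹ • (nonlin hbar V - algebraMap ℝ Per (mean (nonlin hbar V)))) (fun x hx => by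
      have he := hs.eqn x hx
      rw [hint, hhV x (Ioo_subset_Icc_self hx), ← nonlin_apply (hn.trans_le hρ)] at he
      rw [hD 2 two_pos]
      simp only [ContinuousMap.smul_apply, ContinuousMap.sub_apply, Per.algebraMap_eval, smul_eq_mul]
      field_simp
      linarith)
  rw [map_smul, map_sub, K_const, sub_zero, neg_smul] at hK
  nth_rewrite 1 [← hK]
  exact neg_add_cancel _

/-- Solutions of the fixed point equation are steady states. -/
lemma isSteadyState_of_per {hbar ε : ℝ} {V : Per} (hε : 0 < ε) (hb : ‖V‖ < hbar)
    (hV : V + (ε ^ 2)⁻¹ • K (nonlin hbar V) = 0) :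
    IsSteadyState hbar ε (fun x => hbar + V (x : UnitAddCircle)) := by
  have hVK : V = K (-(ε ^ 2)⁻¹ • nonlin hbar V) := by
    rw [map_smul, neg_smul]; exact eq_neg_of_add_eq_zero_left hV
  have hd := hasDerivs_K (-(ε ^ 2)⁻¹ • nonlin hbar V)
  rw [← hVK] at hd
  have hm : mean V = 0 := by rw [hVK, mean_K]
  have hD : ∀ n, 0 < n → ∀ x, D n (fun x : ℝ => hbar + V (x : UnitAddCircle)) x =
      D n (fun x : ℝ => V (x : UnitAddCircle)) x := fun n hn x => iteratedDerivWithin_const_add hn _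
  obtain ⟨h1, h2, h3, h4⟩ := hd.mem_domG hm
  refine ⟨fun x _ => ?_, contDiffOn_const.add h1, fun x hx => ?_, congrArg (hbar + ·) h2, ?_, ?_⟩
  · have := (abs_le.1 (V.abs_le_norm x)).1
    linarith
  · have hint : ∫ y in (0 : ℝ)..1, f (hbar + V (y : UnitAddCircle)) = mean (nonlin hbar V) :=
      integral_eq_mean fun x hx => by rw [nonlin_apply hb, add_comm]
    rw [hint, hD 2 two_pos, hd.D_two (Ioo_subset_Icc_self hx), add_comm hbar, ← nonlin_apply hb]
    simp only [ContinuousMap.smul_apply, ContinuousMap.sub_apply, Per.algebraMap_eval, smul_eq_mul,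
      map_smul]
    field_simp
    ring
  · rw [hD 1 one_pos, hD 1 one_pos, h3]
  · rw [intervalIntegral.integral_add intervalIntegrable_const (V.intervalIntegrable _ _), h4]; simp

/-- Solutions of the fixed point equation that are uniformly small are small in `C²`. -/
lemma exists_c2Small_of_per {hbar ε₀ : ℝ} (hb : 0 < hbar) (hε : 0 < ε₀) {η : ℝ} (hη : 0 < η) :
    ∃ ρ > 0, ∀ ε V, |ε - ε₀| < ρ → ‖V‖ < ρ → V + (ε ^ 2)⁻¹ • K (nonlin hbar V) = 0 →
      C2Small η (fun x : ℝ => hbar + V (x : UnitAddCircle) - hbar) := by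
  obtain ⟨δ, hδ, hK⟩ := exists_c2Small_K hη
  obtain ⟨ρ, hρ, hs⟩ := exists_small_of_map_const
    (Q := ContinuousLinearMap.id ℝ Per - mean.smulRight 1) (fun c => by
      simp [Algebra.algebraMap_eq_smul_one]) hb hε hδ
  refine ⟨ρ, hρ, fun ε V h1 h2 hV => ?_⟩
  have hVK : V = K (-(ε ^ 2)⁻¹ • nonlin hbar V) := by
    rw [map_smul, neg_smul]; exact eq_neg_of_add_eq_zero_left hV
  simp only [add_sub_cancel_left]
  rw [hVK]
  refine hK _ ?_
  convert hs ε V h1 h2 using 2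
  simp [Algebra.algebraMap_eq_smul_one, smul_sub, smul_smul]

/-! ### The Liapunov–Schmidt reduction in terms of `G`, `E` and `M`. -/

lemma mean_cosPer_mul_const {k : ℕ} (hk : 1 ≤ k) (c : ℝ) : mean (cosPer k * algebraMap ℝ Per c) = 0 := by
  rw [mul_comm, ← Algebra.smul_def, map_smul, mean_cosPer hk, smul_zero]

lemma mean_sinPer_mul_const (k : ℕ) (c : ℝ) : mean (sinPer k * algebraMap ℝ Per c) = 0 := by
  rw [mul_comm, ← Algebra.smul_def, map_smul, mean_sinPer, smul_zero]

lemma projE_const {k : ℕ} (hk : 1 ≤ k) (c : ℝ) : projE k (algebraMap ℝ Per c) = algebraMap ℝ Per c :=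
  projE_eq_self (mean_cosPer_mul_const hk c) (mean_sinPer_mul_const k c)

/-- The element `x cos (2πk·) + y sin (2πk·)` of the kernel. -/
def kerVec (k : ℕ) (x y : ℝ) : Per := x • cosPer k + y • sinPer k

lemma kerVec_coe (k : ℕ) (x y t : ℝ) : kerVec k x y (t : UnitAddCircle) = x * w₁ k t + y * w₂ k t := by
  simp [kerVec]

lemma norm_kerVec_le (k : ℕ) (x y : ℝ) : ‖kerVec k x y‖ ≤ |x| + |y| := by
  refine (norm_add_le _ _).trans ?_
  rw [norm_smul, norm_smul, Real.norm_eq_abs, Real.norm_eq_abs]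
  nlinarith [norm_cosPer_le k, norm_sinPer_le k, abs_nonneg x, abs_nonneg y]

lemma projE_kerVec {k : ℕ} (hk : 1 ≤ k) (x y : ℝ) : projE k (kerVec k x y) = 0 := by
  simp [kerVec, projE_cosPer hk, projE_sinPer hk]

lemma mean_cosPer_mul_kerVec {k : ℕ} (hk : 1 ≤ k) (x y : ℝ) : mean (cosPer k * kerVec k x y) = x / 2 := by
  simp only [kerVec, mul_add, mul_smul_comm, map_add, map_smul, mean_cosPer_mul_self hk,
    mean_cosPer_mul_sinPer, smul_eq_mul]
  ring

lemma mean_sinPer_mul_kerVec {k : ℕ} (hk : 1 ≤ k) (x y : ℝ) : mean (sinPer k * kerVec k x y) = y / 2 := by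
  simp only [kerVec, mul_add, mul_smul_comm, map_add, map_smul, mean_sinPer_mul_self hk,
    mul_comm (sinPer k) (cosPer k), mean_cosPer_mul_sinPer, smul_eq_mul]
  ring

lemma hasDerivs_kerVec (k : ℕ) (x y : ℝ) : HasDerivs (kerVec k x y)
    (kerVec k (2 * k * Real.pi * y) (-(2 * k * Real.pi * x)))
    (-((2 * k * Real.pi) ^ 2) • kerVec k x y) := by
  have key : ∀ x y t : ℝ, HasDerivAt (fun t : ℝ => kerVec k x y (t : UnitAddCircle))
      (kerVec k (2 * k * Real.pi * y) (-(2 * k * Real.pi * x)) (t : UnitAddCircle)) t := by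
    intro x y t
    simp only [kerVec_coe]
    convert! ((hasDerivAt_w₁ k t).const_mul x).fun_add ((hasDerivAt_w₂ k t).const_mul y) using 1
    ring
  refine ⟨key x y, fun t => ?_⟩
  convert! key _ _ t using 1
  simp only [ContinuousMap.smul_apply, kerVec_coe, smul_eq_mul]
  ring

lemma D_two_kerVec_add {k : ℕ} {x y : ℝ} {u : ℝ → ℝ} (hu : ContDiffOn ℝ 2 u (Icc 0 1)) {t : ℝ}
    (ht : t ∈ Icc (0 : ℝ) 1) : D 2 (fun s => x * w₁ k s + y * w₂ k s + u s) t =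
      -((2 * k * Real.pi) ^ 2) * kerVec k x y (t : UnitAddCircle) + D 2 u t := by
  have h1 := hasDerivs_kerVec k x y
  have h2 := h1.D_two ht
  have h3 := h1.contDiff
  simp only [kerVec_coe] at h2 h3
  simp only [D] at h2 ⊢
  rw [iteratedDerivWithin_fun_add ht uniqueDiffOn_unit h3.contDiffAt.contDiffWithinAt (hu t ht), h2]
  simp [kerVec_coe]

/-- The steady state operator at a function with derivatives in `Per`. -/
def perG (hbar ε : ℝ) (V V₂ : Per) : Per :=
  ε ^ 2 • V₂ + nonlin hbar V - algebraMap ℝ Per (mean (nonlin hbar V))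

lemma G_eq_perG {hbar ε : ℝ} {v : ℝ → ℝ} {V V₂ : Per} (hb : ‖V‖ < hbar)
    (hV : ∀ t ∈ Icc (0 : ℝ) 1, v t = V (t : UnitAddCircle))
    (hD : ∀ t ∈ Icc (0 : ℝ) 1, D 2 v t = V₂ (t : UnitAddCircle)) :
    ∀ t ∈ Icc (0 : ℝ) 1, G hbar ε v t = perG hbar ε V V₂ (t : UnitAddCircle) := by
  intro t ht
  rw [G, integral_eq_mean (Φ := nonlin hbar V) fun x hx => by rw [nonlin_apply hb, hV x hx],
    hD t ht, hV t ht, ← nonlin_apply hb]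
  simp [perG]

/-- The complementary component of the solution of the projected equation. -/
def solW (k : ℕ) (S : ℝ × Per → Per) (x y ε : ℝ) (t : ℝ) : ℝ :=
  (S (ε, kerVec k x y) - kerVec k x y) (t : UnitAddCircle)

namespace IsSolOp

variable {hbar ε₀ : ℝ} {k : ℕ} {S : ℝ × Per → Per}

/-- The projected equation writes the complementary part as `K F` with `F = -ε⁻² E f(hbar + V)`,
hence it is `C²` with second derivative `F - mean F`. Inserting this, `G` becomes `-(2kπ)² ε² kerVec
+ (1 - E) f(hbar + V)`: it is annihilated by `E`, and its pairings with the kernel are the functions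
`reduced`. -/
lemma exists_solW_ball (h : IsSolOp hbar ε₀ k S) {η : ℝ} (hη : 0 < η) : ∃ r > 0, ∀ x y ε,
    |x| < r → |y| < r → |ε - ε₀| < r → solW k S x y ε ∈ M k ∧ C2Small η (solW k S x y ε) ∧
      (∀ t ∈ Icc (0 : ℝ) 1,
        E k (G hbar ε (fun s => x * w₁ k s + y * w₂ k s + solW k S x y ε s)) t = 0) ∧
      ip (w₁ k) (G hbar ε (fun s => x * w₁ k s + y * w₂ k s + solW k S x y ε s)) =
        reduced hbar k (cosPer k) ε (S (ε, kerVec k x y)) ∧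
      ip (w₂ k) (G hbar ε (fun s => x * w₁ k s + y * w₂ k s + solW k S x y ε s)) =
        reduced hbar k (sinPer k) ε (S (ε, kerVec k x y)) := by
  have hk := h.one_le
  obtain ⟨δ, hδ, hK⟩ := exists_c2Small_K hη
  obtain ⟨ρ, hρ, hs⟩ := exists_small_of_map_const
    (Q := (ContinuousLinearMap.id ℝ Per - mean.smulRight 1) ∘L projE k) (fun c => by
      change projE k _ - mean (projE k _) • (1 : Per) = 0
      rw [projE_const hk, mean_const, Algebra.algebraMap_eq_smul_one, sub_self]) h.hbar_pos h.eps_pos hδ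
  obtain ⟨r, hr, hsol⟩ := h.exists_small_ball (lt_min hρ h.hbar_pos)
  refine ⟨min (r / 2) (min ρ ε₀), lt_min (half_pos hr) (lt_min hρ h.eps_pos), fun x y ε hx hy hε => ?_⟩
  simp only [lt_min_iff] at hx hy hε
  have hε0 : ε ≠ 0 := by
    rintro rfl
    rw [zero_sub, abs_neg, abs_of_pos h.eps_pos] at hε
    exact lt_irrefl _ hε.2.2
  obtain ⟨hV, heq⟩ := hsol ε (kerVec k x y) (by linarith [hε.1])
    ((norm_kerVec_le k x y).trans_lt (by linarith [hx.1, hy.1]))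
  rw [lt_min_iff] at hV
  set V := S (ε, kerVec k x y) with hVdef
  set F : Per := -(ε ^ 2)⁻¹ • projE k (nonlin hbar V) with hF
  have hW : V - kerVec k x y = K F := by
    rw [hF, map_smul, ← projE_K hk, neg_smul]
    linear_combination (exp := 1) heq
  have hsolW : solW k S x y ε = fun t : ℝ => K F (t : UnitAddCircle) := by
    funext t; rw [solW, ← hVdef, hW]
  have hcW : mean (cosPer k * K F) = 0 := by
    rw [hF, map_smul, ← projE_K hk, mul_smul_comm, map_smul, mean_cosPer_mul_projE hk, smul_zero]
  have hsW : mean (sinPer k * K F) = 0 := by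
    rw [hF, map_smul, ← projE_K hk, mul_smul_comm, map_smul, mean_sinPer_mul_projE hk, smul_zero]
  have hd := hasDerivs_K F
  have hcV : mean (cosPer k * V) = x / 2 := by
    rw [← mean_cosPer_mul_kerVec hk x y, ← sub_eq_zero, ← map_sub, ← mul_sub, hW, hcW]
  have hsV : mean (sinPer k * V) = y / 2 := by
    rw [← mean_sinPer_mul_kerVec hk x y, ← sub_eq_zero, ← map_sub, ← mul_sub, hW, hsW]
  rw [hsolW]
  have hG := G_eq_perG (ε := ε) (v := fun s => x * w₁ k s + y * w₂ k s + K F (s : UnitAddCircle)) (V := V)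
    (V₂ := -((2 * k * Real.pi) ^ 2) • kerVec k x y + (F - algebraMap ℝ Per (mean F))) hV.2
    (fun t _ => by rw [← hW, ContinuousMap.sub_apply, kerVec_coe]; ring)
    (fun t ht => by rw [D_two_kerVec_add hd.contDiff.contDiffOn ht, hd.D_two ht]; simp)
  have hε2 : ε ^ 2 • F = -projE k (nonlin hbar V) := by
    rw [hF, smul_smul, mul_neg, mul_inv_cancel₀ (pow_ne_zero 2 hε0), neg_one_smul]
  have hmF : ε ^ 2 * mean F = -mean (nonlin hbar V) := by
    rw [← smul_eq_mul, ← map_smul, hε2, map_neg, mean_projE hk]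
  have hperG : perG hbar ε V (-((2 * k * Real.pi) ^ 2) • kerVec k x y + (F - algebraMap ℝ Per (mean F))) =
      -((2 * k * Real.pi) ^ 2 * ε ^ 2) • kerVec k x y + (nonlin hbar V - projE k (nonlin hbar V)) := by
    have e : ε ^ 2 • algebraMap ℝ Per (mean F) = -algebraMap ℝ Per (mean (nonlin hbar V)) := by
      rw [← map_neg, ← hmF, Algebra.smul_def, ← map_mul]
    rw [perG, smul_add, smul_sub, hε2, e]
    module
  rw [hperG] at hG
  refine ⟨⟨hd.mem_domG (mean_K F), ?_, ?_⟩, hK F ?_, fun t ht => ?_, ?_, ?_⟩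
  · exact (ip_eq_mean (Φ := cosPer k) (fun _ _ => rfl) (fun _ _ => rfl)).trans hcW
  · exact (ip_eq_mean (Φ := sinPer k) (fun _ _ => rfl) (fun _ _ => rfl)).trans hsW
  · convert hs ε V hε.2.1 hV.1 using 2
    simp [hF, Algebra.algebraMap_eq_smul_one, smul_sub, smul_smul]
  · rw [E_eq_projE hG ht, map_add, map_smul, projE_kerVec hk, map_sub,
      projE_eq_self (mean_cosPer_mul_projE hk _) (mean_sinPer_mul_projE hk _)]
    simp
  · rw [ip_eq_mean (φ := w₁ k) (Φ := cosPer k) (fun _ _ => rfl) hG, mul_add, mul_sub, mul_smul_comm,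
      map_add, map_sub, map_smul, mean_cosPer_mul_kerVec hk, mean_cosPer_mul_projE hk, reduced, hcV]
    simp
  · rw [ip_eq_mean (φ := w₂ k) (Φ := sinPer k) (fun _ _ => rfl) hG, mul_add, mul_sub, mul_smul_comm,
      map_add, map_sub, map_smul, mean_sinPer_mul_kerVec hk, mean_sinPer_mul_projE hk, reduced, hsV]
    simp

lemma exists_unique_solW (h : IsSolOp hbar ε₀ k S) : ∃ ρ > 0, ∀ x y ε,
    |x| < ρ → |y| < ρ → |ε - ε₀| < ρ → ∀ u ∈ M k, C2Small ρ u →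
      (∀ t ∈ Icc (0 : ℝ) 1, E k (G hbar ε (fun s => x * w₁ k s + y * w₂ k s + u s)) t = 0) →
      EqOn u (solW k S x y ε) (Icc 0 1) := by
  have hk := h.one_le
  obtain ⟨ρ, hρ, hρb, hρε, huniq⟩ := h.exists_unique_ball
  -- The three thirds bound `|x|`, `|y|` and `‖U‖`, so that the full `V` has norm below `ρ`.
  refine ⟨ρ / 3, by positivity, fun x y ε hx hy hε u hu hsmall hE => ?_⟩
  have hε0 : ε ≠ 0 := by
    rintro rfl
    rw [zero_sub, abs_neg, abs_of_pos h.eps_pos] at hε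
    linarith
  obtain ⟨⟨hsm, hbc, hbc', hmean⟩, hc, hs⟩ := hu
  obtain ⟨U, hU⟩ := exists_per_of_continuousOn hsm.continuousOn hbc
  have hUn : ‖U‖ < ρ / 3 := norm_lt_of_Icc fun t ht => by
    have := hsmall 0 (by norm_num) t ht
    rwa [D_zero, ← hU t ht] at this
  set V := kerVec k x y + U with hV
  have hVn : ‖V‖ < ρ := by
    have h1 := norm_add_le (kerVec k x y) U
    have h2 := norm_kerVec_le k x y
    rw [← hV] at h1
    linarith
  have hvV : ∀ t ∈ Icc (0 : ℝ) 1, x * w₁ k t + y * w₂ k t + u t = V (t : UnitAddCircle) := fun t ht => by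
    rw [hV, ContinuousMap.add_apply, kerVec_coe, hU t ht]
  have hcU : mean (cosPer k * U) = 0 := by
    rw [← hc]; exact (ip_eq_mean (Φ := cosPer k) (fun _ _ => rfl) (fun t ht => (hU t ht).symm)).symm
  have hsU : mean (sinPer k * U) = 0 := by
    rw [← hs]; exact (ip_eq_mean (Φ := sinPer k) (fun _ _ => rfl) (fun t ht => (hU t ht).symm)).symm
  set v : ℝ → ℝ := fun s => x * w₁ k s + y * w₂ k s + u s with hv
  set p := ip (w₁ k) (G hbar ε v)
  set q := ip (w₂ k) (G hbar ε v)
  -- `E G = 0` determines `G` only up to a kernel vector with coefficients `2p`, `2q` (the basis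
  -- functions have square mean `1/2`). The equation is solved for `u''` with this vector included,
  -- and applying `E` removes it.
  have hKF := K_eq_of_D_two hsm hbc' hmean hU
    (F := (ε ^ 2)⁻¹ • (algebraMap ℝ Per (mean (nonlin hbar V)) - nonlin hbar V + kerVec k (2 * p) (2 * q))
      + (2 * k * Real.pi) ^ 2 • kerVec k x y) (fun t ht => by
      have ht' := Ioo_subset_Icc_self ht
      have e1 := hE t ht'
      rw [E, G, integral_eq_mean (Φ := nonlin hbar V)
        (fun s hs => by rw [nonlin_apply (hVn.trans_le hρb), ← hvV s hs]), D_two_kerVec_add hsm ht',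
        show v t = V (t : UnitAddCircle) from hvV t ht', ← nonlin_apply (hVn.trans_le hρb)] at e1
      simp only [ContinuousMap.smul_apply, ContinuousMap.sub_apply, ContinuousMap.add_apply,
        Per.algebraMap_eval, smul_eq_mul, kerVec_coe] at e1 ⊢
      field_simp
      linear_combination e1)
  have hfix : V + (ε ^ 2)⁻¹ • projE k (K (nonlin hbar V)) = kerVec k x y := by
    have e1 := congrArg (projE k) hKF
    rw [projE_eq_self hcU hsU, projE_K hk] at e1
    simp only [map_add, map_sub, map_smul, projE_kerVec hk, projE_const hk, K_const, smul_zero,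
      add_zero, zero_sub, smul_neg, ← projE_K hk] at e1
    linear_combination (exp := 1) hV - e1
  have := huniq ε V _ (by linarith) hVn hfix
  intro t ht
  rw [solW, this, hV, add_sub_cancel_left, hU t ht]

end IsSolOp

/-! ### Steady states as zeros of `ray`, and the bifurcation statements. -/

lemma abs_two_mul_mean_mul_le {w : Per} (hw : ‖w‖ ≤ 1) (V : Per) : |2 * mean (w * V)| ≤ 2 * ‖V‖ := by
  have h1 := abs_mean_le (w * V)
  have h2 := norm_mul_le w V
  rw [abs_mul, abs_two]
  nlinarith [norm_nonneg V]

lemma sqrt_sq_add_sq_le (x y : ℝ) : √(x ^ 2 + y ^ 2) ≤ |x| + |y| := by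
  rw [Real.sqrt_le_left (by positivity)]
  nlinarith [abs_nonneg x, abs_nonneg y, sq_abs x, sq_abs y]

namespace IsSolOp

variable {hbar ε₀ : ℝ} {k : ℕ} {S : ℝ × Per → Per}

/-- Small solutions are translates of solutions on the ray. -/
lemma exists_ray_of_solution (h : IsSolOp hbar ε₀ k S) : ∃ ρ > 0, ∀ ε V, |ε - ε₀| < ρ → ‖V‖ < ρ →
    V + (ε ^ 2)⁻¹ • K (nonlin hbar V) = 0 → ∃ r s, 0 ≤ r ∧ r ≤ 4 * ‖V‖ ∧ ray hbar k S r ε = 0 ∧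
      V = trans s (S (ε, r • cosPer k)) := by
  have hk := h.one_le
  obtain ⟨ρ₁, hρ₁, -, hρε, huniq⟩ := h.exists_unique_ball
  obtain ⟨ρ₂, hρ₂, heq⟩ := h.exists_equivariance_ball
  obtain ⟨ρ₃, hρ₃, hred⟩ := h.exists_reduced_ball
  refine ⟨min ρ₁ (min (ρ₂ / 4) (ρ₃ / 4)), by positivity, fun ε V hε hV hsol => ?_⟩
  simp only [lt_min_iff] at hε hV
  have hε0 : ε ≠ 0 := by
    rintro rfl
    rw [zero_sub, abs_neg, abs_of_pos h.eps_pos] at hε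
    linarith [hε.1]
  set x := 2 * mean (cosPer k * V) with hx
  set y := 2 * mean (sinPer k * V) with hy
  have hxV : |x| ≤ 2 * ‖V‖ := abs_two_mul_mean_mul_le (norm_cosPer_le k) V
  have hyV : |y| ≤ 2 * ‖V‖ := abs_two_mul_mean_mul_le (norm_sinPer_le k) V
  have hr4 : √(x ^ 2 + y ^ 2) ≤ 4 * ‖V‖ := (sqrt_sq_add_sq_le x y).trans (by linarith)
  obtain ⟨s, -, -, hs⟩ := exists_polar hk x y
  set r := √(x ^ 2 + y ^ 2) with hr
  have hr0 : 0 ≤ r := Real.sqrt_nonneg _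
  have hS : S (ε, x • cosPer k + y • sinPer k) = V := by
    refine huniq ε V _ hε.1 hV.1 ?_
    have e1 := congrArg (projE k) hsol
    rw [map_add, map_smul, map_zero, projE_apply k V] at e1
    linear_combination (exp := 1) e1
  have hSt : V = trans s (S (ε, r • cosPer k)) := by
    rw [← (heq ε (r • cosPer k) (by linarith [hε.2.1])
      ((norm_smul_cosPer_le k r).trans_lt (by rw [abs_of_nonneg hr0]; linarith [hV.2.1]))).2.1 s,
      ← hs, hS]
  obtain ⟨hg1, hg2⟩ := hred ε r s (by linarith [hε.2.2])
    (by rw [abs_of_nonneg hr0]; linarith [hV.2.2])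
  rw [← hs, hS] at hg1 hg2
  -- Pairing the full equation with a kernel function `w`, an eigenfunction of `K`, is the same as
  -- the vanishing of the reduced function along `w`.
  have hzero : ∀ w : Per, K w = -((2 * k * Real.pi) ^ 2)⁻¹ • w → reduced hbar k w ε V = 0 := by
    intro w hw
    have e1 := congrArg (fun z => mean (w * z)) hsol
    simp only [mul_add, mul_smul_comm, map_add, map_smul, mul_zero, map_zero, smul_eq_mul,
      mean_mul_K_of_eigen hw] at e1
    have hω := freq_ne_zero hk
    have e2 : mean (w * V) = (ε ^ 2)⁻¹ * (((2 * k * Real.pi) ^ 2)⁻¹ * mean (w * nonlin hbar V)) := by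
      linarith
    rw [reduced, e2]
    field_simp
    ring
  rw [hzero _ (K_cosPer hk)] at hg1
  rw [hzero _ (K_sinPer hk)] at hg2
  refine ⟨r, s, hr0, hr4, ?_, hSt⟩
  have hcs : w₁ k s ^ 2 + w₂ k s ^ 2 = 1 := Real.cos_sq_add_sin_sq _
  -- The two reduced functions are `ray` times the unit vector `(w₁ k s, -w₂ k s)`, so `ray` itself
  -- vanishes.
  linear_combination (-ray hbar k S r ε) * hcs - w₁ k s * hg1 + w₂ k s * hg2

/-- Zeros of the reduced function on the ray give solutions. -/
lemma exists_solution_of_ray (h : IsSolOp hbar ε₀ k S) {δ : ℝ} (hδ : 0 < δ) : ∃ ρ > 0, ∀ ε r,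
    |ε - ε₀| < ρ → |r| < ρ → ray hbar k S r ε = 0 →
      ‖S (ε, r • cosPer k)‖ < δ ∧ mean (cosPer k * S (ε, r • cosPer k)) = r / 2 ∧
      S (ε, r • cosPer k) + (ε ^ 2)⁻¹ • K (nonlin hbar (S (ε, r • cosPer k))) = 0 := by
  have hk := h.one_le
  have hω := freq_ne_zero hk
  obtain ⟨ρ₁, hρ₁, hsol⟩ := h.exists_small_ball hδ
  obtain ⟨ρ₂, hρ₂, heq⟩ := h.exists_equivariance_ball
  obtain ⟨ρ₃, hρ₃, hm⟩ := h.mean_cosPer_mul_sol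
  refine ⟨min (min ρ₁ ρ₂) (min ρ₃ ε₀), lt_min (lt_min hρ₁ hρ₂) (lt_min hρ₃ h.eps_pos),
    fun ε r hε hr hray => ?_⟩
  simp only [lt_min_iff] at hε hr
  have hε0 : ε ≠ 0 := by
    rintro rfl
    rw [zero_sub, abs_neg, abs_of_pos h.eps_pos] at hε
    exact lt_irrefl _ hε.2.2
  obtain ⟨h1, h2⟩ := hsol ε (r • cosPer k) hε.1.1 ((norm_smul_cosPer_le k r).trans_lt hr.1.1)
  obtain ⟨h3, -, h4⟩ := heq ε (r • cosPer k) hε.1.2 ((norm_smul_cosPer_le k r).trans_lt hr.1.2)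
  have h5 := hm ε r hε.2.1 hr.2.1
  refine ⟨h1, h5, ?_⟩
  rw [map_smul reflect, reflect_cosPer] at h4
  rw [ray, reduced, h5] at hray
  set V := S (ε, r • cosPer k) with hV
  have hNr : nonlin hbar V = reflect (nonlin hbar V) := by
    conv_lhs => rw [h4]
    exact (subst_superpos _ h3 _ _ _ _).symm
  have hs : mean (sinPer k * nonlin hbar V) = 0 := by
    have := mean_sinPer_mul_reflect k (nonlin hbar V)
    rw [← hNr] at this; linarith
  rw [projE_apply, mean_mul_K_of_eigen (K_cosPer hk), mean_mul_K_of_eigen (K_sinPer hk), hs] at h2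
  have hc : mean (cosPer k * nonlin hbar V) = (2 * k * Real.pi) ^ 2 * ε ^ 2 * (r / 2) := by linarith
  -- The cosine component discarded by `E` equals `-r cosPer k` exactly when `ray` vanishes.
  -- Restoring it cancels the right-hand side of the projected equation.
  have hcoef : (ε ^ 2)⁻¹ * (2 * (-((2 * k * Real.pi) ^ 2)⁻¹ * mean (cosPer k * nonlin hbar V))) = -r := by
    rw [hc]; field_simp
  rw [smul_sub, smul_sub, smul_smul, hcoef, mul_zero, mul_zero, zero_smul, smul_zero] at h2
  rw [neg_smul] at h2
  linear_combination (exp := 1) h2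

/-- Nontrivial steady states near the bifurcation point come from zeros of the reduced function. -/
lemma exists_ray_of_steady (h : IsSolOp hbar ε₀ k S) {δ : ℝ} (hδ : 0 < δ) : ∃ η > 0, ∀ ε > 0,
    |ε - ε₀| < η → ∀ h', IsNontrivialSteadyState hbar ε h' → C2Small η (fun x => h' x - hbar) →
      ∃ r s, 0 < r ∧ r < δ ∧ ray hbar k S r ε = 0 ∧
        ∀ x ∈ Icc (0 : ℝ) 1, h' x = hbar + S (ε, r • cosPer k) ((x + s : ℝ) : UnitAddCircle) := by
  obtain ⟨ρ₁, hρ₁, h1⟩ := h.exists_ray_of_solution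
  obtain ⟨ρ₂, hρ₂, h2⟩ := h.map_zero_eventually
  refine ⟨min (min ρ₁ ρ₂) (min hbar (δ / 4)), lt_min (lt_min hρ₁ hρ₂) (lt_min h.hbar_pos (by linarith)),
    fun ε hε0 hε h' hs hsmall => ?_⟩
  obtain ⟨V, hV, hVn, hVeq⟩ := exists_per_of_isSteadyState hs.1 hε0
    ((min_le_right _ _).trans (min_le_left _ _)) hsmall
  simp only [lt_min_iff] at hε hVn
  obtain ⟨r, s, hr0, hr4, hray, hVt⟩ := h1 ε V hε.1.1 hVn.1.1 hVeq
  have hVx : ∀ x ∈ Icc (0 : ℝ) 1, h' x = hbar + S (ε, r • cosPer k) ((x + s : ℝ) : UnitAddCircle) :=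
    fun x hx => by rw [hV x hx, hVt, trans_coe]
  refine ⟨r, s, lt_of_le_of_ne hr0 ?_, by linarith [hVn.2.2], hray, hVx⟩
  rintro rfl
  obtain ⟨x, hx, hne⟩ := hs.2
  refine hne ?_
  rw [hVx x hx, zero_smul, h2 ε hε.1.2]
  simp

/-- Zeros of the reduced function give nontrivial steady states. -/
lemma exists_steady_of_ray (h : IsSolOp hbar ε₀ k S) {η : ℝ} (hη : 0 < η) : ∃ δ > 0, ∀ ε > 0,
    |ε - ε₀| < δ → ∀ r, 0 < r → r < δ → ray hbar k S r ε = 0 →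
      ∃ h', IsNontrivialSteadyState hbar ε h' ∧ C2Small η (fun x => h' x - hbar) := by
  obtain ⟨ρ₁, hρ₁, h1⟩ := exists_c2Small_of_per h.hbar_pos h.eps_pos hη
  obtain ⟨ρ₂, hρ₂, h2⟩ := h.exists_solution_of_ray (lt_min hρ₁ h.hbar_pos)
  refine ⟨min ρ₁ ρ₂, lt_min hρ₁ hρ₂, fun ε hε0 hε r hr hrδ hray => ?_⟩
  simp only [lt_min_iff] at hε hrδ
  obtain ⟨h3, h4, h5⟩ := h2 ε r hε.2 (by rw [abs_of_pos hr]; exact hrδ.2) hray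
  rw [lt_min_iff] at h3
  refine ⟨_, ⟨isSteadyState_of_per hε0 h3.2 h5, ?_⟩, h1 ε _ hε.1 h3.1 h5⟩
  -- A trivial solution would have cosine coefficient zero, whereas it is `r / 2 > 0`.
  by_contra hcon
  push Not at hcon
  have hz : S (ε, r • cosPer k) = 0 := Per.ext_Icc fun x hx => by
    have := hcon x hx
    simpa using this
  rw [hz, mul_zero, map_zero] at h4
  linarith

/-- The zeros of the reduced function where its third derivative does not vanish, up to a sign. -/
lemma zero_structure (h : IsSolOp hbar ε₀ k S) {σ : ℝ}
    (hσ : 0 < σ * iteratedDeriv 3 (fun r => ray hbar k S r ε₀) 0) :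
    (∃ δ > 0, ∀ ε, |ε - ε₀| < δ →
      (∀ r, 0 < r → r < δ → ray hbar k S r ε = 0 → σ * (ε₀ ^ 2 - ε ^ 2) < 0) ∧
      ∀ r r', 0 < r → r < δ → 0 < r' → r' < δ → ray hbar k S r ε = 0 → ray hbar k S r' ε = 0 → r = r') ∧
    ∀ η > 0, ∃ δ > 0, ∀ ε, |ε - ε₀| < δ → σ * (ε₀ ^ 2 - ε ^ 2) < 0 →
      ∃ r, 0 < r ∧ r < η ∧ ray hbar k S r ε = 0 := by
  have hσ0 : σ ≠ 0 := by rintro rfl; simp at hσ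
  have hω : 0 < (2 * (k : ℝ) * Real.pi) ^ 2 / 2 := by
    have := sq_pos_of_ne_zero (freq_ne_zero h.one_le)
    linarith
  have hm : ∀ ε, σ * ((slope hbar - (2 * k * Real.pi) ^ 2 * ε ^ 2) / 2) < 0 ↔
      σ * (ε₀ ^ 2 - ε ^ 2) < 0 := by
    intro ε
    rw [h.res, show σ * (((2 * k * Real.pi) ^ 2 * ε₀ ^ 2 - (2 * k * Real.pi) ^ 2 * ε ^ 2) / 2) =
      ((2 * (k : ℝ) * Real.pi) ^ 2 / 2) * (σ * (ε₀ ^ 2 - ε ^ 2)) by ring]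
    refine ⟨fun hneg => ?_, mul_neg_of_pos_of_neg hω⟩
    by_contra hcon
    exact absurd hneg (not_lt.2 (mul_nonneg hω.le (not_lt.1 hcon)))
  obtain ⟨ρ₁, hρ₁, hodd⟩ := h.ray_odd
  obtain ⟨ρ₂, hρ₂, hzero⟩ := h.ray_zero
  obtain ⟨ρ₃, hρ₃, hder⟩ := h.hasDerivAt_ray_zero
  have key := exists_zero_structure (F := fun r ε => σ * ray hbar k S r ε) (ε₀ := ε₀)
    (m := fun ε => σ * ((slope hbar - (2 * k * Real.pi) ^ 2 * ε ^ 2) / 2))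
    (contDiffAt_const.mul h.contDiffAt_ray)
    ⟨ρ₁, hρ₁, fun ε r hε hr => by rw [hodd ε r hε hr]; ring⟩
    ⟨ρ₂, hρ₂, fun ε hε => by rw [hzero ε hε, mul_zero]⟩
    ⟨ρ₃, hρ₃, fun ε hε => (hder ε hε).const_mul σ⟩ (by rw [h.res]; ring)
    (by rw [iteratedDeriv_const_mul_field]; exact hσ)
  simpa only [mul_eq_zero, hσ0, false_or, hm] using key

/-- With a positive cubic coefficient, zeros require a negative linear one, that is `ε > ε₀`. -/
lemma isSubcritical (h : IsSolOp hbar ε₀ k S)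
    (h3 : 0 < iteratedDeriv 3 (fun r => ray hbar k S r ε₀) 0) : IsSubcritical hbar ε₀ := by
  have hε₀ := h.eps_pos
  obtain ⟨⟨δ, hδ, hA⟩, hB⟩ := h.zero_structure (σ := 1) (by rwa [one_mul])
  refine ⟨?_, fun η hη => ?_⟩
  · obtain ⟨η, hη, hst⟩ := h.exists_ray_of_steady hδ
    refine ⟨min η δ, lt_min hη hδ, fun ε hε0 hε h' hs hsmall => ?_⟩
    rw [lt_min_iff] at hε
    obtain ⟨r, s, hr, hrδ, hray, -⟩ := hst ε hε0 hε.1 h' hs fun n hn x hx =>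
      (hsmall n hn x hx).trans_le (min_le_left _ _)
    have := (hA ε hε.2).1 r hr hrδ hray
    refine one_div_lt_one_div_of_lt hε₀ ?_
    by_contra hcon
    nlinarith
  · obtain ⟨δ₁, hδ₁, hst⟩ := h.exists_steady_of_ray hη
    obtain ⟨δ₂, hδ₂, hB⟩ := hB δ₁ hδ₁
    -- The first bound forces `ε < 2 ε₀`, so `ε ε₀ < 2 ε₀²`; the second then turns closeness of the
    -- reciprocals into closeness of `ε` to `ε₀`.
    refine ⟨min (1 / (2 * ε₀)) (min δ₁ δ₂ / (2 * ε₀ ^ 2)), by positivity, fun ε hε0 h1 h2 => ?_⟩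
    have hlt : ε₀ < ε := (one_div_lt_one_div hε0 hε₀).1 h2
    have h1a : 1 / ε₀ - 1 / (2 * ε₀) < 1 / ε :=
      (sub_le_sub_left (min_le_left _ _) _).trans_lt h1
    have h1b : 1 / ε₀ - min δ₁ δ₂ / (2 * ε₀ ^ 2) < 1 / ε :=
      (sub_le_sub_left (min_le_right _ _) _).trans_lt h1
    have hup : ε < 2 * ε₀ := by
      refine (one_div_lt_one_div (by positivity) hε0).1 (lt_of_eq_of_lt ?_ h1a)
      field_simp
      norm_num
    have hd : |ε - ε₀| < min δ₁ δ₂ := by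
      rw [abs_of_pos (by linarith)]
      have e1 : ε - ε₀ = (1 / ε₀ - 1 / ε) * (ε * ε₀) := by field_simp
      have e2 : 1 / ε₀ - 1 / ε < min δ₁ δ₂ / (2 * ε₀ ^ 2) := by linarith
      have e3 : ε * ε₀ < 2 * ε₀ ^ 2 := by nlinarith
      have e4 : 0 < 1 / ε₀ - 1 / ε := by linarith
      calc ε - ε₀ = (1 / ε₀ - 1 / ε) * (ε * ε₀) := e1
        _ < min δ₁ δ₂ / (2 * ε₀ ^ 2) * (2 * ε₀ ^ 2) :=
          mul_lt_mul'' e2 e3 e4.le (by positivity)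
        _ = min δ₁ δ₂ := by field_simp
    rw [lt_min_iff] at hd
    obtain ⟨r, hr, hrδ, hray⟩ := hB ε hd.2 (by nlinarith)
    exact hst ε hε0 hd.1 r hr hrδ hray

lemma isSupercritical (h : IsSolOp hbar ε₀ k S)
    (h3 : iteratedDeriv 3 (fun r => ray hbar k S r ε₀) 0 < 0) : IsSupercritical hbar ε₀ := by
  have hε₀ := h.eps_pos
  obtain ⟨⟨δ, hδ, hA⟩, hB⟩ := h.zero_structure (σ := -1) (by linarith)
  refine ⟨?_, fun η hη => ?_⟩
  · obtain ⟨η, hη, hst⟩ := h.exists_ray_of_steady hδ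
    refine ⟨min η δ, lt_min hη hδ, fun ε hε0 hε h' hs hsmall => ?_⟩
    rw [lt_min_iff] at hε
    obtain ⟨r, s, hr, hrδ, hray, -⟩ := hst ε hε0 hε.1 h' hs fun n hn x hx =>
      (hsmall n hn x hx).trans_le (min_le_left _ _)
    have := (hA ε hε.2).1 r hr hrδ hray
    refine one_div_lt_one_div_of_lt hε0 ?_
    by_contra hcon
    nlinarith
  · obtain ⟨δ₁, hδ₁, hst⟩ := h.exists_steady_of_ray hη
    obtain ⟨δ₂, hδ₂, hB⟩ := hB δ₁ hδ₁
    -- Here `ε < ε₀`, so `ε ε₀ < ε₀²` holds without a separate bound on `ε`.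
    refine ⟨min δ₁ δ₂ / ε₀ ^ 2, by positivity, fun ε hε0 h1 h2 => ?_⟩
    have hlt : ε < ε₀ := (one_div_lt_one_div hε₀ hε0).1 h1
    have hd : |ε - ε₀| < min δ₁ δ₂ := by
      rw [abs_sub_comm, abs_of_pos (by linarith)]
      have e1 : ε₀ - ε = (1 / ε - 1 / ε₀) * (ε * ε₀) := by field_simp
      have e3 : ε * ε₀ < ε₀ ^ 2 := by nlinarith
      calc ε₀ - ε = (1 / ε - 1 / ε₀) * (ε * ε₀) := e1
        _ < min δ₁ δ₂ / ε₀ ^ 2 * ε₀ ^ 2 :=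
          mul_lt_mul'' (by linarith) e3 (by linarith) (by positivity)
        _ = min δ₁ δ₂ := by field_simp
    rw [lt_min_iff] at hd
    obtain ⟨r, hr, hrδ, hray⟩ := hB ε hd.2 (by nlinarith)
    exact hst ε hε0 hd.1 r hr hrδ hray

/-- Every nearby nontrivial steady state is a translate of the one at a positive zero of `ray`, and
that zero is unique when the cubic coefficient is nonzero. -/
lemma isLocallyOneCircle (h : IsSolOp hbar ε₀ k S)
    (h3 : iteratedDeriv 3 (fun r => ray hbar k S r ε₀) 0 ≠ 0) : IsLocallyOneCircle hbar ε₀ := by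
  obtain ⟨⟨δ, hδ, hA⟩, -⟩ := h.zero_structure
    (σ := iteratedDeriv 3 (fun r => ray hbar k S r ε₀) 0) (mul_self_pos.2 h3)
  obtain ⟨η, hη, hst⟩ := h.exists_ray_of_steady hδ
  refine ⟨min η δ, lt_min hη hδ, fun ε hε0 hε h₁ h₂ hs₁ hsm₁ hs₂ hsm₂ => ?_⟩
  rw [lt_min_iff] at hε
  obtain ⟨r₁, s₁, hr₁, hrδ₁, hray₁, hx₁⟩ := hst ε hε0 hε.1 h₁ hs₁ fun n hn x hx =>
    (hsm₁ n hn x hx).trans_le (min_le_left _ _)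
  obtain ⟨r₂, s₂, hr₂, hrδ₂, hray₂, hx₂⟩ := hst ε hε0 hε.1 h₂ hs₂ fun n hn x hx =>
    (hsm₂ n hn x hx).trans_le (min_le_left _ _)
  obtain rfl := (hA ε hε.2).2 r₁ r₂ hr₁ hrδ₁ hr₂ hrδ₂ hray₁ hray₂
  refine ⟨s₂ - s₁, fun x hx => ?_⟩
  rw [hx₂ x hx, hx₁ _ ⟨Int.fract_nonneg _, (Int.fract_lt_one _).le⟩, AddCircle.coe_add (1 : ℝ) (Int.fract _),
    Per.coe_fract, ← AddCircle.coe_add]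
  congr 3
  ring

/-- Only the sign change of the linear coefficient enters, so the degenerate thicknesses `hMinus`
and `hPlus` are covered. -/
lemma isBifurcationPoint (h : IsSolOp hbar ε₀ k S) : IsBifurcationPoint hbar ε₀ := by
  intro η hη
  have hε₀ := h.eps_pos
  have hω := sq_pos_of_ne_zero (freq_ne_zero h.one_le)
  obtain ⟨δ, hδ, hst⟩ := h.exists_steady_of_ray hη
  obtain ⟨r, ε, hr, hrδ, hε, hray⟩ := exists_zero_of_sign_change (F := ray hbar k S) (ε₀ := ε₀)
    (m := fun ε => (slope hbar - (2 * k * Real.pi) ^ 2 * ε ^ 2) / 2)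
    h.contDiffAt_ray h.ray_zero h.hasDerivAt_ray_zero
    (fun ε hε => by
      rw [h.res]
      have : ε₀ ^ 2 < ε ^ 2 := by nlinarith
      nlinarith)
    ⟨ε₀, hε₀, fun ε h1 h2 => by
      rw [h.res]
      have : ε ^ 2 < ε₀ ^ 2 := by nlinarith
      nlinarith⟩ (lt_min (lt_min hδ hη) hε₀)
  simp only [lt_min_iff] at hrδ hε
  have hε0 : 0 < ε := by linarith [(abs_lt.1 hε.2).1]
  exact ⟨ε, hε0, hε.1.2, hst ε hε0 hε.1.1 r hr hrδ.1.1 hray⟩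

end IsSolOp

/-- There is no bifurcation where the linearization is invertible. -/
lemma not_isBifurcationPoint {hbar ε₀ : ℝ} (hb : 0 < hbar) (hε : 0 < ε₀)
    (hne : ∀ n : ℕ, 1 ≤ n → slope hbar / ε₀ ^ 2 ≠ (2 * n * Real.pi) ^ 2) :
    ¬ IsBifurcationPoint hbar ε₀ := by
  intro hbif
  obtain ⟨S, -, -, hu⟩ := exists_solution_operator (T := K) K_const isCompactOperator_K hb hε.ne'
    (fun u hu => eq_zero_of_add_smul_K_eq_zero hu fun n hn h => absurd h (hne n hn))
  obtain ⟨ρ, hρ, hu⟩ := eventually_prod_iff_ball (P := fun ε v => S (phi K hbar (ε, v)) = v) hu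
  obtain ⟨ε, hε0, hεr, h, hs, hsmall⟩ := hbif (min ρ hbar) (lt_min hρ hb)
  obtain ⟨V, hV, hVn, hVeq⟩ := exists_per_of_isSteadyState hs.1 hε0 (min_le_right _ _) hsmall
  rw [lt_min_iff] at hVn hεr
  have h1 := hu ε V hεr.1 hVn.1
  have h2 := hu ε 0 hεr.1 (by simpa using hρ)
  -- `V` and `0` have the same image under `phi`, which is injective near `(ε₀, 0)`.
  have e1 : phi K hbar (ε, V) = (ε, 0) := by simp only [phi, hVeq]
  have e2 : phi K hbar (ε, 0) = (ε, 0) := by simp [phi, nonlin_zero hb, K_const]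
  rw [e1] at h1
  rw [e2, h1] at h2
  obtain ⟨x, hx, hxne⟩ := hs.2
  exact hxne (by rw [hV x hx, h2]; simp)

/-! ### Explicit coefficients, the thresholds, and the set of bifurcation points. -/

lemma deriv_f {hbar : ℝ} (hb : 0 < hbar) : deriv f hbar = slope hbar := by
  have h0 := hb.ne'
  have h6 : HasDerivAt (fun h : ℝ => h ^ 6) (6 * hbar ^ 5) hbar := by simpa using hasDerivAt_pow 6 hbar
  have h3 : HasDerivAt (fun h : ℝ => h ^ 3) (3 * hbar ^ 2) hbar := by simpa using hasDerivAt_pow 3 hbar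
  have h := (h6.fun_inv (pow_ne_zero 6 h0)).fun_sub (h3.fun_inv (pow_ne_zero 3 h0))
  have e : f = fun h : ℝ => (h ^ 6)⁻¹ - (h ^ 3)⁻¹ := by funext h; simp [f]
  rw [e, h.deriv, slope]
  field_simp
  ring

lemma slope_eq {hbar : ℝ} (hb : 0 < hbar) : slope hbar = 3 * (hbar ^ 3 - 2) / hbar ^ 7 := by
  rw [slope]; field_simp; ring

lemma slope_pos_iff {hbar : ℝ} (hb : 0 < hbar) : 0 < slope hbar ↔ 2 < hbar ^ 3 := by
  rw [slope_eq hb, div_pos_iff_of_pos_right (by positivity)]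
  constructor <;> intro h <;> linarith

lemma third_derivative_eq {hbar : ℝ} (hb : 0 < hbar) (h2 : 2 < hbar ^ 3) :
    slope₂ hbar ^ 2 / (8 * slope hbar) + 3 * slope₃ hbar / 8 =
      (57 * hbar ^ 6 - 426 * hbar ^ 3 + 651) / (2 * hbar ^ 9 * (hbar ^ 3 - 2)) := by
  have h : hbar ^ 3 - 2 ≠ 0 := by linarith
  rw [slope_eq hb, slope₂, slope₃]
  field_simp
  ring

lemma rpow_third_pow {a : ℝ} (ha : 0 ≤ a) : (a ^ (1 / 3 : ℝ)) ^ 3 = a := by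
  rw [← Real.rpow_natCast, ← Real.rpow_mul ha]
  norm_num

lemma hZero_pow : hZero ^ 3 = 2 := rpow_third_pow zero_le_two

lemma sqrt_102_bounds : 10.0995 < √102 ∧ √102 < 10.0996 :=
  ⟨Real.lt_sqrt_of_sq_lt (by norm_num), by rw [Real.sqrt_lt' (by norm_num)]; norm_num⟩

lemma hMinus_pow : hMinus ^ 3 = (71 - 3 * √102) / 19 :=
  rpow_third_pow (by have := sqrt_102_bounds.2; linarith)

lemma hPlus_pow : hPlus ^ 3 = (71 + 3 * √102) / 19 := rpow_third_pow (by positivity)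

lemma hZero_nonneg : 0 ≤ hZero := by unfold hZero; positivity

lemma hMinus_nonneg : 0 ≤ hMinus :=
  Real.rpow_nonneg (by have := sqrt_102_bounds.2; linarith) _

lemma hPlus_nonneg : 0 ≤ hPlus := by unfold hPlus; positivity

lemma lt_iff_pow_three_lt {a b : ℝ} (ha : 0 ≤ a) (hb : 0 ≤ b) : a < b ↔ a ^ 3 < b ^ 3 :=
  (pow_lt_pow_iff_left₀ ha hb three_ne_zero).symm

lemma hZero_lt_iff {hbar : ℝ} (hb : 0 < hbar) : hZero < hbar ↔ 2 < hbar ^ 3 := by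
  rw [lt_iff_pow_three_lt hZero_nonneg hb.le, hZero_pow]

lemma hZero_bounds : 1.259 < hZero ∧ hZero < 1.26 := by
  rw [lt_iff_pow_three_lt (by norm_num) hZero_nonneg, lt_iff_pow_three_lt hZero_nonneg (by norm_num),
    hZero_pow]
  norm_num

lemma abs_hMinus_sub_lt : |hMinus - 1.289| < 0.0005 := by
  obtain ⟨h1, h2⟩ := sqrt_102_bounds
  have e1 : 1.2885 < hMinus := by
    rw [lt_iff_pow_three_lt (by norm_num) hMinus_nonneg, hMinus_pow]; norm_num at *; linarith
  have e2 : hMinus < 1.2895 := by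
    rw [lt_iff_pow_three_lt hMinus_nonneg (by norm_num), hMinus_pow]; norm_num at *; linarith
  rw [abs_lt]; constructor <;> norm_num at * <;> linarith

lemma abs_hPlus_sub_lt : |hPlus - 1.747| < 0.0005 := by
  obtain ⟨h1, h2⟩ := sqrt_102_bounds
  have e1 : 1.7465 < hPlus := by
    rw [lt_iff_pow_three_lt (by norm_num) hPlus_nonneg, hPlus_pow]; norm_num at *; linarith
  have e2 : hPlus < 1.7475 := by
    rw [lt_iff_pow_three_lt hPlus_nonneg (by norm_num), hPlus_pow]; norm_num at *; linarith
  rw [abs_lt]; constructor <;> norm_num at * <;> linarith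

/-- Factorization of a quadratic in `hbar³`; it decides the sign of the cubic coefficient. -/
lemma numerator_eq (hbar : ℝ) : 57 * hbar ^ 6 - 426 * hbar ^ 3 + 651 =
    57 * ((hbar ^ 3 - hMinus ^ 3) * (hbar ^ 3 - hPlus ^ 3)) := by
  have h := Real.sq_sqrt (show (0 : ℝ) ≤ 102 by norm_num)
  rw [hMinus_pow, hPlus_pow]
  linear_combination (57 * 9 / 361 : ℝ) * h

lemma hMinus_pow_lt_hPlus_pow : hMinus ^ 3 < hPlus ^ 3 := by
  have := sqrt_102_bounds.1
  rw [hMinus_pow, hPlus_pow]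
  linarith

lemma epsK_pos {hbar : ℝ} (hb : 0 < hbar) (h2 : 2 < hbar ^ 3) {k : ℕ} (hk : 1 ≤ k) :
    0 < epsK hbar k := by
  have hs := (slope_pos_iff hb).2 h2
  have : (0 : ℝ) < k := by exact_mod_cast hk
  have := Real.pi_pos
  rw [epsK, deriv_f hb]
  positivity

lemma slope_eq_epsK {hbar : ℝ} (hb : 0 < hbar) (h2 : 2 < hbar ^ 3) {k : ℕ} (hk : 1 ≤ k) :
    slope hbar = (2 * k * Real.pi) ^ 2 * epsK hbar k ^ 2 := by
  have hs := (slope_pos_iff hb).2 h2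
  have := freq_ne_zero hk
  rw [epsK, deriv_f hb, div_pow, Real.sq_sqrt hs.le]
  field_simp

lemma isBifurcationPoint_iff {hbar : ℝ} (hb : 0 < hbar) {ε₀ : ℝ} (hε : 0 < ε₀) :
    IsBifurcationPoint hbar ε₀ ↔ hZero < hbar ∧ ∃ k : ℕ, 1 ≤ k ∧ ε₀ = epsK hbar k := by
  rw [hZero_lt_iff hb]
  refine ⟨fun h => ?_, ?_⟩
  · by_contra hcon
    refine not_isBifurcationPoint hb hε (fun n hn heq => hcon ?_) h
    rw [div_eq_iff (by positivity)] at heq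
    have hω := sq_pos_of_ne_zero (freq_ne_zero hn)
    have hs : 0 < slope hbar := by rw [heq]; positivity
    have h2 := (slope_pos_iff hb).1 hs
    refine ⟨h2, n, hn, ?_⟩
    rw [slope_eq_epsK hb h2 hn] at heq
    have := mul_left_cancel₀ hω.ne' heq
    exact ((pow_left_inj₀ (epsK_pos hb h2 hn).le hε.le two_ne_zero).1 this).symm
  · rintro ⟨h2, k, hk, rfl⟩
    obtain ⟨S, hS⟩ := exists_isSolOp hb hε hk (slope_eq_epsK hb h2 hk)
    exact hS.isBifurcationPoint

/-! ### Comparison of an arbitrary Liapunov–Schmidt reduction with the one from `S`. -/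

namespace IsSolOp

variable {hbar : ℝ} {k : ℕ} {S : ℝ × Per → Per}

lemma isLiapunovSchmidtReduction (h : IsSolOp hbar (epsK hbar k) k S) :
    IsLiapunovSchmidtReduction hbar k
      (fun x y ε => reduced hbar k (cosPer k) ε (S (ε, kerVec k x y)))
      (fun x y ε => reduced hbar k (sinPer k) ε (S (ε, kerVec k x y))) := by
  obtain ⟨η, hη, hu⟩ := h.exists_unique_solW
  obtain ⟨r, hr, hW⟩ := h.exists_solW_ball hη
  refine ⟨solW k S, min r η, lt_min hr hη, η, hη, fun x y ε hx hy hε => ?_⟩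
  rw [lt_min_iff] at hx hy hε
  obtain ⟨h1, h2, h3, h4, h5⟩ := hW x y ε hx.1 hy.1 hε.1
  exact ⟨fun u huM hsmall hE => hu x y ε hx.2 hy.2 hε.2 u huM hsmall hE, h1, h2, h3, h4.symm, h5.symm⟩

/-- An arbitrary reduction has its own radius `η` of uniqueness. Near the base point `solW` is
smaller than `η` and solves the same equation, so it coincides with the given `W` on `[0,1]`.
Smoothness, symmetry and the cubic coefficient thus transfer to every reduction. -/
lemma eventually_eq_reduced (h : IsSolOp hbar (epsK hbar k) k S) {g₁ g₂ : ℝ → ℝ → ℝ → ℝ}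
    (hg : IsLiapunovSchmidtReduction hbar k g₁ g₂) :
    ∀ᶠ q : ℝ × ℝ × ℝ in 𝓝 (0, 0, epsK hbar k),
      g₁ q.1 q.2.1 q.2.2 = reduced hbar k (cosPer k) q.2.2 (S (q.2.2, kerVec k q.1 q.2.1)) ∧
      g₂ q.1 q.2.1 q.2.2 = reduced hbar k (sinPer k) q.2.2 (S (q.2.2, kerVec k q.1 q.2.1)) := by
  obtain ⟨W, r, hr, η, hη, hW⟩ := hg
  obtain ⟨r', hr', hW'⟩ := h.exists_solW_ball hη
  filter_upwards [Metric.ball_mem_nhds _ (lt_min hr hr')] with q hq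
  rw [Metric.mem_ball, Prod.dist_eq, Prod.dist_eq] at hq
  simp only [max_lt_iff, lt_min_iff, Real.dist_eq, sub_zero] at hq
  obtain ⟨⟨hx, hy, hε⟩, hx', hy', hε'⟩ := hq
  obtain ⟨h1, h2, h3, h4, h5⟩ := hW' q.1 q.2.1 q.2.2 hx' hy' hε'
  obtain ⟨hu, -, -, -, hg1, hg2⟩ := hW q.1 q.2.1 q.2.2 hx hy hε
  have he := hu _ h1 h2 h3
  have hv : EqOn (fun s => q.1 * w₁ k s + q.2.1 * w₂ k s + solW k S q.1 q.2.1 q.2.2 s)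
      (fun s => q.1 * w₁ k s + q.2.1 * w₂ k s + W q.1 q.2.1 q.2.2 s) (Icc 0 1) := fun s hs => by
    simp only [he hs]
  have hG : ∀ w, ip w (G hbar q.2.2
      (fun s => q.1 * w₁ k s + q.2.1 * w₂ k s + W q.1 q.2.1 q.2.2 s)) =
      ip w (G hbar q.2.2
        (fun s => q.1 * w₁ k s + q.2.1 * w₂ k s + solW k S q.1 q.2.1 q.2.2 s)) := by
    intro w
    refine intervalIntegral.integral_congr fun t ht => ?_
    rw [uIcc_of_le zero_le_one] at ht
    simp only [G]
    rw [D_congr hv ht, he ht]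
    congr 2
    refine intervalIntegral.integral_congr fun s hs => ?_
    rw [uIcc_of_le zero_le_one] at hs
    simp only [he hs]
  rw [hg1, hg2, hG, hG, h4, h5]
  exact ⟨rfl, rfl⟩

lemma contDiffAt_reduced_kerVec {ε₀ : ℝ} (h : IsSolOp hbar ε₀ k S) (w : Per) :
    ContDiffAt ℝ ω (fun q : ℝ × ℝ × ℝ => reduced hbar k w q.2.2 (S (q.2.2, kerVec k q.1 q.2.1)))
      (0, 0, ε₀) := by
  have h1 : ContDiffAt ℝ ω (fun q : ℝ × ℝ × ℝ => (q.2.2, kerVec k q.1 q.2.1)) (0, 0, ε₀) := by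
    unfold kerVec
    exact (contDiffAt_snd.comp _ contDiffAt_snd).prodMk
      ((contDiffAt_fst.smul contDiffAt_const).add
        ((contDiffAt_fst.comp _ contDiffAt_snd).smul contDiffAt_const))
  refine ContDiffAt.comp (g := fun p : ℝ × Per => reduced hbar k w p.1 (S p)) (0, 0, ε₀) ?_ h1
  simpa [kerVec] using h.contDiffAt_reduced w

lemma exists_radial {ε₀ : ℝ} (h : IsSolOp hbar ε₀ k S) : ∃ p : ℝ → ℝ → ℝ,
    ∀ᶠ q : ℝ × ℝ × ℝ in 𝓝 (0, 0, ε₀),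
      reduced hbar k (cosPer k) q.2.2 (S (q.2.2, kerVec k q.1 q.2.1)) =
        q.1 * p (q.1 ^ 2 + q.2.1 ^ 2) q.2.2 ∧
      reduced hbar k (sinPer k) q.2.2 (S (q.2.2, kerVec k q.1 q.2.1)) =
        q.2.1 * p (q.1 ^ 2 + q.2.1 ^ 2) q.2.2 := by
  obtain ⟨ρ, hρ, hred⟩ := h.exists_reduced_ball
  obtain ⟨ρ', hρ', hz⟩ := h.ray_zero
  -- At `s = 0` the quotient is `0 / 0 = 0`, which is harmless since `ray` vanishes at `r = 0`.
  refine ⟨fun s ε => ray hbar k S (√s) ε / √s, ?_⟩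
  filter_upwards [Metric.ball_mem_nhds _ (lt_min (half_pos hρ) hρ')] with q hq
  rw [Metric.mem_ball, Prod.dist_eq, Prod.dist_eq] at hq
  simp only [max_lt_iff, lt_min_iff, Real.dist_eq, sub_zero] at hq
  obtain ⟨⟨hx, hy, hε⟩, -, -, hε'⟩ := hq
  obtain ⟨s, hs1, hs2, hs3⟩ := exists_polar h.one_le q.1 q.2.1
  have hr0 : 0 ≤ √(q.1 ^ 2 + q.2.1 ^ 2) := Real.sqrt_nonneg _
  have hr := sqrt_sq_add_sq_le q.1 q.2.1
  obtain ⟨h1, h2⟩ := hred q.2.2 (√(q.1 ^ 2 + q.2.1 ^ 2)) s (by linarith)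
    (by rw [abs_of_nonneg hr0]; linarith)
  rw [← hs3] at h1 h2
  have hkv : kerVec k q.1 q.2.1 = q.1 • cosPer k + q.2.1 • sinPer k := rfl
  rw [hkv, h1, h2]
  set r := √(q.1 ^ 2 + q.2.1 ^ 2) with hrdef
  rcases eq_or_ne r 0 with h0 | h0
  · rw [h0, hz q.2.2 hε']; simp
  · constructor
    · rw [← hs1]; field_simp
    · rw [← hs2]; field_simp

end IsSolOp

end ThinFilm

end

/-! ### Assembly of the main theorem. -/

theorem proposition1 :
    -- numerical values of the thresholds
    ((1.259 < ThinFilm.hZero ∧ ThinFilm.hZero < 1.26) ∧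
      |ThinFilm.hMinus - 1.289| < 0.0005 ∧ |ThinFilm.hPlus - 1.747| < 0.0005) ∧
    ∀ hbar : ℝ, 0 < hbar →
      -- location of all bifurcations from the constant solution
      (∀ ε₀ > 0, ThinFilm.IsBifurcationPoint hbar ε₀ ↔
        ThinFilm.hZero < hbar ∧ ∃ k : ℕ, 1 ≤ k ∧ ε₀ = ThinFilm.epsK hbar k) ∧
      ∀ k : ℕ, 1 ≤ k →
        -- direction of the bifurcations
        (ThinFilm.hMinus < hbar ∧ hbar < ThinFilm.hPlus →
          ThinFilm.IsSupercritical hbar (ThinFilm.epsK hbar k)) ∧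
        ((ThinFilm.hZero < hbar ∧ hbar < ThinFilm.hMinus) ∨ ThinFilm.hPlus < hbar →
          ThinFilm.IsSubcritical hbar (ThinFilm.epsK hbar k)) ∧
        (ThinFilm.hZero < hbar → hbar ≠ ThinFilm.hMinus → hbar ≠ ThinFilm.hPlus →
          ThinFilm.IsLocallyOneCircle hbar (ThinFilm.epsK hbar k)) ∧
        -- the Liapunov–Schmidt reduction and the coefficient that decides the direction
        (ThinFilm.hZero < hbar →
          (∃ g₁ g₂, ThinFilm.IsLiapunovSchmidtReduction hbar k g₁ g₂) ∧
          ∀ g₁ g₂, ThinFilm.IsLiapunovSchmidtReduction hbar k g₁ g₂ →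
            ContDiffAt ℝ ∞ (fun q : ℝ × ℝ × ℝ => g₁ q.1 q.2.1 q.2.2)
              (0, 0, ThinFilm.epsK hbar k) ∧
            ContDiffAt ℝ ∞ (fun q : ℝ × ℝ × ℝ => g₂ q.1 q.2.1 q.2.2)
              (0, 0, ThinFilm.epsK hbar k) ∧
            (∃ p : ℝ → ℝ → ℝ,
              ∀ᶠ q : ℝ × ℝ × ℝ in 𝓝 (0, 0, ThinFilm.epsK hbar k),
                g₁ q.1 q.2.1 q.2.2 = q.1 * p (q.1 ^ 2 + q.2.1 ^ 2) q.2.2 ∧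
                g₂ q.1 q.2.1 q.2.2 = q.2.1 * p (q.1 ^ 2 + q.2.1 ^ 2) q.2.2) ∧
            ThinFilm.dxxx g₁ (ThinFilm.epsK hbar k) =
              (57 * hbar ^ 6 - 426 * hbar ^ 3 + 651) / (2 * hbar ^ 9 * (hbar ^ 3 - 2)) ∧
            (ThinFilm.dxxx g₁ (ThinFilm.epsK hbar k) < 0 →
              ThinFilm.IsSupercritical hbar (ThinFilm.epsK hbar k)) ∧
            (0 < ThinFilm.dxxx g₁ (ThinFilm.epsK hbar k) →
              ThinFilm.IsSubcritical hbar (ThinFilm.epsK hbar k))) := by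
  open ThinFilm in
  refine ⟨⟨hZero_bounds, abs_hMinus_sub_lt, abs_hPlus_sub_lt⟩, fun hbar hb =>
    ⟨fun ε₀ hε => isBifurcationPoint_iff hb hε, fun k hk => ?_⟩⟩
  have hsol : 2 < hbar ^ 3 → ∃ S, IsSolOp hbar (epsK hbar k) k S ∧
      iteratedDeriv 3 (fun r => ray hbar k S r (epsK hbar k)) 0 =
        (57 * hbar ^ 6 - 426 * hbar ^ 3 + 651) / (2 * hbar ^ 9 * (hbar ^ 3 - 2)) := fun h2 => by
    obtain ⟨S, hS⟩ := exists_isSolOp hb (epsK_pos hb h2 hk) hk (slope_eq_epsK hb h2 hk)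
    exact ⟨S, hS, hS.iteratedDeriv_ray.trans (third_derivative_eq hb h2)⟩
  have hden : 2 < hbar ^ 3 → 0 < 2 * hbar ^ 9 * (hbar ^ 3 - 2) := fun h2 =>
    mul_pos (by positivity) (by linarith)
  -- Both thresholds `hMinus` and `hPlus` lie above `hZero`, so the resonance `ε_k` exists in every
  -- case where a direction is claimed.
  have hM2 : 2 < hMinus ^ 3 := by
    have := sqrt_102_bounds.2
    rw [hMinus_pow]
    linarith
  have hMP := hMinus_pow_lt_hPlus_pow
  refine ⟨?_, ?_, ?_, ?_⟩
  · rintro ⟨h1, h2⟩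
    rw [lt_iff_pow_three_lt hMinus_nonneg hb.le] at h1
    rw [lt_iff_pow_three_lt hb.le hPlus_nonneg] at h2
    obtain ⟨S, hS, h3⟩ := hsol (hM2.trans h1)
    refine hS.isSupercritical ?_
    rw [h3, numerator_eq]
    exact div_neg_of_neg_of_pos (by nlinarith) (hden (hM2.trans h1))
  · intro h
    have h2 : 2 < hbar ^ 3 ∧ 0 < (hbar ^ 3 - hMinus ^ 3) * (hbar ^ 3 - hPlus ^ 3) := by
      rcases h with ⟨h0, h1⟩ | h1
      · rw [hZero_lt_iff hb] at h0
        rw [lt_iff_pow_three_lt hb.le hMinus_nonneg] at h1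
        exact ⟨h0, mul_pos_of_neg_of_neg (by linarith) (by linarith)⟩
      · rw [lt_iff_pow_three_lt hPlus_nonneg hb.le] at h1
        exact ⟨by linarith, mul_pos (by linarith) (by linarith)⟩
    obtain ⟨S, hS, h3⟩ := hsol h2.1
    refine hS.isSubcritical ?_
    rw [h3, numerator_eq]
    exact div_pos (by linarith [h2.2]) (hden h2.1)
  · intro h0 h1 h2
    rw [hZero_lt_iff hb] at h0
    obtain ⟨S, hS, h3⟩ := hsol h0
    refine hS.isLocallyOneCircle ?_
    rw [h3, numerator_eq]
    refine div_ne_zero (mul_ne_zero (by norm_num) (mul_ne_zero (sub_ne_zero.2 fun h => h1 ?_)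
      (sub_ne_zero.2 fun h => h2 ?_))) (hden h0).ne'
    · exact (pow_left_inj₀ hb.le hMinus_nonneg three_ne_zero).1 h
    · exact (pow_left_inj₀ hb.le hPlus_nonneg three_ne_zero).1 h
  · intro h0
    rw [hZero_lt_iff hb] at h0
    obtain ⟨S, hS, h3⟩ := hsol h0
    refine ⟨⟨_, _, hS.isLiapunovSchmidtReduction⟩, fun g₁ g₂ hg => ?_⟩
    have he := hS.eventually_eq_reduced hg
    have hd : dxxx g₁ (epsK hbar k) = iteratedDeriv 3 (fun r => ray hbar k S r (epsK hbar k)) 0 := by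
      have hline : Tendsto (fun r : ℝ => (r, (0 : ℝ), epsK hbar k)) (𝓝 0) (𝓝 (0, 0, epsK hbar k)) :=
        (Continuous.prodMk_left ((0 : ℝ), epsK hbar k)).tendsto 0
      refine Filter.EventuallyEq.iteratedDeriv_eq 3 ?_
      filter_upwards [hline.eventually he] with r hr
      rw [hr.1, ray, kerVec, zero_smul, add_zero]
    refine ⟨?_, ?_, ?_, hd.trans h3, fun h => hS.isSupercritical (hd ▸ h),
      fun h => hS.isSubcritical (hd ▸ h)⟩
    · exact ((hS.contDiffAt_reduced_kerVec (cosPer k)).of_le le_top).congr_of_eventuallyEq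
        (he.mono fun q hq => hq.1)
    · exact ((hS.contDiffAt_reduced_kerVec (sinPer k)).of_le le_top).congr_of_eventuallyEq
        (he.mono fun q hq => hq.2)
    · obtain ⟨p, hp⟩ := hS.exists_radial
      refine ⟨p, ?_⟩
      filter_upwards [he, hp] with q h1 h2
      exact ⟨h1.1.trans h2.1, h1.2.trans h2.2⟩
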